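/- **Setting.** Let $\Omega\subset\mathbb R^d$ be open and let $V$ be a closed subspace of $H^1_0(\Omega)$ (complex-valued functions, $H^1_0(\Omega)$ being the closure of $C_c^\infty(\Omega)$ in the $H^1$-norm). Let $X$ be the closure of $V$ in $L^2(\Omega)$ and let $A$ be the operator in $X$ with $$Au=w\iff u\in V,\ w\in X,\quad (w,\varphi)_{L^2(\Omega)}=-(\nabla u,\nabla\varphi)_{L^2(\Omega)}\quad\forall\varphi\in V .$$ For $V=H_0^1(\Omega)$ this is the Laplacian with homogeneous Dirichlet boundary condition in $X=L^2(\Omega)$; for a finite-dimensional (finite element) space $V$ it is the Galerkin approximation $\Delta_h$. Let $r(A)=\sup\{|(Au,u)|:u\in D(A),\|u\|=1\}\in[0,\infty]$ be the numerical radius of $A$. Let $1\le k\le 6$, $1<\alpha<2$, $\tau>0$, $N\in\mathbb N$, $t_n=n\tau$, $T=N\tau$, and set $$\delta(\zeta)=\sum_{j=1}^k\tfrac1j(1-\zeta)^j,\quad \delta_\tau(\zeta)=\tau^{-1}\delta(\zeta),\quad K(z)=z^{-1}(z^\alpha-A)^{-1},\quad \gamma_\ell(\zeta)=\Big(\zeta\frac{d}{d\zeta}\Big)^{\ell}\frac1{1-\zeta}$$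 (powers are principal branches). For a sequence $\varphi$ and $s>0$ put $\bar\partial_\tau^{s}\varphi^n=\tau^{-s}\sum_{j=0}^n\omega^{(s)}_j\varphi^{n-j}$, where $\delta(\zeta)^s=\sum_{j\ge0}\omega^{(s)}_j\zeta^j$ near $0$, and $\bar\partial_\tau=\bar\partial_\tau^{1}$. Let $v,b\in D(A)$, let $f\in L^1(0,T;X)$ have one-sided derivatives at $t=0$ up to order $k-3$ (in the sense that $f$ is of class $C^{k-3}$ near $0$ in $[0,T]$; no condition if $k\le2$), and let $g(t)=\int_0^tf(s)\,ds$ and $$R_k(t)=g(t)-\sum_{\ell=1}^{k-2}\frac{t^\ell}{\ell!}\,\partial_t^{\ell-1}f(0).$$ Let $a^{(k)}_j,c^{(k)}_j,b^{(k)}_{\ell,j}$ ($1\le j\le k-1$, $1\le \ell\le k-2$) be arbitrary coefficients, $\mu(\zeta)=\delta(\zeta)\big(\frac{\zeta}{1-\zeta}+\sum_{j=1}^{k-1}a_j^{(k)}\zeta^j\big)$, and let $U^0=v$ and $U^1,\dots,U^N\in D(A)$ solve the corrected diffusion-wave scheme $$\bar\partial_\tau^\alpha(U-v-tb)^n-AU^n=\mathbf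 1_{\{n\le k-1\}}\Big(a_n^{(k)}Av+c_n^{(k)}\tau Ab+\sum_{\ell=1}^{k-2}b_{\ell,n}^{(k)}\tau^{\ell-1}\partial_t^{\ell-1}f(0)\Big)+\bar\partial_\tau g^n,\qquad 1\le n\le N .$$ **Condition 3.1.** Let $\vartheta_k$ be the largest angle for which BDF$k$ is $A(\vartheta_k)$-stable, $\alpha^*(k)=\pi/(\pi-\vartheta_k)$, and let $-c(\alpha,k)$ be the intersection point of $\{\delta(\zeta)^\alpha:|\zeta|=1\}$ with the negative real axis that is closest to the origin. For a given $\eta>0$: either (i) $\alpha<\alpha^*(k)$, or (ii) $\alpha\ge\alpha^*(k)$ and $\tau^\alpha r(A)\le c(\alpha,k)-\eta$. **Contour.** For $\theta\in(\pi/2,\pi)$ and $0<\delta<\pi/\tau$ let $$\Gamma^\tau_{\theta,\delta}=\big\{z\in\mathbb C:\ \big(|z|=\delta,\ |\arg z|\le\theta\big)\ \text{or}\ \big(z=\rho e^{\pm i\theta},\ \rho\ge\delta\big);\ \ |\operatorname{Im}z|\le\pi/\tau\big\},$$ oriented with increasing imaginary part. Let $(R^n)_{n\ge0}$ be any sequence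 in $X$ with $R^n=R_k(t_n)$ for $0\le n\le N$ whose generating function $\widetilde R_k(\zeta)=\sum_{n\ge1}R^n\zeta^n$ converges absolutely at $\zeta=e^{-z\tau}$ for all $z\in\Gamma^\tau_{\theta,\delta}$ (for instance $R^n=0$ for $n>N$). **Theorem 3.1.** For all $1\le k\le6$, $1<\alpha<2$ and $\eta>0$ there is $\theta_0\in(\pi/2,\pi/\alpha]$, depending only on $k,\alpha,\eta$, such that for every $\theta\in(\pi/2,\theta_0)$, every $\delta\in(0,\pi/\tau)$ and all data as above that satisfy Condition 3.1, the following holds. For all $z\in\Gamma^\tau_{\theta,\delta}$, $\delta_\tau(e^{-z\tau})\ne0$ and $\delta_\tau(e^{-z\tau})^\alpha$ is in the resolvent set of $A$; and for $1\le n\le N$ the following four integrands are integrable and $W^n:=U^n-v-t_nb$ is given by $$\begin{aligned} W^n={}&\frac1{2\pi i}\int_{\Gamma^\tau_{\theta,\delta}}e^{zt_n}\mu(e^{-z\tau})K(\delta_\tau(e^{-z\tau}))Av\,dz\\ &+\frac1{2\pi i}\int_{\Gamma^\tau_{\theta,\delta}}e^{zt_n}K(\delta_\tau(e^{-z\tau}))\,\delta_\tau(e^{-z\tau})\Big(\gamma_1(e^{-z\tau})+\sum_{j=1}^{k-1}c_j^{(k)}e^{-zt_j}\Big)\tau^2Ab\,dz\\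 &+\frac1{2\pi i}\int_{\Gamma^\tau_{\theta,\delta}}e^{zt_n}\delta_\tau(e^{-z\tau})K(\delta_\tau(e^{-z\tau}))\sum_{\ell=1}^{k-2}\Big(\delta(e^{-z\tau})\frac{\gamma_\ell(e^{-z\tau})}{\ell!}+\sum_{j=1}^{k-1}b_{\ell,j}^{(k)}e^{-zt_j}\Big)\tau^\ell\,\partial_t^{\ell-1}f(0)\,dz\\ &+\frac1{2\pi i}\int_{\Gamma^\tau_{\theta,\delta}}e^{zt_n}\delta_\tau(e^{-z\tau})^2K(\delta_\tau(e^{-z\tau}))\,\tau\widetilde R_k(e^{-z\tau})\,dz . \end{aligned}$$ -/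

import Mathlib

open MeasureTheory Set
open scoped ENNReal ContDiff

noncomputable section

namespace DiffusionWave

/-! ## The backward difference formulas and their convolution quadrature -/

/-- The generating polynomial `δ(ζ) = ∑_{j=1}^k (1-ζ)^j / j` of the `k`-step BDF. -/
def bdf (k : ℕ) (ζ : ℂ) : ℂ := ∑ j ∈ Finset.Icc 1 k, (1 - ζ) ^ j / (j : ℂ)

/-- `δ_τ(ζ) = δ(ζ) / τ`. -/
def bdfStep (k : ℕ) (τ : ℝ) (ζ : ℂ) : ℂ := bdf k ζ / (τ : ℂ)

/-- The `j`-th Taylor coefficient at `0` of `δ(ζ)^s` (principal branch). -/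
def cqWeight (k : ℕ) (s : ℝ) (j : ℕ) : ℂ :=
  iteratedDeriv j (fun ζ : ℂ => bdf k ζ ^ (s : ℂ)) 0 / (j.factorial : ℂ)

/-- `γ_ℓ(ζ) = (ζ d/dζ)^ℓ (1/(1-ζ))`. -/
def gammaFun (l : ℕ) : ℂ → ℂ :=
  (fun (F : ℂ → ℂ) (ζ : ℂ) => ζ * deriv F ζ)^[l] (fun ζ => 1 / (1 - ζ))

/-- `μ(ζ) = δ(ζ) (ζ/(1-ζ) + ∑_{j=1}^{k-1} a_j ζ^j)`. -/
def muFun (k : ℕ) (a : ℕ → ℂ) (ζ : ℂ) : ℂ :=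
  bdf k ζ * (ζ / (1 - ζ) + ∑ j ∈ Finset.Ico 1 k, a j * ζ ^ j)

/-- A(ϑ)-stability of the `k`-step BDF: the sector `{w ≠ 0 : |arg(-w)| < ϑ}` is contained in the
stability region. The characteristic roots for the test equation `y' = λ y`, `w = λ τ`, are the
reciprocals `1/ζ` of the solutions of `δ(ζ) = w` (and possibly `0`); they have to lie in the closed
unit disc, and those on the unit circle have to be simple. -/
def IsAStable (k : ℕ) (ϑ : ℝ) : Prop :=
  ∀ w : ℂ, w ≠ 0 → |Complex.arg (-w)| < ϑ → ∀ ζ : ℂ, bdf k ζ = w →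
    1 ≤ ‖ζ‖ ∧ (‖ζ‖ = 1 → deriv (bdf k) ζ ≠ 0)

/-- The stability angle `ϑ_k`: the largest angle for which the BDF is A(ϑ)-stable. -/
def stabilityAngle (k : ℕ) : ℝ := sSup {ϑ : ℝ | 0 < ϑ ∧ ϑ ≤ Real.pi / 2 ∧ IsAStable k ϑ}

/-- The critical order `α*(k) = π / (π - ϑ_k)`. -/
def criticalOrder (k : ℕ) : ℝ := Real.pi / (Real.pi - stabilityAngle k)

/-- The constant `c(α,k)`: the distance to the origin of the point, closest to the origin, in which
the curve `{δ(ζ)^α : |ζ| = 1}` meets the negative real axis. -/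
def cflConst (α : ℝ) (k : ℕ) : ℝ :=
  sInf {x : ℝ | 0 < x ∧ ∃ ζ : ℂ, ‖ζ‖ = 1 ∧ bdf k ζ ^ (α : ℂ) = -(x : ℂ)}

/-! ## The contour -/

/-- The contour `Γ^τ_{θ,δ}`, as a set. -/
def contour (θ δ τ : ℝ) : Set ℂ :=
  {z | ((‖z‖ = δ ∧ |Complex.arg z| ≤ θ) ∨
      ∃ ρ : ℝ, δ ≤ ρ ∧ (z = ρ * Complex.exp (Complex.I * θ) ∨
        z = ρ * Complex.exp (-(Complex.I * θ)))) ∧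
    |z.im| ≤ Real.pi / τ}

section Operators

variable {X : Type*} [NormedAddCommGroup X] [InnerProductSpace ℂ X]

/-- `F` is integrable along the three pieces of the contour (for `0 < δ < π/τ`, `0 < θ < π`). -/
def ContourIntegrable (θ δ τ : ℝ) (F : ℂ → X) : Prop :=
  IntervalIntegrable (fun ρ : ℝ => F (ρ * Complex.exp (-(Complex.I * θ)))) volume
      δ (Real.pi / (τ * Real.sin θ)) ∧
  IntervalIntegrable (fun φ : ℝ => F (δ * Complex.exp (Complex.I * φ))) volume (-θ) θ ∧
  IntervalIntegrable (fun ρ : ℝ => F (ρ * Complex.exp (Complex.I * θ))) volume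
      δ (Real.pi / (τ * Real.sin θ))

/-- The integral of `F` over `Γ^τ_{θ,δ}` oriented with increasing imaginary part, for `0 < δ < π/τ`
and `0 < θ < π`: up along the lower ray, counterclockwise along the arc, up along the upper ray. On
a ray `|Im z| ≤ π/τ` means `|z| ≤ π / (τ sin θ)`. -/
def contourIntegral (θ δ τ : ℝ) (F : ℂ → X) : X :=
  -(∫ ρ in δ..(Real.pi / (τ * Real.sin θ)),
      Complex.exp (-(Complex.I * θ)) • F (ρ * Complex.exp (-(Complex.I * θ)))) +
  (∫ φ in (-θ)..θ,
      (Complex.I * δ * Complex.exp (Complex.I * φ)) • F (δ * Complex.exp (Complex.I * φ))) +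
  ∫ ρ in δ..(Real.pi / (τ * Real.sin θ)),
      Complex.exp (Complex.I * θ) • F (ρ * Complex.exp (Complex.I * θ))

/-! ## Unbounded operators -/

/-- `R` is the bounded two-sided inverse of `lam - A`. -/
structure IsResolvent (A : X →ₗ.[ℂ] X) (lam : ℂ) (R : X →L[ℂ] X) : Prop where
  mem : ∀ x, R x ∈ A.domain
  right : ∀ x, lam • R x - A ⟨R x, mem x⟩ = x
  left : ∀ u : A.domain, R (lam • (u : X) - A u) = u

/-- `lam` belongs to the resolvent set of `A`. -/
def InResolventSet (A : X →ₗ.[ℂ] X) (lam : ℂ) : Prop := ∃ R, IsResolvent A lam R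

open Classical in
/-- `(lam - A)⁻¹`; zero if `lam` is not in the resolvent set. -/
def resolventOp (A : X →ₗ.[ℂ] X) (lam : ℂ) : X →L[ℂ] X :=
  if h : ∃ R, IsResolvent A lam R then h.choose else 0

/-- The kernel `K(z) = z⁻¹ (z^α - A)⁻¹`. -/
def kernelK (α : ℝ) (A : X →ₗ.[ℂ] X) (z : ℂ) : X →L[ℂ] X :=
  z⁻¹ • resolventOp A (z ^ (α : ℂ))

/-- The numerical radius `sup {|⟨u, A u⟩| : u ∈ D(A), ‖u‖ = 1}`, possibly infinite. -/
def numericalRadius (A : X →ₗ.[ℂ] X) : ℝ≥0∞ :=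
  ⨆ (u : A.domain) (_ : ‖(u : X)‖ = 1), ‖inner ℂ (u : X) (A u)‖ₑ

/-- Either `α < α*(k)`, or `α ≥ α*(k)` and `τ^α r(A) ≤ c(α,k) - η`. -/
def CFLCondition (k : ℕ) (α η τ : ℝ) (A : X →ₗ.[ℂ] X) : Prop :=
  α < criticalOrder k ∨
  (criticalOrder k ≤ α ∧
    ENNReal.ofReal (τ ^ α) * numericalRadius A + ENNReal.ofReal η ≤ ENNReal.ofReal (cflConst α k))

/-! ## The corrected scheme -/

/-- The convolution quadrature `∂̄_τ^s φ^n = τ^{-s} ∑_{j=0}^n b_j φ^{n-j}`. -/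
def cqDeriv (k : ℕ) (s τ : ℝ) (φ : ℕ → X) (n : ℕ) : X :=
  ((τ ^ (-s) : ℝ) : ℂ) • ∑ j ∈ Finset.range (n + 1), cqWeight k s j • φ (n - j)

/-- The `m`-th (one-sided) time derivative at `0` of a function on `[0,T]`. -/
def derivAtZero (T : ℝ) (f : ℝ → X) (m : ℕ) : X := iteratedDerivWithin m f (Icc 0 T) 0

/-- `f` is integrable on `(0,T)` and all the derivatives `∂_t^m f(0)`, `0 ≤ m ≤ k - 3`, that occur
in the scheme exist classically. -/
def IsSource (k : ℕ) (T : ℝ) (f : ℝ → X) : Prop :=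
  IntervalIntegrable f volume 0 T ∧
  ∀ m : ℕ, m + 3 ≤ k → ContDiffWithinAt ℝ (m : ℕ∞) f (Icc 0 T) 0

/-- `g(t) = ∫_0^t f(s) ds`. -/
def primitive (f : ℝ → X) (t : ℝ) : X := ∫ s in (0 : ℝ)..t, f s

/-- `R_k(t) = g(t) - ∑_{ℓ=1}^{k-2} (t^ℓ/ℓ!) ∂_t^{ℓ-1} f(0)`. -/
def taylorRemainder (k : ℕ) (T : ℝ) (f : ℝ → X) (t : ℝ) : X :=
  primitive f t -
    ∑ l ∈ Finset.Ico 1 (k - 1), ((t : ℂ) ^ l / (l.factorial : ℂ)) • derivAtZero T f (l - 1)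

/-- `U^0, …, U^N` solves the corrected scheme for `∂_t^α (u - v - t b) - A u = f` on the grid
`t_n = n τ`, `0 ≤ n ≤ N`, with correction coefficients `a n`, `c n`, `β l n`. -/
def IsDiscreteSolution (k : ℕ) (α τ : ℝ) (N : ℕ) (A : X →ₗ.[ℂ] X) (a c : ℕ → ℂ) (β : ℕ → ℕ → ℂ)
    (v b : A.domain) (f : ℝ → X) (U : ℕ → A.domain) : Prop :=
  U 0 = v ∧
  ∀ n : ℕ, 1 ≤ n → n ≤ N →
    cqDeriv k α τ (fun m => (U m : X) - (v : X) - ((m * τ : ℝ) : ℂ) • (b : X)) n - A (U n) =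
      (if n ≤ k - 1 then
        a n • A v + (c n * (τ : ℂ)) • A b +
          ∑ l ∈ Finset.Ico 1 (k - 1),
            (β l n * (τ : ℂ) ^ (l - 1)) • derivAtZero (N * τ) f (l - 1)
      else 0) +
      cqDeriv k 1 τ (fun m => primitive f (m * τ)) n

/-! ## The four integrands -/

/-- `e^{z t_n} μ(e^{-zτ}) K(δ_τ(e^{-zτ})) x`, to be used with `x = A v`. -/
def integrandV (k : ℕ) (α τ : ℝ) (A : X →ₗ.[ℂ] X) (a : ℕ → ℂ) (n : ℕ) (x : X) (z : ℂ) : X :=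
  (Complex.exp (z * (n * τ)) * muFun k a (Complex.exp (-z * τ))) •
    kernelK α A (bdfStep k τ (Complex.exp (-z * τ))) x

/-- `e^{z t_n} K(δ_τ(e^{-zτ})) δ_τ(e^{-zτ}) (γ_1(e^{-zτ}) + ∑_{j=1}^{k-1} c_j e^{-z t_j}) τ² x`, to
be used with `x = A b`. -/
def integrandB (k : ℕ) (α τ : ℝ) (A : X →ₗ.[ℂ] X) (c : ℕ → ℂ) (n : ℕ) (x : X) (z : ℂ) : X :=
  Complex.exp (z * (n * τ)) •
    kernelK α A (bdfStep k τ (Complex.exp (-z * τ)))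
      ((bdfStep k τ (Complex.exp (-z * τ)) *
        (gammaFun 1 (Complex.exp (-z * τ)) +
          ∑ j ∈ Finset.Ico 1 k, c j * Complex.exp (-z * (j * τ))) * (τ : ℂ) ^ 2) • x)

/-- `e^{z t_n} δ_τ(e^{-zτ}) K(δ_τ(e^{-zτ})) ∑_{ℓ=1}^{k-2} (δ(e^{-zτ}) γ_ℓ(e^{-zτ})/ℓ! +
∑_{j=1}^{k-1} b_{ℓ,j} e^{-z t_j}) τ^ℓ F_ℓ`, to be used with `F_ℓ = ∂_t^{ℓ-1} f(0)`. -/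
def integrandF (k : ℕ) (α τ : ℝ) (A : X →ₗ.[ℂ] X) (β : ℕ → ℕ → ℂ) (n : ℕ) (F : ℕ → X) (z : ℂ) : X :=
  (Complex.exp (z * (n * τ)) * bdfStep k τ (Complex.exp (-z * τ))) •
    kernelK α A (bdfStep k τ (Complex.exp (-z * τ)))
      (∑ l ∈ Finset.Ico 1 (k - 1),
        ((bdf k (Complex.exp (-z * τ)) *
            (gammaFun l (Complex.exp (-z * τ)) / (l.factorial : ℂ)) +
          ∑ j ∈ Finset.Ico 1 k, β l j * Complex.exp (-z * (j * τ))) * (τ : ℂ) ^ l) • F l)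

/-- The generating function `∑_{n ≥ 1} R^n ζ^n`. -/
def genFun (R : ℕ → X) (ζ : ℂ) : X := ∑' m : ℕ, ζ ^ (m + 1) • R (m + 1)

/-- `e^{z t_n} δ_τ(e^{-zτ})² K(δ_τ(e^{-zτ})) τ R̃(e^{-zτ})`. -/
def integrandR (k : ℕ) (α τ : ℝ) (A : X →ₗ.[ℂ] X) (n : ℕ) (R : ℕ → X) (z : ℂ) : X :=
  (Complex.exp (z * (n * τ)) * bdfStep k τ (Complex.exp (-z * τ)) ^ 2) •
    kernelK α A (bdfStep k τ (Complex.exp (-z * τ)))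
      ((τ : ℂ) • genFun R (Complex.exp (-z * τ)))

end Operators

/-! ## The Dirichlet Laplacian and its Galerkin approximations -/

section Laplacian

variable {d : ℕ}

/-- `L²(Ω)` (complex-valued). -/
abbrev L2 (Ω : Set (EuclideanSpace ℝ (Fin d))) : Type :=
  Lp ℂ 2 (volume.restrict Ω)

/-- Pairs `(u, p)` of a function `u ∈ L²(Ω)` and a vector field `p ∈ L²(Ω)^d`, with the Hilbert norm
`(‖u‖² + ∑ ‖p_i‖²)^{1/2}`; on pairs `(u, ∇u)` this is the norm of `H¹(Ω)`. -/
abbrev L2Pairs (Ω : Set (EuclideanSpace ℝ (Fin d))) : Type :=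
  WithLp 2 (L2 Ω × PiLp 2 (fun _ : Fin d => L2 Ω))

/-- The pairs `(φ, ∇φ)` with `φ ∈ C_c^∞(Ω)`. -/
def testPairs (Ω : Set (EuclideanSpace ℝ (Fin d))) : Set (L2Pairs Ω) :=
  {x | ∃ φ : EuclideanSpace ℝ (Fin d) → ℂ, ContDiff ℝ ∞ φ ∧ HasCompactSupport φ ∧ tsupport φ ⊆ Ω ∧
    (x.fst : EuclideanSpace ℝ (Fin d) → ℂ) =ᵐ[volume.restrict Ω] φ ∧
    ∀ i : Fin d, (x.snd i : EuclideanSpace ℝ (Fin d) → ℂ) =ᵐ[volume.restrict Ω]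
      fun y => fderiv ℝ φ y (EuclideanSpace.single i 1)}

/-- `H¹₀(Ω)`, the closure of `C_c^∞(Ω)` in the `H¹` norm, every `u` being recorded together with its
weak gradient as the pair `(u, ∇u)`. -/
def H10 (Ω : Set (EuclideanSpace ℝ (Fin d))) : Submodule ℂ (L2Pairs Ω) :=
  (Submodule.span ℂ (testPairs Ω)).topologicalClosure

variable {Ω : Set (EuclideanSpace ℝ (Fin d))}

/-- The closure in `L²(Ω)` of a space of functions `V ⊆ H¹₀(Ω)`. It is `L²(Ω)` for `V = H¹₀(Ω)`, and
`V` itself with the `L²` norm if `V` has finite dimension. -/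
abbrev L2Closure (V : Submodule ℂ (L2Pairs Ω)) : Submodule ℂ (L2 Ω) :=
  (V.map (WithLp.fstL 2 ℂ (L2 Ω) (PiLp 2 (fun _ : Fin d => L2 Ω))).toLinearMap).topologicalClosure

/-- The pairs `(u, w)` with `u ∈ V` and `(w, φ) = -(∇u, ∇φ)` for all `φ ∈ V`. -/
def laplacianGraph (V : Submodule ℂ (L2Pairs Ω)) :
    Submodule ℂ (L2Closure V × L2Closure V) where
  carrier := {x | ∃ p ∈ V, p.fst = (x.1 : L2 Ω) ∧
    ∀ q ∈ V, inner ℂ q.fst (x.2 : L2 Ω) = -inner ℂ q.snd p.snd}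
  zero_mem' := ⟨0, V.zero_mem, by simp, by simp⟩
  add_mem' := by
    rintro x y ⟨p, hp, hpx, hpw⟩ ⟨p', hp', hpx', hpw'⟩
    refine ⟨p + p', V.add_mem hp hp', by simp [hpx, hpx'], fun q hq => ?_⟩
    simp only [Prod.snd_add, Submodule.coe_add, WithLp.add_snd, inner_add_right, hpw q hq,
      hpw' q hq]
    ring
  smul_mem' := by
    rintro s x ⟨p, hp, hpx, hpw⟩
    refine ⟨s • p, V.smul_mem s hp, by simp [hpx], fun q hq => ?_⟩
    simp only [Prod.smul_snd, Submodule.coe_smul, WithLp.smul_snd, inner_smul_right, hpw q hq]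
    ring

/-- The graph is single-valued. -/
theorem laplacianGraph_single (V : Submodule ℂ (L2Pairs Ω)) :
    ∀ x ∈ laplacianGraph V, x.1 = 0 → x.2 = 0 := by
  rintro ⟨x, w⟩ ⟨p, hp, hpx, hpw⟩ (hx : x = 0)
  subst hx
  have hp0 : p.fst = 0 := by simpa using hpx
  have h1 := hpw p hp
  rw [hp0, inner_zero_left, zero_eq_neg, inner_self_eq_zero] at h1
  have h2 : ∀ y ∈ L2Closure V, inner ℂ y (w : L2 Ω) = 0 := by
    have hc : IsClosed {y : L2 Ω | inner ℂ y (w : L2 Ω) = 0} :=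
      isClosed_eq (by fun_prop) continuous_const
    intro y hy
    refine closure_minimal (t := {y : L2 Ω | inner ℂ y (w : L2 Ω) = 0}) ?_ hc hy
    rintro _ ⟨q, hq, rfl⟩
    have := hpw q hq
    rw [h1, inner_zero_right, neg_zero] at this
    exact this
  exact Subtype.ext (inner_self_eq_zero.1 (h2 w w.2))

/-- The Laplacian with homogeneous Dirichlet boundary condition on the closed subspace `V` of
`H¹₀(Ω)`: `A u = w` iff `u ∈ V` and `(w, φ) = -(∇u, ∇φ)` for all `φ ∈ V`. For `V = H¹₀(Ω)` it is the
Dirichlet Laplacian `Δ` in `L²(Ω)`, for a finite element space `V` it is the discrete Laplacian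
`Δ_h` in `V`. -/
def laplacian (V : Submodule ℂ (L2Pairs Ω)) : L2Closure V →ₗ.[ℂ] L2Closure V :=
  (laplacianGraph V).toLinearPMap

theorem laplacian_graph (V : Submodule ℂ (L2Pairs Ω)) :
    (laplacian V).graph = laplacianGraph V :=
  Submodule.toLinearPMap_graph_eq _ (laplacianGraph_single V)

end Laplacian

end DiffusionWave

end

open DiffusionWave

open Filter Topology

namespace DiffusionWave

/-! ## The range of the generating polynomial -/

/-! The representation is the scheme solved with generating functions. Put `W^n = U^n - v - t_n b`.
Then `W^0 = 0`, and for `1 ≤ n ≤ N` the sequence satisfies a discrete convolution equation with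
right-hand side `Av + t_n Ab`, plus the corrections, plus the quadrature of `g`. On generating
functions, convolution quadrature is multiplication by `δ_τ(ζ)^α`. The sequences `1` (for `n ≥ 1`),
`t_n` and `t_n^ℓ` become `ζ/(1-ζ)`, `τ γ_1` and `τ^ℓ γ_ℓ`. Formally the generating function of `W`
is therefore `(δ_τ(ζ)^α - A)⁻¹ Φ(ζ)` with explicit `Φ`. Its `n`-th coefficient is a Cauchy integral,
and `ζ = e^{-zτ}` turns this into an integral over one period, taken along `Γ`. Two points need
proof.

The resolvent must exist at the symbol on `Γ` and everywhere to the right of it. The number `δ^α`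
lies on the negative axis only if `δ` lies on a ray of angle `±π/α`. On the unit circle such values
are excluded by A(ϑ)-stability or, as far as the step size condition needs, by the definition of
`cflConst` (`bdf_ne_of_norm_eq_one`). An open-mapping argument along the ray carries this into the
disc (`bdf_ne_on_ball_of_preconnected`). The expansion `δ(e^{-w}) = w + o(w)` and compactness carry
it slightly beyond the imaginary axis (`exists_forall_bdf_exp_ne`). The resulting margin `ε` is
found in the scaled variable `w = zτ`, so the angle `θ₀` depends on `k`, `α`, `η` only. On the
operator side, `(1 - A)⁻¹ = ι ι*` with `ι` the embedding of the energy space. This places every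
point off `(-∞, 0]`, and every `-x` with `x > r(A)`, in the resolvent set
(`inResolventSet_of_variational`).

The inversion must be justified although the scheme stops at `N` and the generating function of `R`
is only known to converge on `Γ`. Only Taylor coefficients up to order `N` enter (`HasJet`). The
polynomial `∑_{m ≤ N} W^m ζ^m` solves the transformed equation up to `O(ζ^{N+1})`. That defect
integrates to zero by periodicity and decay as `Re z → ∞` (`contourIntegral_eq_zero`), and
orthogonality of exponentials over a period extracts `W^n` (`contourIntegral_cqIntegrand`). The
remainder is first replaced by partial sums, for which the integral does not depend on the number of
terms once there are at least `N`. A uniform limit on `Γ` finishes the proof (`representation`). -/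

theorem differentiable_bdf (k : ℕ) : Differentiable ℂ (bdf k) := by
  unfold bdf
  fun_prop

theorem continuous_bdf (k : ℕ) : Continuous (bdf k) := (differentiable_bdf k).continuous

theorem bdf_one (k : ℕ) : bdf k 1 = 0 := by
  refine Finset.sum_eq_zero fun j hj => ?_
  have : j ≠ 0 := by have := Finset.mem_Icc.1 hj; omega
  simp [this]

theorem exists_bdf_zero_eq {k : ℕ} (hk : 1 ≤ k) : ∃ h : ℝ, 0 < h ∧ bdf k 0 = h := by
  refine ⟨∑ j ∈ Finset.Icc 1 k, 1 / (j : ℝ), ?_, by simp [bdf]⟩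
  refine Finset.sum_pos (fun j hj => ?_) ⟨1, Finset.mem_Icc.2 ⟨le_rfl, hk⟩⟩
  have : 0 < (j : ℝ) := by exact_mod_cast (Finset.mem_Icc.1 hj).1
  positivity

theorem hasDerivAt_bdf_one {k : ℕ} (hk : 1 ≤ k) : HasDerivAt (bdf k) (-1) 1 := by
  have h : HasDerivAt (bdf k)
      (∑ j ∈ Finset.Icc 1 k, (j : ℂ) * (1 - 1) ^ (j - 1) * (-1) / (j : ℂ)) 1 := by
    unfold bdf
    refine HasDerivAt.fun_sum fun j _ => ?_
    have h0 : HasDerivAt (fun ζ : ℂ => 1 - ζ) (-1) 1 := by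
      simpa using (hasDerivAt_id (1 : ℂ)).const_sub 1
    exact (h0.pow j).div_const _
  convert! h using 1
  rw [Finset.sum_eq_single 1]
  · simp
  · intro j hj hj1
    have : j - 1 ≠ 0 := by have := Finset.mem_Icc.1 hj; omega
    simp [this]
  · simp [hk]

theorem isOpenMap_bdf {k : ℕ} (hk : 1 ≤ k) : IsOpenMap (bdf k) := by
  have h : AnalyticOnNhd ℂ (bdf k) univ := fun z _ => (differentiable_bdf k).analyticAt z
  rcases h.is_constant_or_isOpenMap with ⟨w, hw⟩ | h
  · obtain ⟨h, h0, he⟩ := exists_bdf_zero_eq hk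
    have := (hw 0).trans (hw 1).symm
    rw [bdf_one, he] at this
    exact absurd (by exact_mod_cast this) h0.ne'
  · exact h

/-- On the unit circle the imaginary part of the generating polynomial vanishes at `±1` only. -/
theorem bdf_ne_nonpos_of_norm_eq_one {k : ℕ} (hk1 : 1 ≤ k) (hk6 : k ≤ 6) {ζ : ℂ} (hζ : ‖ζ‖ = 1)
    (hζ1 : ζ ≠ 1) {r : ℝ} (hr : 0 ≤ r) : bdf k ζ ≠ r * (-1) := by
  intro h
  obtain ⟨w, hw⟩ : ∃ w, w = 1 - ζ := ⟨_, rfl⟩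
  set t : ℝ := w.re with ht
  have hsq : ζ.re ^ 2 + ζ.im ^ 2 = 1 := by
    have := Complex.sq_norm ζ
    rw [hζ, Complex.normSq_apply] at this
    nlinarith
  have hwim : w.im = -ζ.im := by simp [hw]
  have hwre : t = 1 - ζ.re := by simp [ht, hw]
  have hq : w.im ^ 2 = 2 * t - t ^ 2 := by rw [hwim, hwre]; linarith
  -- On the circle `|w|² = 2 Re w`, so `w` is a root of the real quadratic `X² - 2tX + 2t`. Every
  -- power of `w`, hence `δ(ζ)`, reduces to `a + b w` with `a`, `b` real polynomials in `t ∈ [0,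
  -- 2]`.
  have h2 : w ^ 2 = -2 * t + 2 * t * w := by
    apply Complex.ext
    · simp [pow_two]; nlinarith
    · simp [pow_two]; nlinarith
  have ht0 : 0 ≤ t := by nlinarith [sq_nonneg w.im]
  have ht2 : t ≤ 2 := by nlinarith [sq_nonneg w.im]
  have h3 : w ^ 3 = -4 * t ^ 2 + (-2 * t + 4 * t ^ 2) * w := by
    linear_combination w * h2 + 2 * t * h2
  have h4 : w ^ 4 = (4 * t ^ 2 - 8 * t ^ 3) + (-8 * t ^ 2 + 8 * t ^ 3) * w := by
    linear_combination w * h3 + (-2 * t + 4 * t ^ 2) * h2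
  have h5 : w ^ 5 = (16 * t ^ 3 - 16 * t ^ 4) + (4 * t ^ 2 - 24 * t ^ 3 + 16 * t ^ 4) * w := by
    linear_combination w * h4 + (-8 * t ^ 2 + 8 * t ^ 3) * h2
  have h6 : w ^ 6 = (-8 * t ^ 3 + 48 * t ^ 4 - 32 * t ^ 5) +
      (24 * t ^ 3 - 64 * t ^ 4 + 32 * t ^ 5) * w := by
    linear_combination w * h5 + (4 * t ^ 2 - 24 * t ^ 3 + 16 * t ^ 4) * h2
  -- The imaginary part is `b · Im w`. With `b > 0` a real value forces `Im w = 0`, that is `t = 0`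
  -- (`ζ = 1`) or `t = 2` (`ζ = -1`), and in the latter case the value `a + 2b` is positive.
  suffices H : ∃ a b : ℝ, 0 < b ∧ (t = 2 → 0 < a + b * 2) ∧ bdf k ζ = a + b * w by
    obtain ⟨a, b, hb, hab, he⟩ := H
    rw [he] at h
    have him : b * w.im = 0 := by simpa using congrArg Complex.im h
    have hre : a + b * t = -r := by simpa using congrArg Complex.re h
    have him0 : w.im = 0 := (mul_eq_zero.1 him).resolve_left hb.ne'
    rw [him0] at hq
    have : t * (2 - t) = 0 := by nlinarith
    rcases mul_eq_zero.1 this with h' | h'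
    · exact hζ1 (sub_eq_zero.1 (hw ▸ Complex.ext h' him0 : 1 - ζ = 0)).symm
    · have ht' : t = 2 := by linarith
      have := hab ht'
      rw [ht'] at hre
      linarith
  have ht3 : 0 ≤ t ^ 3 := by positivity
  -- Fifteen times the coefficient `b` for `k = 6`. The point `7/10` minimizes the quadratic factor
  -- `18 - 112 t + 80 t²`; beyond `t = 1`, expanding in `s = t - 1` leaves only nonnegative
  -- coefficients.
  have b6 : 0 < 15 + 5 * t + 2 * t ^ 2 + 18 * t ^ 3 - 112 * t ^ 4 + 80 * t ^ 5 := by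
    rcases le_total t 1 with h1 | h1
    · nlinarith [mul_nonneg ht3 (sq_nonneg (t - 7 / 10)), pow_le_one₀ ht0 h1 (n := 3),
        mul_nonneg (sq_nonneg t) (sub_nonneg.2 h1), mul_nonneg ht0 (sub_nonneg.2 h1)]
    · obtain ⟨s, hs⟩ : ∃ s, s = t - 1 := ⟨_, rfl⟩
      have hs0 : 0 ≤ s := by linarith
      rw [show t = 1 + s by linarith]
      ring_nf
      positivity
  unfold bdf
  rw [← hw]
  interval_cases k
  · exact ⟨0, 1, one_pos, by norm_num, by simp⟩
  · refine ⟨-t, 1 + t, by positivity, fun h' => by rw [h']; norm_num, ?_⟩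
    simp [Finset.sum_Icc_succ_top]
    linear_combination h2 / 2
  · refine ⟨-t - 4 * t ^ 2 / 3, 1 + t + (-2 * t + 4 * t ^ 2) / 3, by nlinarith,
      fun h' => by rw [h']; norm_num, ?_⟩
    simp [Finset.sum_Icc_succ_top]
    linear_combination h2 / 2 + h3 / 3
  · refine ⟨-t - 4 * t ^ 2 / 3 + (t ^ 2 - 2 * t ^ 3),
      1 + t + (-2 * t + 4 * t ^ 2) / 3 + (-2 * t ^ 2 + 2 * t ^ 3),
      by nlinarith [mul_nonneg ht0 (sq_nonneg (t - 1))], fun h' => by rw [h']; norm_num, ?_⟩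
    simp [Finset.sum_Icc_succ_top]
    linear_combination h2 / 2 + h3 / 3 + h4 / 4
  · refine ⟨-t - 4 * t ^ 2 / 3 + (t ^ 2 - 2 * t ^ 3) + (16 * t ^ 3 - 16 * t ^ 4) / 5,
      1 + t + (-2 * t + 4 * t ^ 2) / 3 + (-2 * t ^ 2 + 2 * t ^ 3) +
        (4 * t ^ 2 - 24 * t ^ 3 + 16 * t ^ 4) / 5,
      by nlinarith [sq_nonneg (t * (t - 7 / 16))], fun h' => by rw [h']; norm_num, ?_⟩
    simp [Finset.sum_Icc_succ_top]
    linear_combination h2 / 2 + h3 / 3 + h4 / 4 + h5 / 5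
  · refine ⟨-t - 4 * t ^ 2 / 3 + (t ^ 2 - 2 * t ^ 3) + (16 * t ^ 3 - 16 * t ^ 4) / 5 +
        (-8 * t ^ 3 + 48 * t ^ 4 - 32 * t ^ 5) / 6,
      1 + t + (-2 * t + 4 * t ^ 2) / 3 + (-2 * t ^ 2 + 2 * t ^ 3) +
        (4 * t ^ 2 - 24 * t ^ 3 + 16 * t ^ 4) / 5 + (24 * t ^ 3 - 64 * t ^ 4 + 32 * t ^ 5) / 6,
      by linarith, fun h' => by rw [h']; norm_num, ?_⟩
    simp [Finset.sum_Icc_succ_top]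
    linear_combination h2 / 2 + h3 / 3 + h4 / 4 + h5 / 5 + h6 / 6

/-- A number close to a number `w` of almost nonnegative real part does not lie on a ray that
points into the left half plane. -/
theorem ne_ofReal_mul_of_norm_sub_le {e u w : ℂ} (he : ‖e‖ = 1) (hre : e.re < 0) (hw : w ≠ 0)
    (huw : ‖u - w‖ ≤ -e.re / 4 * ‖w‖) (hwre : e.re / 4 * ‖w‖ ≤ w.re) {r : ℝ} (hr : 0 ≤ r) :
    u ≠ r * e := by
  rintro rfl
  have h0 : 0 < ‖w‖ := norm_pos_iff.2 hw
  have h1 : -e.re ≤ 1 := by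
    have := Complex.abs_re_le_norm e
    rw [he] at this
    linarith [neg_abs_le e.re]
  have h2 : ‖w‖ ≤ r + ‖r * e - w‖ := by
    have := norm_sub_norm_le w (r * e)
    rw [norm_sub_rev, norm_mul, he, Complex.norm_real, Real.norm_of_nonneg hr] at this
    linarith
  have h3 : w.re - r * e.re ≤ ‖r * e - w‖ := by
    have := (neg_abs_le _).trans' (neg_le_neg (Complex.abs_re_le_norm (r * e - w)))
    simp at this
    linarith
  have h4 : (1 + e.re / 4) * ‖w‖ ≤ r := by linarith
  have h5 : -e.re * r ≤ -e.re / 2 * ‖w‖ := by linarith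
  have h6 : -e.re * ((1 + e.re / 4) * ‖w‖) ≤ -e.re * r :=
    mul_le_mul_of_nonneg_left h4 (by linarith)
  have h7 : 0 < -e.re * ‖w‖ := mul_pos (by linarith) h0
  nlinarith

/-! ### Avoiding a ray: from the unit circle to the disc and slightly beyond -/

section Ray

variable {k : ℕ} {e : ℂ}

/-- A continuity argument in `r`. The set of `r` with `r e ∈ δ(open disc)` is open because `δ` is an
open map. It is closed relative to `I`, because a limit of such values is attained on the closed
disc and the circle is excluded there. By connectedness a single missed value `r₁` settles all of
`I`. -/
theorem bdf_ne_on_ball_of_preconnected (hk : 1 ≤ k) {I : Set ℝ} (hI : IsPreconnected I)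
    (hI0 : ∀ r ∈ I, 0 < r) (he : ‖e‖ = 1)
    (hb : ∀ r ∈ I, ∀ ζ : ℂ, ‖ζ‖ = 1 → ζ ≠ 1 → bdf k ζ ≠ r * e) {r₁ : ℝ} (hr₁ : r₁ ∈ I)
    (h₁ : ∀ ζ : ℂ, ‖ζ‖ < 1 → bdf k ζ ≠ r₁ * e) {r : ℝ} (hr : r ∈ I) {ζ : ℂ} (hζ : ‖ζ‖ < 1) :
    bdf k ζ ≠ r * e := by
  intro h
  have he0 : e ≠ 0 := by rintro rfl; simp at he
  have hc : Continuous fun r : ℝ => (r : ℂ) * e := by fun_prop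
  have hsub : I ⊆ (fun r : ℝ => (r : ℂ) * e) ⁻¹' (bdf k '' Metric.ball 0 1) := by
    refine hI.subset_of_closure_inter_subset
      ((isOpenMap_bdf hk _ Metric.isOpen_ball).preimage hc) ⟨r, hr, ζ, by simpa using hζ, h⟩ ?_
    rintro s ⟨hs, hsI⟩
    have hcl : IsClosed ((fun r : ℝ => (r : ℂ) * e) ⁻¹' (bdf k '' Metric.closedBall 0 1)) :=
      ((isCompact_closedBall _ _).image (continuous_bdf k)).isClosed.preimage hc
    obtain ⟨ξ, hξ, hξs⟩ := closure_minimal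
      (preimage_mono (image_mono Metric.ball_subset_closedBall)) hcl hs
    have hξ1 : ‖ξ‖ ≤ 1 := by simpa using hξ
    rcases hξ1.lt_or_eq with hlt | heq
    · exact ⟨ξ, by simpa using hlt, hξs⟩
    · refine absurd hξs (hb s hsI ξ heq ?_)
      rintro rfl
      have : (s : ℂ) * e = 0 := by rw [← bdf_one k]; exact hξs.symm
      have hs0 : (s : ℂ) ≠ 0 := by exact_mod_cast (hI0 s hsI).ne'
      exact mul_ne_zero hs0 he0 this
  obtain ⟨ξ, hξ, hξs⟩ := hsub hr₁
  exact h₁ ξ (by simpa using hξ) hξs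

/-- The backward difference formulas of order at most six are `A₀`-stable and zero-stable. -/
theorem bdf_ne_nonpos (hk1 : 1 ≤ k) (hk6 : k ≤ 6) {ζ : ℂ} (hζ : ‖ζ‖ ≤ 1) (hζ1 : ζ ≠ 1) {r : ℝ}
    (hr : 0 ≤ r) : bdf k ζ ≠ r * (-1) := by
  rcases hζ.eq_or_lt with heq | hlt
  · exact bdf_ne_nonpos_of_norm_eq_one hk1 hk6 heq hζ1 hr
  have hpos : ∀ s : ℝ, 0 < s → ∀ ξ : ℂ, ‖ξ‖ < 1 → bdf k ξ ≠ s * (-1) := by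
    obtain ⟨M, hM⟩ := (isCompact_closedBall (0 : ℂ) 1).exists_bound_of_continuousOn
      (continuous_bdf k).continuousOn
    intro s hs ξ hξ
    -- The missed value is any number larger than the maximum of `|δ|` on the closed disc.
    refine bdf_ne_on_ball_of_preconnected hk1 (isPreconnected_Ioi (a := (0 : ℝ))) (fun _ h => h)
      (by simp) (fun s hs ξ h1 h2 => bdf_ne_nonpos_of_norm_eq_one hk1 hk6 h1 h2 (le_of_lt hs))
      (r₁ := |M| + 1) (mem_Ioi.2 (by positivity)) (fun ξ hξ h => ?_) hs hξ
    have h1 := hM ξ (by simpa using hξ.le)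
    rw [h, norm_mul, Complex.norm_real, Real.norm_of_nonneg (by positivity)] at h1
    simp at h1
    linarith [le_abs_self M]
  rcases hr.eq_or_lt with rfl | hr
  · intro h
    -- A zero inside the disc would make the image a neighbourhood of `0`, which contains small
    -- negative numbers and contradicts `hpos`.
    have hnb : bdf k '' Metric.ball 0 1 ∈ 𝓝 (0 : ℂ) :=
      (isOpenMap_bdf hk1 _ Metric.isOpen_ball).mem_nhds ⟨ζ, by simpa using hlt, by simpa using h⟩
    have ht : Tendsto (fun s : ℝ => (s : ℂ) * (-1)) (𝓝[>] 0) (𝓝 0) :=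
      tendsto_nhdsWithin_of_tendsto_nhds (Continuous.tendsto' (by fun_prop) _ _ (by simp))
    obtain ⟨s, ⟨ξ, hξ, hs⟩, hs0⟩ := ((ht.eventually hnb).and self_mem_nhdsWithin).exists
    exact hpos s hs0 ξ (by simpa using hξ) hs
  · exact hpos r hr ζ hlt

/-- A segment starting at the origin and pointing into the left half plane that is not met by the
root locus curve is not met by the image of the unit disc either. -/
theorem bdf_ne_on_ball_of_segment (hk1 : 1 ≤ k) (hk6 : k ≤ 6) (he : ‖e‖ = 1) (hre : e.re < 0)
    {r : ℝ} (hr : 0 ≤ r)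
    (hb : ∀ s ∈ Icc 0 r, ∀ ζ : ℂ, ‖ζ‖ = 1 → ζ ≠ 1 → bdf k ζ ≠ s * e) {ζ : ℂ} (hζ : ‖ζ‖ < 1) :
    bdf k ζ ≠ r * e := by
  have hne1 : ∀ ξ : ℂ, ‖ξ‖ < 1 → ξ ≠ 1 := by rintro _ h rfl; simp at h
  rcases hr.eq_or_lt with rfl | hr
  · simpa using bdf_ne_nonpos hk1 hk6 hζ.le (hne1 ζ hζ) le_rfl
  have hnear : ∀ᶠ ξ : ℂ in 𝓝 1, ‖bdf k ξ - (1 - ξ)‖ ≤ -e.re / 4 * ‖1 - ξ‖ := by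
    filter_upwards [(hasDerivAt_iff_isLittleO.1 (hasDerivAt_bdf_one hk1)).def
      (show 0 < -e.re / 4 by linarith)] with ξ hξ
    rw [bdf_one] at hξ
    rw [norm_sub_rev 1 ξ]
    simpa [sub_eq_add_neg] using hξ
  obtain ⟨ρ, hρ, hnear⟩ := Metric.eventually_nhds_iff_ball.1 hnear
  -- Away from `ζ = 1` zero-stability bounds `|δ|` below by `m`; near `ζ = 1` the value is close to
  -- `1 - ζ`, whose real part is nonnegative. Hence small `r₁ ≤ m/2` are missed and can start the
  -- continuity argument.
  obtain ⟨m, hm0, hm⟩ : ∃ m : ℝ, 0 < m ∧ ∀ ξ ∈ Metric.closedBall (0 : ℂ) 1 \ Metric.ball 1 ρ,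
      m ≤ ‖bdf k ξ‖ := by
    have hK : IsCompact (Metric.closedBall (0 : ℂ) 1 \ Metric.ball 1 ρ) :=
      (isCompact_closedBall _ _).diff Metric.isOpen_ball
    rcases (Metric.closedBall (0 : ℂ) 1 \ Metric.ball 1 ρ).eq_empty_or_nonempty with h0 | h0
    · exact ⟨1, one_pos, by simp [h0]⟩
    obtain ⟨x, hx, hmin⟩ := hK.exists_isMinOn h0 (continuous_bdf k).norm.continuousOn
    refine ⟨_, norm_pos_iff.2 ?_, hmin⟩
    have hx1 : x ≠ 1 := by rintro rfl; exact hx.2 (by simpa using hρ)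
    simpa using bdf_ne_nonpos hk1 hk6 (by simpa using hx.1) hx1 le_rfl
  refine bdf_ne_on_ball_of_preconnected hk1 (isPreconnected_Ioc (a := (0 : ℝ)) (b := r))
    (fun s hs => hs.1) he (fun s hs => hb s ⟨hs.1.le, hs.2⟩) (r₁ := min (m / 2) r)
    ⟨lt_min (by positivity) hr, min_le_right _ _⟩ (fun ξ hξ => ?_) ⟨hr, le_rfl⟩ hζ
  by_cases hξρ : ξ ∈ Metric.ball (1 : ℂ) ρ
  · refine ne_ofReal_mul_of_norm_sub_le he hre (sub_ne_zero.2 (hne1 ξ hξ).symm) (hnear ξ hξρ) ?_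
      (le_min (by positivity) hr.le)
    have h1 : e.re / 4 * ‖1 - ξ‖ ≤ 0 :=
      mul_nonpos_of_nonpos_of_nonneg (by linarith) (norm_nonneg _)
    have h2 : ξ.re ≤ 1 := (Complex.re_le_norm ξ).trans hξ.le
    simp only [Complex.sub_re, Complex.one_re]
    linarith
  · intro h
    have h1 := hm ξ ⟨by simpa using hξ.le, hξρ⟩
    rw [h, norm_mul, he, mul_one, Complex.norm_real,
      Real.norm_of_nonneg (le_min (by positivity) hr.le)] at h1
    linarith [min_le_left (m / 2) r]

/-- The exponentials of points `w ≠ 0` in a slightly enlarged right half strip are mapped off a ray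
that is not met by the root locus curve. -/
theorem exists_forall_bdf_exp_ne (hk1 : 1 ≤ k) (hk6 : k ≤ 6) (he : ‖e‖ = 1) (hre : e.re < 0)
    {T : Set ℝ} (hTc : IsClosed T) (hT0 : ∀ r ∈ T, 0 ≤ r) (hT : ∀ r ∈ T, Icc 0 r ⊆ T)
    (hb : ∀ r ∈ T, ∀ ζ : ℂ, ‖ζ‖ = 1 → ζ ≠ 1 → bdf k ζ ≠ r * e) :
    ∃ ε : ℝ, 0 < ε ∧ ∀ w : ℂ, -ε * |w.im| < w.re → |w.im| < 4 → ∀ r ∈ T,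
      bdf k (Complex.exp (-w)) ≠ r * e := by
  -- The height `4` lies strictly between `π` and `2π`: the contour, of scaled height `π`, stays
  -- inside the strip, and the strip contains no period of the exponential.
  have hexp1 : ∀ w : ℂ, w ≠ 0 → |w.im| ≤ 4 → Complex.exp (-w) ≠ 1 := by
    intro w hw hw4 h
    obtain ⟨n, hn⟩ := Complex.exp_eq_one_iff.1 h
    have him : -w.im = n * (2 * Real.pi) := by simpa using congrArg Complex.im hn
    have hn0 : n = 0 := by
      have h1 : |(n : ℝ)| * (2 * Real.pi) ≤ 4 := by
        rw [← abs_of_pos Real.two_pi_pos, ← abs_mul, ← him, abs_neg]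
        exact hw4
      have h2 : |(n : ℝ)| < 1 := by
        by_contra! h2
        nlinarith [Real.pi_gt_three]
      exact Int.abs_lt_one_iff.1 (by exact_mod_cast h2)
    rw [hn0] at hn
    exact hw (by simpa using hn)
  have hdisc : ∀ w : ℂ, w ≠ 0 → 0 ≤ w.re → |w.im| ≤ 4 → ∀ r ∈ T,
      bdf k (Complex.exp (-w)) ≠ r * e := by
    intro w hw hw0 hw4 r hr
    have h1 := hexp1 w hw hw4
    rcases hw0.eq_or_lt with h0 | h0
    · exact hb r hr _ (by simp [Complex.norm_exp, ← h0]) h1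
    · exact bdf_ne_on_ball_of_segment hk1 hk6 he hre (hT0 r hr) (fun s hs => hb s (hT r hr hs))
        (by simpa [Complex.norm_exp] using h0)
  have hnear : ∀ᶠ w : ℂ in 𝓝 0,
      ‖bdf k (Complex.exp (-w)) - w‖ ≤ -e.re / 4 * ‖w‖ := by
    have hd : HasDerivAt (fun w : ℂ => bdf k (Complex.exp (-w))) 1 0 := by
      have h1 : HasDerivAt (fun w : ℂ => Complex.exp (-w)) (-1) 0 := by
        simpa using (hasDerivAt_neg (0 : ℂ)).cexp
      have h2 : HasDerivAt (bdf k) (-1) (Complex.exp (-0)) := by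
        simpa using hasDerivAt_bdf_one hk1
      simpa [Function.comp_def] using! h2.comp (0 : ℂ) h1
    filter_upwards [(hasDerivAt_iff_isLittleO.1 hd).def (show 0 < -e.re / 4 by linarith)]
      with w hw
    simpa [bdf_one] using hw
  obtain ⟨ρ, hρ, hnear⟩ := Metric.eventually_nhds_iff_ball.1 hnear
  have hopen : IsOpen {w : ℂ | ∀ r ∈ T, bdf k (Complex.exp (-w)) ≠ r * e} := by
    -- Since `|e| = 1`, a point `u` of the ray has parameter `r = |u|`. The forbidden set is thus
    -- described by closed conditions on `u` without a quantifier.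
    have : {w : ℂ | ∀ r ∈ T, bdf k (Complex.exp (-w)) ≠ r * e} =
        (fun w : ℂ => bdf k (Complex.exp (-w))) ⁻¹' {u | ‖u‖ ∈ T ∧ u = (‖u‖ : ℂ) * e}ᶜ := by
      ext w
      simp only [mem_ofPred_eq, mem_preimage, mem_compl_iff]
      constructor
      · rintro h ⟨h1, h2⟩
        exact h _ h1 h2
      · intro h r hr hw
        have : ‖bdf k (Complex.exp (-w))‖ = r := by
          rw [hw, norm_mul, he, mul_one, Complex.norm_real, Real.norm_of_nonneg (hT0 r hr)]
        exact h ⟨this ▸ hr, this ▸ hw⟩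
    rw [this]
    refine IsOpen.preimage ((continuous_bdf k).comp (by fun_prop)) ?_
    rw [isOpen_compl_iff]
    exact (hTc.preimage continuous_norm).inter (isClosed_eq continuous_id (by fun_prop))
  have hK : IsCompact ((fun y : ℝ => (y : ℂ) * Complex.I) '' (Icc (-4) 4 \ Ioo (-(ρ / 2)) (ρ / 2))) :=
    (isCompact_Icc.diff isOpen_Ioo).image (by fun_prop)
  obtain ⟨ε₂, hε₂, hthick⟩ := hK.exists_thickening_subset_open hopen (by
    rintro _ ⟨y, ⟨hy4, hy⟩, rfl⟩
    refine hdisc _ ?_ (by simp) (by simpa [abs_le] using hy4)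
    rintro h
    have : y = 0 := by simpa using h
    exact hy (by rw [this]; constructor <;> linarith))
  -- The first bound serves the expansion near `0`. The bound `1` ensures `|Im w| ≥ ρ/2` when `|w| ≥
  -- ρ` and `Re w < 0`. The last keeps `w` within `ε₂` of the imaginary axis, as `|Im w| < 4`.
  refine ⟨min (min (-e.re / 4) 1) (ε₂ / 4), by
    refine lt_min (lt_min (by linarith) one_pos) (by linarith), fun w hw hw4 => ?_⟩
  have hε1 : min (min (-e.re / 4) 1) (ε₂ / 4) ≤ -e.re / 4 :=
    (min_le_left _ _).trans (min_le_left _ _)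
  have hε2 : min (min (-e.re / 4) 1) (ε₂ / 4) ≤ 1 := (min_le_left _ _).trans (min_le_right _ _)
  have hε3 : min (min (-e.re / 4) 1) (ε₂ / 4) ≤ ε₂ / 4 := min_le_right _ _
  have hεpos : 0 < min (min (-e.re / 4) 1) (ε₂ / 4) :=
    lt_min (lt_min (by linarith) one_pos) (by linarith)
  generalize min (min (-e.re / 4) 1) (ε₂ / 4) = ε at *
  have hw0 : w ≠ 0 := by rintro rfl; simp at hw
  rcases le_or_gt 0 w.re with hre0 | hre0
  · exact hdisc w hw0 hre0 hw4.le
  have hy0 := abs_nonneg w.im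
  rcases lt_or_ge ‖w‖ ρ with hwρ | hwρ
  · intro r hr
    refine ne_ofReal_mul_of_norm_sub_le he hre hw0 (hnear w (by simpa using hwρ)) ?_ (hT0 r hr)
    have h1 : ε * |w.im| ≤ -e.re / 4 * ‖w‖ :=
      mul_le_mul hε1 (Complex.abs_im_le_norm w) hy0 (by linarith)
    linarith
  · refine hthick (Metric.mem_thickening_iff.2 ⟨w.im * Complex.I, ⟨w.im, ⟨?_, ?_⟩, rfl⟩, ?_⟩)
    · exact abs_le.1 hw4.le
    · intro h
      have h1 := Complex.norm_le_abs_re_add_abs_im w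
      have h2 : |w.im| < ρ / 2 := abs_lt.2 h
      rw [abs_of_neg hre0] at h1
      nlinarith
    · have : dist w (w.im * Complex.I) = |w.re| := by
        rw [dist_eq_norm, ← Real.norm_eq_abs, ← Complex.norm_real]
        congr 1
        apply Complex.ext <;> simp
      rw [this, abs_of_neg hre0]
      nlinarith

end Ray

/-! ## Powers of the generating polynomial -/

theorem eq_pi_or_eq_neg_pi_of_cos_eq_neg_one {x : ℝ} (hx : |x| < 2 * Real.pi)
    (h : Real.cos x = -1) : x = Real.pi ∨ x = -Real.pi := by
  have hπ := Real.pi_pos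
  obtain ⟨h1, h2⟩ := abs_lt.1 hx
  rcases le_or_gt 0 x with h0 | h0
  · left
    have := (Real.cos_eq_one_iff_of_lt_of_lt (x := x - Real.pi) (by linarith) (by linarith)).1
      (by rw [Real.cos_sub_pi, h, neg_neg])
    linarith
  · right
    have := (Real.cos_eq_one_iff_of_lt_of_lt (x := x + Real.pi) (by linarith) (by linarith)).1
      (by rw [Real.cos_add_pi, h, neg_neg])
    linarith

section Power

variable {k : ℕ} {α : ℝ}

/-- A power `u ^ α` with `1 < α < 2` lies on the negative real axis only if `u` lies on one of the
rays with angles `±π / α`. -/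
theorem cpow_eq_neg_ofReal {u : ℂ} (hα1 : 1 < α) (hα2 : α < 2) (hu : u ≠ 0) {y : ℝ}
    (hy : 0 ≤ y) (h : u ^ (α : ℂ) = -(y : ℂ)) :
    ‖u‖ ^ α = y ∧ (u = ‖u‖ * Complex.exp ((Real.pi / α : ℝ) * Complex.I) ∨
      u = ‖u‖ * Complex.exp ((-(Real.pi / α) : ℝ) * Complex.I)) := by
  have hπ := Real.pi_pos
  have hα0 : 0 < α := by linarith
  have hn : ‖u‖ ^ α = y := by
    have := congrArg norm h
    rwa [Complex.norm_cpow_real, norm_neg, Complex.norm_real,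
      Real.norm_of_nonneg hy] at this
  have hpos : 0 < ‖u‖ ^ α := Real.rpow_pos_of_pos (norm_pos_iff.2 hu) _
  have hcos : Real.cos (u.arg * α) = -1 := by
    rw [Complex.cpow_ofReal] at h
    have := congrArg Complex.re h
    simp only [Complex.mul_re, Complex.add_re, Complex.ofReal_re, Complex.I_re, mul_zero,
      Complex.ofReal_im, Complex.I_im, Complex.add_im, Complex.mul_im, Complex.neg_re] at this
    have h3 : ‖u‖ ^ α * (Real.cos (u.arg * α) + 1) = 0 := by
      rw [hn] at this ⊢; linarith
    have := (mul_eq_zero.1 h3).resolve_left hpos.ne'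
    linarith
  -- This is where `α < 2` enters: the only odd multiples of `π` in range are `±π`.
  have habs : |u.arg * α| < 2 * Real.pi := by
    rw [abs_mul, abs_of_pos hα0]
    have := Complex.abs_arg_le_pi u
    nlinarith [abs_nonneg u.arg]
  refine ⟨hn, ?_⟩
  have hrep := (Complex.norm_mul_exp_arg_mul_I u).symm
  rcases eq_pi_or_eq_neg_pi_of_cos_eq_neg_one habs hcos with h' | h'
  · left
    rwa [show u.arg = Real.pi / α by field_simp; linarith] at hrep
  · right
    rwa [show u.arg = -(Real.pi / α) by field_simp; linarith] at hrep

theorem ofReal_mul_exp_cpow {φ : ℝ} (hφ : φ ∈ Ioc (-Real.pi) Real.pi) {r : ℝ} (hr : 0 < r)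
    (hcos : Real.cos (φ * α) = -1) :
    ((r : ℂ) * Complex.exp (φ * Complex.I)) ^ (α : ℂ) = -((r ^ α : ℝ) : ℂ) := by
  have harg : ((r : ℂ) * Complex.exp (φ * Complex.I)).arg = φ := by
    rw [Complex.exp_mul_I]
    exact Complex.arg_mul_cos_add_sin_mul_I hr hφ
  have hnorm : ‖(r : ℂ) * Complex.exp (φ * Complex.I)‖ = r := by
    rw [norm_mul, Complex.norm_exp_ofReal_mul_I, mul_one, Complex.norm_real,
      Real.norm_of_nonneg hr.le]
  have hsin : Real.sin (φ * α) = 0 := by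
    have := Real.sin_sq_add_cos_sq (φ * α)
    rw [hcos] at this
    nlinarith [sq_nonneg (Real.sin (φ * α))]
  rw [Complex.cpow_ofReal, harg, hnorm, hcos, hsin]
  simp

/-- The inequality `α < π/(π - ϑ_k)` says `π - π/α < ϑ_k`. Taking an element of the set below its
supremum avoids having to know that the supremum is attained. -/
theorem exists_isAStable_of_lt_criticalOrder (hα1 : 1 < α) (h : α < criticalOrder k) :
    ∃ ϑ : ℝ, Real.pi - Real.pi / α < ϑ ∧ IsAStable k ϑ := by
  have hπ := Real.pi_pos
  have hle : stabilityAngle k ≤ Real.pi / 2 :=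
    Real.sSup_le (fun x hx => hx.2.1) (by positivity)
  have hne : {ϑ : ℝ | 0 < ϑ ∧ ϑ ≤ Real.pi / 2 ∧ IsAStable k ϑ}.Nonempty := by
    by_contra hne
    -- The supremum of the empty set is `0` by convention, which would make the critical order `1`,
    -- less than `α`.
    rw [not_nonempty_iff_eq_empty] at hne
    rw [criticalOrder, stabilityAngle, hne, Real.sSup_empty, sub_zero, div_self hπ.ne'] at h
    linarith
  have hlt : Real.pi - Real.pi / α < stabilityAngle k := by
    rw [criticalOrder, lt_div_iff₀ (by linarith)] at h
    have : Real.pi - stabilityAngle k < Real.pi / α := by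
      rw [lt_div_iff₀ (by linarith)]
      linarith
    linarith
  obtain ⟨ϑ, hϑ, hlt⟩ := exists_lt_of_lt_csSup hne hlt
  exact ⟨ϑ, hlt, hϑ.2.2⟩

/-- The root locus curve does not meet the rays `±π / α` as far as the stability of the scheme of
order `α` requires. -/
theorem bdf_ne_of_norm_eq_one (hk1 : 1 ≤ k) (hk6 : k ≤ 6) (hα1 : 1 < α) (hα2 : α < 2) {η : ℝ}
    (hη : 0 < η) {σ : ℝ} (hσ : σ = 1 ∨ σ = -1) {r : ℝ} (hr : 0 ≤ r)
    (h : α < criticalOrder k ∨ r ^ α ≤ cflConst α k - η) {ζ : ℂ} (hζ : ‖ζ‖ = 1) (hζ1 : ζ ≠ 1) :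
    bdf k ζ ≠ r * Complex.exp ((σ * (Real.pi / α) : ℝ) * Complex.I) := by
  intro he
  have hπ := Real.pi_pos
  have hα0 : 0 < α := by linarith
  have hlt : Real.pi / α < Real.pi := div_lt_self hπ hα1
  have hpos : 0 < Real.pi / α := by positivity
  rcases hr.eq_or_lt with rfl | hr
  · exact bdf_ne_nonpos_of_norm_eq_one hk1 hk6 hζ hζ1 le_rfl (by simpa using he)
  rcases h with h | h
  · obtain ⟨ϑ, hϑ, hst⟩ := exists_isAStable_of_lt_criticalOrder hα1 h
    have hneg : -bdf k ζ = r * Complex.exp ((σ * (Real.pi / α - Real.pi) : ℝ) * Complex.I) := by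
      rw [he, ← mul_neg, show ((σ * (Real.pi / α - Real.pi) : ℝ) : ℂ) * Complex.I =
        ((σ * (Real.pi / α) : ℝ) : ℂ) * Complex.I - (σ : ℂ) * (Real.pi * Complex.I) by
          push_cast; ring, Complex.exp_sub]
      rcases hσ with rfl | rfl <;> simp [Complex.exp_neg] <;> ring
    have harg : (-bdf k ζ).arg = σ * (Real.pi / α - Real.pi) := by
      rw [hneg, Complex.exp_mul_I]
      refine Complex.arg_mul_cos_add_sin_mul_I hr ?_
      rcases hσ with rfl | rfl <;> constructor <;> linarith
    have habs : |(-bdf k ζ).arg| < ϑ := by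
      rw [harg]
      have : |σ * (Real.pi / α - Real.pi)| = Real.pi - Real.pi / α := by
        rw [abs_mul, abs_of_neg (by linarith : Real.pi / α - Real.pi < 0)]
        rcases hσ with rfl | rfl <;> simp
      rwa [this]
    have hne0 : -bdf k ζ ≠ 0 := by
      rw [hneg]
      exact mul_ne_zero (by exact_mod_cast hr.ne') (Complex.exp_ne_zero _)
    have hslit : -bdf k ζ ∈ Complex.slitPlane := by
      rw [Complex.mem_slitPlane_iff_arg, harg]
      refine ⟨?_, hne0⟩
      rcases hσ with rfl | rfl <;> intro h' <;> linarith
    -- The point `-δ(ζ)` lies in the open stability sector, so `-δ(sζ)` does too for `s < 1` close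
    -- to `1`. Then `sζ` is a root inside the unit disc, which A(ϑ)-stability forbids.
    have hc : Tendsto (fun s : ℝ => -bdf k ((s : ℂ) * ζ)) (𝓝[<] 1) (𝓝 (-bdf k ζ)) := by
      refine tendsto_nhdsWithin_of_tendsto_nhds (Continuous.tendsto' ?_ _ _ (by simp))
      exact ((continuous_bdf k).comp (by fun_prop)).neg
    obtain ⟨s, ⟨⟨hs1, hs2⟩, hs3⟩, hs4⟩ := (((((Complex.continuousAt_arg hslit).abs.tendsto.comp
      hc).eventually_lt_const habs).and (hc.eventually_ne hne0)).and
      (Ioo_mem_nhdsLT (zero_lt_one' ℝ))).and self_mem_nhdsWithin |>.exists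
    have := (hst _ (neg_ne_zero.1 hs2) hs1 _ rfl).1
    rw [norm_mul, hζ, mul_one, Complex.norm_real, Real.norm_of_nonneg hs3.1.le] at this
    exact absurd hs3.2 (not_lt.2 this)
  · have hpow : bdf k ζ ^ (α : ℂ) = -((r ^ α : ℝ) : ℂ) := by
      rw [he]
      refine ofReal_mul_exp_cpow ?_ hr ?_
      · rcases hσ with rfl | rfl <;> constructor <;> linarith
      · rw [mul_assoc, div_mul_cancel₀ _ hα0.ne']
        rcases hσ with rfl | rfl <;> simp
    have : cflConst α k ≤ r ^ α :=
      -- `r^α` would be one of the crossings whose infimum is `cflConst`, against `r^α ≤ c - η`.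
      csInf_le ⟨0, fun x hx => hx.1.le⟩ ⟨Real.rpow_pos_of_pos hr _, ζ, hζ, hpow⟩
    linarith

/-- In a slightly enlarged right half strip, `δ(e^{-w})` avoids the branch cut and its power of
order `α` avoids the part of the negative real axis that the step size condition admits for the
spectrum. -/
theorem exists_forall_bdf_exp_mem_slitPlane (hk1 : 1 ≤ k) (hk6 : k ≤ 6) (hα1 : 1 < α)
    (hα2 : α < 2) {η : ℝ} (hη : 0 < η) :
    ∃ ε : ℝ, 0 < ε ∧ ∀ w : ℂ, -ε * |w.im| < w.re → |w.im| < 4 →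
      bdf k (Complex.exp (-w)) ∈ Complex.slitPlane ∧
      ∀ y : ℝ, 0 ≤ y → bdf k (Complex.exp (-w)) ^ (α : ℂ) = -(y : ℂ) →
        criticalOrder k ≤ α ∧ cflConst α k - η < y := by
  have hπ := Real.pi_pos
  have hα0 : 0 < α := by linarith
  have hlt : Real.pi / α < Real.pi := div_lt_self hπ hα1
  have hgt : Real.pi / 2 < Real.pi / α := div_lt_div_of_pos_left hπ hα0 hα2
  obtain ⟨ε₀, hε₀, h₀⟩ := exists_forall_bdf_exp_ne hk1 hk6 (e := -1) (by simp) (by simp)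
    (T := Ici 0) isClosed_Ici (fun _ h => h) (fun r _ => Icc_subset_Ici_self)
    (fun r hr ζ h1 h2 => bdf_ne_nonpos_of_norm_eq_one hk1 hk6 h1 h2 hr)
  -- The admissible radii form an initial part of `[0, ∞)`: all of it below the critical order,
  -- otherwise those with `r^α ≤ c - η`. The sign `σ` selects one of the two conjugate rays.
  have hside : ∀ σ : ℝ, σ = 1 ∨ σ = -1 → ∃ ε : ℝ, 0 < ε ∧ ∀ w : ℂ, -ε * |w.im| < w.re →
      |w.im| < 4 → ∀ r ∈ {r : ℝ | 0 ≤ r ∧ (α < criticalOrder k ∨ r ^ α ≤ cflConst α k - η)},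
        bdf k (Complex.exp (-w)) ≠ r * Complex.exp ((σ * (Real.pi / α) : ℝ) * Complex.I) := by
    intro σ hσ
    refine exists_forall_bdf_exp_ne hk1 hk6 (Complex.norm_exp_ofReal_mul_I _) ?_ ?_
      (fun r hr => hr.1) ?_ (fun r hr ζ h1 h2 => bdf_ne_of_norm_eq_one hk1 hk6 hα1 hα2 hη hσ
        hr.1 hr.2 h1 h2)
    · rw [Complex.exp_ofReal_mul_I_re]
      have := Real.cos_neg_of_pi_div_two_lt_of_lt hgt (by linarith)
      rcases hσ with rfl | rfl <;> simpa using this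
    · refine isClosed_Ici.inter ?_
      exact isClosed_const.union
        (isClosed_le (Real.continuous_rpow_const hα0.le) continuous_const)
    · rintro r ⟨hr0, hr⟩ s ⟨hs0, hsr⟩
      exact ⟨hs0, hr.imp_right (Real.rpow_le_rpow hs0 hsr hα0.le).trans⟩
  obtain ⟨ε₁, hε₁, h₁⟩ := hside 1 (Or.inl rfl)
  obtain ⟨ε₂, hε₂, h₂⟩ := hside (-1) (Or.inr rfl)
  refine ⟨min ε₀ (min ε₁ ε₂), lt_min hε₀ (lt_min hε₁ hε₂), fun w hw hw4 => ?_⟩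
  have hle : ∀ ε, min ε₀ (min ε₁ ε₂) ≤ ε → -ε * |w.im| < w.re := fun ε hε =>
    hw.trans_le' (mul_le_mul_of_nonneg_right (neg_le_neg hε) (abs_nonneg _))
  have hslit : bdf k (Complex.exp (-w)) ∈ Complex.slitPlane := by
    by_contra hn
    rw [Complex.mem_slitPlane_iff, not_or, not_lt, not_not] at hn
    refine h₀ w (hle _ (min_le_left _ _)) hw4 (-(bdf k (Complex.exp (-w))).re)
      (neg_nonneg.2 hn.1) ?_
    apply Complex.ext <;> simp [hn.2]
  refine ⟨hslit, fun y hy hpow => ?_⟩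
  by_contra hcon
  obtain ⟨hn, hrep⟩ := cpow_eq_neg_ofReal hα1 hα2 (Complex.slitPlane_ne_zero hslit) hy hpow
  have hT : ‖bdf k (Complex.exp (-w))‖ ∈
      {r : ℝ | 0 ≤ r ∧ (α < criticalOrder k ∨ r ^ α ≤ cflConst α k - η)} := by
    refine ⟨norm_nonneg _, ?_⟩
    rw [hn]
    rw [not_and_or, not_le, not_lt] at hcon
    exact hcon
  rcases hrep with hrep | hrep
  · exact h₁ w (hle _ ((min_le_right _ _).trans (min_le_left _ _))) hw4 _ hT (by simpa using hrep)
  · exact h₂ w (hle _ ((min_le_right _ _).trans (min_le_right _ _))) hw4 _ hT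
      (by simpa using hrep)

end Power

/-! ## Resolvents -/

section Resolvent

variable {X : Type*} [NormedAddCommGroup X] [InnerProductSpace ℂ X] {A : X →ₗ.[ℂ] X} {lam : ℂ}

theorem IsResolvent.unique {R S : X →L[ℂ] X} (hR : IsResolvent A lam R)
    (hS : IsResolvent A lam S) : R = S := by
  ext x
  have := hR.left ⟨S x, hS.mem x⟩
  rwa [hS.right] at this

theorem IsResolvent.resolventOp_eq {R : X →L[ℂ] X} (hR : IsResolvent A lam R) :
    resolventOp A lam = R := by
  have h : ∃ R, IsResolvent A lam R := ⟨R, hR⟩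
  rw [resolventOp, dif_pos h]
  exact h.choose_spec.unique hR

theorem InResolventSet.isResolvent (h : InResolventSet A lam) :
    IsResolvent A lam (resolventOp A lam) := by
  obtain ⟨R, hR⟩ := h
  rwa [hR.resolventOp_eq]

/-- From the factorization `z - A = (1 + (z - lam) R)(lam - A)` on the domain of `A`. It reduces
questions about the unbounded operator to the invertibility of a bounded one. -/
theorem IsResolvent.of_isUnit {R : X →L[ℂ] X} (hR : IsResolvent A lam R) {z : ℂ}
    (hu : IsUnit (1 + (z - lam) • R)) :
    IsResolvent A z (R * Ring.inverse (1 + (z - lam) • R)) where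
  mem x := hR.mem _
  right x := by
    have h1 := DFunLike.congr_fun (Ring.mul_inverse_cancel _ hu) x
    obtain ⟨q, hq⟩ : ∃ q, q = Ring.inverse (1 + (z - lam) • R) x := ⟨_, rfl⟩
    have h2 := hR.right q
    simp only [mul_apply_eq_comp, add_apply, one_apply_eq_self, smul_apply, ← hq] at h1 ⊢
    calc z • R q - A ⟨R q, hR.mem q⟩
        = (lam • R q - A ⟨R q, hR.mem q⟩) + (z - lam) • R q := by module
      _ = x := by rw [h2, h1]
  left u := by
    have h1 : (1 + (z - lam) • R) (lam • (u : X) - A u) = z • (u : X) - A u := by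
      simp only [add_apply, one_apply_eq_self,
        smul_apply, hR.left u]
      module
    have h2 := DFunLike.congr_fun (Ring.inverse_mul_cancel _ hu) (lam • (u : X) - A u)
    simp only [mul_apply_eq_comp, h1, one_apply_eq_self] at h2 ⊢
    rw [h2, hR.left]

theorem InResolventSet.differentiableAt [CompleteSpace X] (h : InResolventSet A lam) :
    DifferentiableAt ℂ (resolventOp A) lam := by
  have hR := h.isResolvent
  set R := resolventOp A lam with hRdef
  have hd : DifferentiableAt ℂ (fun z : ℂ => (1 : X →L[ℂ] X) + (z - lam) • R) lam := by fun_prop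
  have hu : IsUnit ((fun z : ℂ => (1 : X →L[ℂ] X) + (z - lam) • R) lam) := by simp
  have hev : ∀ᶠ z in 𝓝 lam, resolventOp A z = R * Ring.inverse (1 + (z - lam) • R) := by
    filter_upwards [hd.continuousAt.preimage_mem_nhds (Units.isOpen.mem_nhds hu)] with z hz
    exact (hR.of_isUnit hz).resolventOp_eq
  refine DifferentiableAt.congr_of_eventuallyEq ?_ hev
  exact ((differentiableAt_inverse (𝕜 := ℂ) hu).comp lam hd).const_mul R

theorem norm_inner_le_of_numericalRadius_le {r : ℝ} (hr : 0 ≤ r)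
    (h : numericalRadius A ≤ ENNReal.ofReal r) (u : A.domain) :
    ‖inner ℂ (u : X) (A u)‖ ≤ r * ‖(u : X)‖ ^ 2 := by
  rcases eq_or_ne (u : X) 0 with h0 | h0
  · simp [h0]
  have hn : 0 < ‖(u : X)‖ := norm_pos_iff.2 h0
  set c : ℂ := ((‖(u : X)‖⁻¹ : ℝ) : ℂ) with hc
  have hcn : ‖c‖ = ‖(u : X)‖⁻¹ := by
    rw [hc, Complex.norm_real, norm_inv, norm_norm]
  have hu1 : ‖((c • u : A.domain) : X)‖ = 1 := by
    rw [Submodule.coe_smul, norm_smul, hcn, inv_mul_cancel₀ hn.ne']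
  have h1 : ‖inner ℂ ((c • u : A.domain) : X) (A (c • u))‖ₑ ≤ ENNReal.ofReal r :=
    (le_iSup₂ (f := fun (u : A.domain) (_ : ‖(u : X)‖ = 1) => ‖inner ℂ (u : X) (A u)‖ₑ)
      (c • u) hu1).trans h
  rw [← ofReal_norm, ENNReal.ofReal_le_ofReal_iff hr, LinearPMap.map_smul, Submodule.coe_smul,
    inner_smul_left, inner_smul_right, norm_mul, norm_mul, RCLike.norm_conj, hcn] at h1
  calc ‖inner ℂ (u : X) (A u)‖
      = (‖(u : X)‖⁻¹ * (‖(u : X)‖⁻¹ * ‖inner ℂ (u : X) (A u)‖)) * ‖(u : X)‖ ^ 2 := by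
        field_simp
    _ ≤ r * ‖(u : X)‖ ^ 2 := by gcongr

/-- The lower bound gives injectivity and closed range. By self-adjointness the orthogonal
complement of the range is the kernel, so the range is also dense. -/
theorem isUnit_of_isSelfAdjoint_of_bound [CompleteSpace X] {S : X →L[ℂ] X} (hS : IsSelfAdjoint S)
    {C : ℝ} (h : ∀ x, ‖x‖ ≤ C * ‖S x‖) : IsUnit S := by
  rw [ContinuousLinearMap.isUnit_iff_bijective,
    ContinuousLinearMap.bijective_iff_dense_range_and_antilipschitz]
  refine ⟨?_, ⟨C.toNNReal, S.antilipschitz_of_bound fun x => (h x).trans ?_⟩⟩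
  · rw [Submodule.topologicalClosure_eq_top_iff, Submodule.eq_bot_iff]
    intro x hx
    have h0 : S x = 0 := by
      refine ext_inner_left ℂ fun y => ?_
      rw [inner_zero_right, ← ContinuousLinearMap.adjoint_inner_left, hS.adjoint_eq]
      exact hx (S y) ⟨y, rfl⟩
    simpa [h0] using h x
  · gcongr
    exact Real.le_coe_toNNReal C

/-! ### Resolvent points from the bounded operator `(1 - A)⁻¹` -/

section Contractive

variable [CompleteSpace X] {J : X →L[ℂ] X}

/-- As `0 ≤ J ≤ 1` in the sense of forms, the normalized values of the form of `1 + (lam - 1) J`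
are, up to conjugation, on the segment from `1` to `lam`. The slit plane is star-shaped about `1`,
so this segment keeps a positive distance from `0`, and coercivity gives invertibility. -/
theorem IsResolvent.inResolventSet_of_mem_slitPlane (hJ : IsResolvent A 1 J)
    (hJ0 : ∀ y, ∃ s : ℝ, 0 ≤ s ∧ s ≤ ‖y‖ ^ 2 ∧ inner ℂ (J y) y = (s : ℂ))
    (hlam : lam ∈ Complex.slitPlane) : InResolventSet A lam := by
  refine ⟨_, hJ.of_isUnit ?_⟩
  have hne : ∀ t ∈ Icc (0 : ℝ) 1, 1 + (lam - 1) * t ≠ 0 := by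
    intro t ht
    have := Complex.slitPlane_ne_zero (Complex.starConvex_one_slitPlane hlam
      (sub_nonneg.2 ht.2) ht.1 (by ring))
    intro h
    apply this
    simp only [Complex.real_smul]
    push_cast
    linear_combination h
  obtain ⟨t₀, ht₀, hmin⟩ := isCompact_Icc.exists_isMinOn (nonempty_Icc.2 zero_le_one)
    (f := fun t : ℝ => ‖1 + (lam - 1) * t‖) (by fun_prop)
  have hc : 0 < ‖1 + (lam - 1) * (t₀ : ℂ)‖ := norm_pos_iff.2 (hne t₀ ht₀)
  refine ContinuousLinearMap.isUnit_of_forall_le_norm_inner_map _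
    (c := ⟨‖1 + (lam - 1) * (t₀ : ℂ)‖, hc.le⟩) hc fun y => ?_
  obtain ⟨s, hs0, hs1, hs⟩ := hJ0 y
  rcases eq_or_ne y 0 with rfl | hy
  · simp
  have hy2 : 0 < ‖y‖ ^ 2 := by positivity
  have hin : inner ℂ ((1 + (lam - 1) • J) y) y =
      (starRingEnd ℂ) (1 + (lam - 1) * (s / ‖y‖ ^ 2 : ℝ)) * (‖y‖ ^ 2 : ℝ) := by
    have h0 : ((‖y‖ : ℝ) : ℂ) ≠ 0 := by exact_mod_cast (norm_pos_iff.2 hy).ne'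
    simp only [add_apply, one_apply_eq_self,
      smul_apply, inner_add_left, inner_smul_left, hs,
      inner_self_eq_norm_sq_to_K]
    simp
    field_simp
  rw [hin, norm_mul, RCLike.norm_conj, Complex.norm_real, Real.norm_of_nonneg hy2.le, mul_comm]
  exact mul_le_mul_of_nonneg_right (hmin ⟨div_nonneg hs0 hy2.le, (div_le_one hy2).2 hs1⟩) hy2.le

/-- With `r` the numerical radius, Cauchy–Schwarz gives `(x - r) ‖u‖ ≤ ‖(x + A) u‖` on the domain.
For `y = (1 - A) u` one has `y = (1 + x) u - (x + A) u`, which turns this into a lower bound for the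
self-adjoint operator `1 - (1 + x) J`. -/
theorem IsResolvent.inResolventSet_neg_of_numericalRadius_lt (hJ : IsResolvent A 1 J)
    (hJs : IsSelfAdjoint J) {x : ℝ} (hx : numericalRadius A < ENNReal.ofReal x) :
    InResolventSet A (-(x : ℂ)) := by
  have hx0 : 0 < x := ENNReal.ofReal_pos.1 (hx.trans_le' zero_le)
  obtain ⟨r, hr0, hrx, hr⟩ : ∃ r : ℝ, 0 ≤ r ∧ r < x ∧ numericalRadius A ≤ ENNReal.ofReal r :=
    ⟨(numericalRadius A).toReal, ENNReal.toReal_nonneg,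
      (ENNReal.lt_ofReal_iff_toReal_lt hx.ne_top).1 hx, (ENNReal.ofReal_toReal hx.ne_top).ge⟩
  refine ⟨_, hJ.of_isUnit (isUnit_of_isSelfAdjoint_of_bound (C := 1 + (1 + x) / (x - r)) ?_ ?_)⟩
  · refine (IsSelfAdjoint.one _).add (IsSelfAdjoint.smul ?_ hJs)
    simp [isSelfAdjoint_iff]
  · intro y
    set u : A.domain := ⟨J y, hJ.mem y⟩ with hu
    have hy : y = (u : X) - A u := by simpa using (hJ.right y).symm
    set w : X := (x : ℂ) • (u : X) + A u with hw
    have hfy : (1 + (-(x : ℂ) - 1) • J) y = -w := by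
      have : J y = u := rfl
      simp only [add_apply, one_apply_eq_self,
        smul_apply, this]
      rw [hy]
      module
    rw [hfy, norm_neg]
    have h1 : (x - r) * ‖(u : X)‖ ≤ ‖w‖ := by
      rcases (norm_nonneg (u : X)).eq_or_lt with h0 | h0
      · rw [← h0, mul_zero]
        exact norm_nonneg _
      have h2 := norm_inner_le_norm (𝕜 := ℂ) (u : X) w
      have h3 := norm_inner_le_of_numericalRadius_le hr0 hr u
      have h4 : ‖inner ℂ (u : X) ((x : ℂ) • (u : X))‖ = x * ‖(u : X)‖ ^ 2 := by
        rw [inner_smul_right, norm_mul, Complex.norm_real, Real.norm_of_nonneg hx0.le,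
          inner_self_eq_norm_sq_to_K]
        simp
      have h5 : ‖inner ℂ (u : X) ((x : ℂ) • (u : X))‖ - ‖inner ℂ (u : X) (A u)‖ ≤
          ‖inner ℂ (u : X) w‖ := by
        rw [hw, inner_add_right]
        exact norm_sub_le_norm_add _ _
      have h6 : ‖(u : X)‖ * ((x - r) * ‖(u : X)‖) ≤ ‖(u : X)‖ * ‖w‖ := by nlinarith
      exact le_of_mul_le_mul_left h6 h0
    have h7 : ‖(u : X)‖ ≤ ‖w‖ / (x - r) := by
      rw [le_div_iff₀ (by linarith)]
      linarith
    have h8 : y = ((1 + x : ℝ) : ℂ) • (u : X) - w := by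
      nth_rewrite 1 [hy]
      rw [hw]
      push_cast
      module
    calc ‖y‖ ≤ (1 + x) * ‖(u : X)‖ + ‖w‖ := by
          rw [h8]
          refine (norm_sub_le _ _).trans ?_
          rw [norm_smul, Complex.norm_real, Real.norm_of_nonneg (by linarith)]
      _ ≤ (1 + x) * (‖w‖ / (x - r)) + ‖w‖ := by gcongr
      _ = (1 + (1 + x) / (x - r)) * ‖w‖ := by ring

end Contractive

/-! ### Operators associated with a form -/

section Variational

variable [CompleteSpace X] {E : Type*} [NormedAddCommGroup E] [InnerProductSpace ℂ E]
  [CompleteSpace E] {ι : E →L[ℂ] X}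

/-- The resolvent of the operator associated with a form whose energy space is `E`. -/
theorem isResolvent_one_of_variational
    (hA : ∀ u w : X, (∃ h : u ∈ A.domain, A ⟨u, h⟩ = w) ↔
      ∃ p : E, ι p = u ∧ ∀ q : E, inner ℂ (ι q) (u - w) = inner ℂ q p) :
    IsResolvent A 1 (ι ∘L ι.adjoint) := by
  have hgraph : ∀ y : X, ∃ h : ι (ι.adjoint y) ∈ A.domain,
      A ⟨_, h⟩ = ι (ι.adjoint y) - y := by
    intro y
    rw [hA]
    refine ⟨ι.adjoint y, rfl, fun q => ?_⟩
    rw [sub_sub_cancel, ContinuousLinearMap.adjoint_inner_right]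
  refine ⟨fun y => (hgraph y).1, fun y => ?_, fun u => ?_⟩
  · obtain ⟨h1, h2⟩ := hgraph y
    have : A ⟨(ι ∘L ι.adjoint) y, h1⟩ = _ := h2
    rw [this]
    simp
  · obtain ⟨p, hp, hpw⟩ := (hA _ _).1 ⟨u.2, rfl⟩
    -- The inner product of `E` is the form of `1 - A`, so the weak equation states exactly that the
    -- adjoint embedding maps the right-hand side to `p`.
    have h : ι.adjoint ((1 : ℂ) • (u : X) - A u) = p := by
      refine ext_inner_left ℂ fun q => ?_
      rw [ContinuousLinearMap.adjoint_inner_right, one_smul]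
      exact hpw q
    rw [ContinuousLinearMap.comp_apply, h, hp]

theorem inResolventSet_of_variational
    (hA : ∀ u w : X, (∃ h : u ∈ A.domain, A ⟨u, h⟩ = w) ↔
      ∃ p : E, ι p = u ∧ ∀ q : E, inner ℂ (ι q) (u - w) = inner ℂ q p)
    (hι : ∀ p, ‖ι p‖ ≤ ‖p‖) (h : lam ∈ Complex.slitPlane ∨
      ∃ x : ℝ, lam = -(x : ℂ) ∧ numericalRadius A < ENNReal.ofReal x) :
    InResolventSet A lam := by
  have hJ := isResolvent_one_of_variational hA
  rcases h with h | ⟨x, rfl, hx⟩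
  · refine hJ.inResolventSet_of_mem_slitPlane (fun y => ?_) h
    have h1 : ‖ι.adjoint y‖ ≤ ‖y‖ := by
      refine (ι.adjoint.le_opNorm y).trans ?_
      rw [LinearIsometryEquiv.norm_map]
      have := ι.opNorm_le_bound zero_le_one fun p => (hι p).trans_eq (one_mul _).symm
      nlinarith [norm_nonneg y]
    refine ⟨‖ι.adjoint y‖ ^ 2, sq_nonneg _, by gcongr, ?_⟩
    rw [ContinuousLinearMap.comp_apply, ← ContinuousLinearMap.adjoint_inner_right,
      inner_self_eq_norm_sq_to_K]
    simp
  · refine hJ.inResolventSet_neg_of_numericalRadius_lt ?_ hx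
    rw [ContinuousLinearMap.isSelfAdjoint_iff', ContinuousLinearMap.adjoint_comp,
      ContinuousLinearMap.adjoint_adjoint]

end Variational

end Resolvent

/-! ## The resolvent of the Laplacian -/

section Laplacian

variable {d : ℕ} {Ω : Set (EuclideanSpace ℝ (Fin d))}

/-- The embedding of a subspace of `H¹₀(Ω)` into its closure in `L²(Ω)`. -/
noncomputable def l2Embedding (V : Submodule ℂ (L2Pairs Ω)) : V →L[ℂ] L2Closure V :=
  ((WithLp.fstL 2 ℂ (L2 Ω) (PiLp 2 (fun _ : Fin d => L2 Ω))).comp V.subtypeL).codRestrict _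
    fun p => Submodule.le_topologicalClosure _ ⟨p, p.2, rfl⟩

theorem coe_l2Embedding (V : Submodule ℂ (L2Pairs Ω)) (p : V) :
    (l2Embedding V p : L2 Ω) = (p : L2Pairs Ω).fst := rfl

theorem norm_l2Embedding_le (V : Submodule ℂ (L2Pairs Ω)) (p : V) : ‖l2Embedding V p‖ ≤ ‖p‖ := by
  have h := WithLp.prod_norm_sq_eq_of_L2 (p : L2Pairs Ω)
  refine le_of_sq_le_sq ?_ (norm_nonneg _)
  rw [Submodule.coe_norm, Submodule.coe_norm, coe_l2Embedding, h]
  linarith [sq_nonneg ‖(p : L2Pairs Ω).snd‖]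

variable {V : Submodule ℂ (L2Pairs Ω)}

theorem mem_laplacianGraph_iff {u w : L2Closure V} :
    (∃ h : u ∈ (laplacian V).domain, laplacian V ⟨u, h⟩ = w) ↔ (u, w) ∈ laplacianGraph V := by
  rw [← laplacian_graph, LinearPMap.mem_graph_iff]
  constructor
  · rintro ⟨h, e⟩
    exact ⟨⟨u, h⟩, rfl, e⟩
  · rintro ⟨⟨y, hy⟩, rfl, e⟩
    exact ⟨hy, e⟩

/-- The energy space is `V` with the `H¹` inner product, complete because `V` is closed. Subtracting
the `L²` part from both sides turns the weak formulation of `u - A u` into the one that defines the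
graph of `A`. -/
theorem inResolventSet_laplacian (hV : IsClosed (V : Set (L2Pairs Ω))) {lam : ℂ}
    (h : lam ∈ Complex.slitPlane ∨
      ∃ x : ℝ, lam = -(x : ℂ) ∧ numericalRadius (laplacian V) < ENNReal.ofReal x) :
    InResolventSet (laplacian V) lam := by
  have : CompleteSpace V := hV.completeSpace_coe
  refine inResolventSet_of_variational (X := L2Closure V) (E := V) (ι := l2Embedding V)
    (fun u w => ?_) (fun p => ?_) h
  swap
  · exact norm_l2Embedding_le V p
  rw [mem_laplacianGraph_iff]
  have key : ∀ p q : V, l2Embedding V p = u →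
      (inner ℂ (l2Embedding V q) (u - w) = inner ℂ q p ↔
        inner ℂ (q : L2Pairs Ω).fst (w : L2 Ω) =
          -inner ℂ (q : L2Pairs Ω).snd (p : L2Pairs Ω).snd) := by
    rintro p q rfl
    have h1 : inner ℂ (l2Embedding V q) (l2Embedding V p - w) =
        inner ℂ (q : L2Pairs Ω).fst (p : L2Pairs Ω).fst -
          inner ℂ (q : L2Pairs Ω).fst (w : L2 Ω) := by
      rw [Submodule.coe_inner, Submodule.coe_sub, inner_sub_right]
      rfl
    have h2 : inner ℂ q p = inner ℂ (q : L2Pairs Ω).fst (p : L2Pairs Ω).fst +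
        inner ℂ (q : L2Pairs Ω).snd (p : L2Pairs Ω).snd := WithLp.prod_inner_apply _ _
    rw [h1, h2, sub_eq_add_neg, add_right_inj, neg_eq_iff_eq_neg]
  constructor
  · rintro ⟨p, hp, hpu, hpw⟩
    have hu : l2Embedding V ⟨p, hp⟩ = u := Subtype.ext hpu
    exact ⟨⟨p, hp⟩, hu, fun q => (key _ q hu).2 (hpw q q.2)⟩
  · rintro ⟨p, hpu, hpw⟩
    exact ⟨p, p.2, congrArg Subtype.val hpu, fun q hq => (key p ⟨q, hq⟩ hpu).1 (hpw _)⟩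

end Laplacian

/-! ## Integration along the contour -/

section Primitive

variable {X : Type*} [NormedAddCommGroup X] [NormedSpace ℂ X] [CompleteSpace X]

theorem exists_primitive_of_isOpen_convex {s : Set ℂ} (hs : IsOpen s) (hc : Convex ℝ s)
    {F : ℂ → X} (hF : DifferentiableOn ℂ F s) : ∃ G : ℂ → X, ∀ z ∈ s, HasDerivAt G (F z) z := by
  obtain ⟨G, hG⟩ := hc.exists_forall_hasDerivWithinAt hF
  exact ⟨G, fun z hz => (hG z hz).hasDerivAt (hs.mem_nhds hz)⟩

open Classical in
-- Primitives on the two convex pieces differ by a constant on the convex intersection, and they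
-- glue after one is shifted by that constant.
theorem exists_primitive_of_convex_union {s t : Set ℂ} (hs : IsOpen s) (ht : IsOpen t)
    (hsc : Convex ℝ s) (htc : Convex ℝ t) {z₀ : ℂ} (hz₀ : z₀ ∈ s ∩ t) {F : ℂ → X}
    (hF : DifferentiableOn ℂ F (s ∪ t)) : ∃ G : ℂ → X, ∀ z ∈ s ∪ t, HasDerivAt G (F z) z := by
  obtain ⟨G₁, h₁⟩ := exists_primitive_of_isOpen_convex hs hsc (hF.mono subset_union_left)
  obtain ⟨G₂, h₂⟩ := exists_primitive_of_isOpen_convex ht htc (hF.mono subset_union_right)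
  have hconst : ∀ z ∈ s ∩ t, G₁ z = G₂ z + (G₁ z₀ - G₂ z₀) := by
    intro z hz
    have hd : ∀ w ∈ s ∩ t, HasDerivWithinAt (fun w => G₁ w - G₂ w) 0 (s ∩ t) w := by
      intro w hw
      simpa using ((h₁ w hw.1).fun_sub (h₂ w hw.2)).hasDerivWithinAt
    have := (hsc.inter htc).norm_image_sub_le_of_norm_hasDerivWithin_le (C := 0) hd
      (by simp) hz₀ hz
    simp only [zero_mul, norm_le_zero_iff] at this
    rw [← sub_eq_zero.1 this]
    abel
  refine ⟨fun z => if z ∈ s then G₁ z else G₂ z + (G₁ z₀ - G₂ z₀), fun z hz => ?_⟩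
  by_cases hzs : z ∈ s
  · refine (h₁ z hzs).congr_of_eventuallyEq ?_
    filter_upwards [hs.mem_nhds hzs] with w hw
    rw [if_pos hw]
  · have hzt : z ∈ t := hz.resolve_left hzs
    refine ((h₂ z hzt).add_const (G₁ z₀ - G₂ z₀)).congr_of_eventuallyEq ?_
    filter_upwards [ht.mem_nhds hzt] with w hw
    split_ifs with hws
    · exact hconst w ⟨hws, hw⟩
    · rfl

end Primitive

/-- The intersection of a horizontal strip with a sector of opening larger than `π`. -/
def cutStrip (ε b : ℝ) : Set ℂ := {z | -ε * |z.im| < z.re ∧ |z.im| < b}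

section CutStrip

variable {ε b : ℝ}

theorem add_ofReal_mem_cutStrip {z : ℂ} (hz : z ∈ cutStrip ε b) {x : ℝ} (hx : 0 ≤ x) :
    z + x ∈ cutStrip ε b := by
  refine ⟨?_, ?_⟩
  · simp only [Complex.add_im, Complex.ofReal_im, add_zero, Complex.add_re, Complex.ofReal_re]
    linarith [hz.1]
  · simpa using hz.2

/-- The region has a reentrant corner at the origin and is not convex. It is the union of two
strips, each cut by one half plane through the origin. -/
theorem exists_primitive_on_cutStrip {X : Type*} [NormedAddCommGroup X] [NormedSpace ℂ X]
    [CompleteSpace X] (hε : 0 < ε) (hb : 0 < b) {F : ℂ → X}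
    (hF : DifferentiableOn ℂ F (cutStrip ε b)) :
    ∃ G : ℂ → X, ∀ z ∈ cutStrip ε b, HasDerivAt G (F z) z := by
  have hopen : ∀ c : ℝ, IsOpen {z : ℂ | 0 < z.re + c * z.im ∧ |z.im| < b} := fun c =>
    (isOpen_lt continuous_const (Complex.continuous_re.add
      (continuous_const.mul Complex.continuous_im))).and
      (isOpen_lt Complex.continuous_im.abs continuous_const)
  have hconv : ∀ c : ℝ, Convex ℝ {z : ℂ | 0 < z.re + c * z.im ∧ |z.im| < b} := by
    intro c x hx y hy p q hp hq hpq
    simp only [mem_ofPred_eq, Complex.add_re, Complex.add_im, Complex.real_smul, Complex.mul_re,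
      Complex.mul_im, Complex.ofReal_re, Complex.ofReal_im, zero_mul, sub_zero, add_zero, abs_lt]
      at hx hy ⊢
    obtain rfl : q = 1 - p := by linarith
    rcases hp.eq_or_lt with rfl | hp
    · simpa using hy
    · refine ⟨?_, ?_, ?_⟩
      · nlinarith [mul_pos hp hx.1, mul_nonneg hq hy.1.le]
      · nlinarith [mul_pos hp (sub_pos.2 hx.2.1), mul_nonneg hq (sub_pos.2 hy.2.1).le]
      · nlinarith [mul_pos hp (sub_pos.2 hx.2.2), mul_nonneg hq (sub_pos.2 hy.2.2).le]
  have heq : cutStrip ε b = {z : ℂ | 0 < z.re + ε * z.im ∧ |z.im| < b} ∪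
      {z : ℂ | 0 < z.re + -ε * z.im ∧ |z.im| < b} := by
    ext z
    simp only [cutStrip, mem_ofPred_eq, mem_union, ← or_and_right]
    refine and_congr_left fun _ => ⟨fun h => ?_, fun h => ?_⟩
    · rcases abs_cases z.im with ⟨h1, _⟩ | ⟨h1, _⟩ <;> rw [h1] at h
      · left; linarith
      · right; linarith
    · rcases h with h | h
      · nlinarith [mul_le_mul_of_nonneg_left (le_abs_self z.im) hε.le]
      · nlinarith [mul_le_mul_of_nonneg_left (neg_abs_le z.im) hε.le]
  rw [heq] at hF ⊢
  exact exists_primitive_of_convex_union (hopen _) (hopen _) (hconv _) (hconv _) (z₀ := 1)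
    (by simp [hb]) hF

end CutStrip

section Contour

variable {θ δ τ : ℝ}

theorem ray_mem_contour (hθ0 : 0 < θ) (hθπ : θ < Real.pi) (hτ : 0 < τ) (hδ : 0 < δ)
    (hδτ : δ < Real.pi / τ) {ρ : ℝ} (hρ : ρ ∈ uIcc δ (Real.pi / (τ * Real.sin θ))) :
    (ρ : ℂ) * Complex.exp (Complex.I * θ) ∈ contour θ δ τ ∧
      (ρ : ℂ) * Complex.exp (-(Complex.I * θ)) ∈ contour θ δ τ := by
  have hs : 0 < Real.sin θ := Real.sin_pos_of_pos_of_lt_pi hθ0 hθπ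
  have hle : δ ≤ Real.pi / (τ * Real.sin θ) := by
    refine hδτ.le.trans (div_le_div_of_nonneg_left Real.pi_pos.le (by positivity) ?_)
    exact mul_le_of_le_one_right hτ.le (Real.sin_le_one θ)
  rw [uIcc_of_le hle] at hρ
  have hρ0 : 0 < ρ := hδ.trans_le hρ.1
  have hb : ρ * Real.sin θ ≤ Real.pi / τ := by
    rw [le_div_iff₀ hτ]
    have := (le_div_iff₀ (by positivity)).1 hρ.2
    linarith
  have him : ((ρ : ℂ) * Complex.exp (Complex.I * θ)).im = ρ * Real.sin θ := by
    rw [mul_comm Complex.I, Complex.im_ofReal_mul, Complex.exp_ofReal_mul_I_im]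
  have him' : ((ρ : ℂ) * Complex.exp (-(Complex.I * θ))).im = -(ρ * Real.sin θ) := by
    rw [show -(Complex.I * θ) = ((-θ : ℝ) : ℂ) * Complex.I by push_cast; ring,
      Complex.im_ofReal_mul, Complex.exp_ofReal_mul_I_im, Real.sin_neg, mul_neg]
  refine ⟨⟨Or.inr ⟨ρ, hρ.1, Or.inl rfl⟩, ?_⟩, ⟨Or.inr ⟨ρ, hρ.1, Or.inr rfl⟩, ?_⟩⟩
  · rwa [him, abs_of_nonneg (by positivity)]
  · rwa [him', abs_neg, abs_of_nonneg (by positivity)]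

theorem arc_mem_contour (hθ0 : 0 < θ) (hθπ : θ < Real.pi) (hδ : 0 < δ)
    (hδτ : δ < Real.pi / τ) {φ : ℝ} (hφ : φ ∈ uIcc (-θ) θ) :
    (δ : ℂ) * Complex.exp (Complex.I * φ) ∈ contour θ δ τ := by
  rw [uIcc_of_le (by linarith)] at hφ
  have hn : ‖(δ : ℂ) * Complex.exp (Complex.I * φ)‖ = δ := by
    rw [mul_comm Complex.I, norm_mul, Complex.norm_exp_ofReal_mul_I, mul_one, Complex.norm_real,
      Real.norm_of_nonneg hδ.le]
  refine ⟨Or.inl ⟨hn, ?_⟩, ((Complex.abs_im_le_norm _).trans_eq hn).trans hδτ.le⟩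
  rw [mul_comm Complex.I, Complex.exp_mul_I,
    Complex.arg_mul_cos_add_sin_mul_I hδ ⟨by linarith [hφ.1], by linarith [hφ.2]⟩]
  exact abs_le.2 hφ

theorem contour_subset_cutStrip {ε : ℝ} (hε : 0 < ε) (hθ : Real.pi / 2 < θ) (hθπ : θ < Real.pi)
    (hθε : -ε * Real.sin θ < Real.cos θ) (hτ : 0 < τ) (hδ : 0 < δ) :
    contour θ δ τ ⊆ cutStrip ε (4 / τ) := by
  have hπ := Real.pi_pos
  have hs : 0 < Real.sin θ := Real.sin_pos_of_pos_of_lt_pi (by linarith) hθπ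
  have hangle : ∀ φ : ℝ, |φ| ≤ θ → -ε * |Real.sin φ| < Real.cos φ := by
    intro φ hφ
    rcases lt_or_ge |φ| (Real.pi / 2) with h | h
    · have := Real.cos_pos_of_mem_Ioo (abs_lt.1 h)
      nlinarith [abs_nonneg (Real.sin φ)]
    · have h1 : Real.cos θ ≤ Real.cos φ := by
        rw [← Real.cos_abs φ]
        exact Real.cos_le_cos_of_nonneg_of_le_pi (abs_nonneg _) hθπ.le hφ
      -- Beyond a right angle, increasing the angle makes the cosine more negative and the sine
      -- smaller, so the inequality at `θ` is the worst case.
      have h2 : Real.sin θ ≤ |Real.sin φ| := by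
        have h3 : Real.cos φ ≤ 0 := by
          rw [← Real.cos_abs φ]
          exact Real.cos_nonpos_of_pi_div_two_le_of_le h (by linarith)
        refine le_of_sq_le_sq ?_ (abs_nonneg _)
        rw [sq_abs]
        nlinarith [Real.sin_sq_add_cos_sq θ, Real.sin_sq_add_cos_sq φ]
      nlinarith
  have hpolar : ∀ (ρ φ : ℝ) (z : ℂ), 0 < ρ → |φ| ≤ θ →
      z = ρ * Complex.exp ((φ : ℂ) * Complex.I) → -ε * |z.im| < z.re := by
    rintro ρ φ z hρ hφ rfl
    rw [Complex.im_ofReal_mul, Complex.re_ofReal_mul, Complex.exp_ofReal_mul_I_re,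
      Complex.exp_ofReal_mul_I_im, abs_mul, abs_of_pos hρ]
    nlinarith [mul_lt_mul_of_pos_left (hangle φ hφ) hρ]
  rintro z ⟨hz, him⟩
  refine ⟨?_, him.trans_lt (div_lt_div_of_pos_right (by linarith [Real.pi_lt_four]) hτ)⟩
  have hθabs : |θ| ≤ θ := (abs_of_pos (by linarith)).le
  rcases hz with ⟨hn, harg⟩ | ⟨ρ, hρ, rfl | rfl⟩
  · exact hpolar δ z.arg z hδ harg (by rw [← hn, Complex.norm_mul_exp_arg_mul_I])
  · exact hpolar ρ θ _ (hδ.trans_le hρ) hθabs (by rw [mul_comm Complex.I])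
  · exact hpolar ρ (-θ) _ (hδ.trans_le hρ) (by rwa [abs_neg]) (by
      rw [mul_comm Complex.I]; push_cast; rw [neg_mul])

/-- The lower end point of the contour. -/
noncomputable def contourEnd (θ τ : ℝ) : ℂ :=
  ((Real.pi / (τ * Real.sin θ) : ℝ) : ℂ) * Complex.exp (-(Complex.I * θ))

theorem contourEnd_im (hs : Real.sin θ ≠ 0) : (contourEnd θ τ).im = -(Real.pi / τ) := by
  rw [contourEnd, show -(Complex.I * θ) = ((-θ : ℝ) : ℂ) * Complex.I by push_cast; ring,
    Complex.im_ofReal_mul, Complex.exp_ofReal_mul_I_im, Real.sin_neg]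
  field_simp

theorem contourEnd_add (hs : Real.sin θ ≠ 0) :
    contourEnd θ τ + 2 * Real.pi * Complex.I / τ =
      ((Real.pi / (τ * Real.sin θ) : ℝ) : ℂ) * Complex.exp (Complex.I * θ) := by
  rcases eq_or_ne τ 0 with rfl | hτ
  · simp [contourEnd]
  have h1 : Complex.exp (Complex.I * θ) - Complex.exp (-(Complex.I * θ)) =
      2 * Complex.I * (Real.sin θ : ℂ) := by
    rw [mul_comm Complex.I, ← neg_mul, Complex.exp_mul_I, Complex.exp_mul_I, Complex.cos_neg,
      Complex.sin_neg, Complex.ofReal_sin]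
    ring
  have hs' : (Real.sin θ : ℂ) ≠ 0 := by exact_mod_cast hs
  have hτ' : (τ : ℂ) ≠ 0 := by exact_mod_cast hτ
  have h2 : (2 * Real.pi * Complex.I / τ : ℂ) =
      ((Real.pi / (τ * Real.sin θ) : ℝ) : ℂ) * (2 * Complex.I * (Real.sin θ : ℂ)) := by
    push_cast at hs' ⊢
    field_simp
  rw [h2, ← h1, contourEnd]
  ring

/-! ### Integrals of vector-valued functions over the contour -/

section Integral

variable {X : Type*} [NormedAddCommGroup X] [InnerProductSpace ℂ X] {F : ℂ → X}

omit [InnerProductSpace ℂ X] in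
theorem contourIntegrable_of_continuousOn (hθ0 : 0 < θ) (hθπ : θ < Real.pi) (hτ : 0 < τ)
    (hδ : 0 < δ) (hδτ : δ < Real.pi / τ) (hF : ContinuousOn F (contour θ δ τ)) :
    ContourIntegrable θ δ τ F := by
  refine ⟨ContinuousOn.intervalIntegrable ?_, ContinuousOn.intervalIntegrable ?_,
    ContinuousOn.intervalIntegrable ?_⟩
  · exact hF.comp (by fun_prop) fun ρ hρ => (ray_mem_contour hθ0 hθπ hτ hδ hδτ hρ).2
  · exact hF.comp (by fun_prop) fun φ hφ => arc_mem_contour hθ0 hθπ hδ hδτ hφ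
  · exact hF.comp (by fun_prop) fun ρ hρ => (ray_mem_contour hθ0 hθπ hτ hδ hδτ hρ).1

theorem ContourIntegrable.intervalIntegrable_smul (hF : ContourIntegrable θ δ τ F) :
    IntervalIntegrable (fun ρ : ℝ => Complex.exp (-(Complex.I * θ)) •
        F (ρ * Complex.exp (-(Complex.I * θ)))) volume δ (Real.pi / (τ * Real.sin θ)) ∧
      IntervalIntegrable (fun φ : ℝ => (Complex.I * δ * Complex.exp (Complex.I * φ)) •
        F (δ * Complex.exp (Complex.I * φ))) volume (-θ) θ ∧
      IntervalIntegrable (fun ρ : ℝ => Complex.exp (Complex.I * θ) •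
        F (ρ * Complex.exp (Complex.I * θ))) volume δ (Real.pi / (τ * Real.sin θ)) :=
  ⟨hF.1.smul _, hF.2.1.continuousOn_smul (by fun_prop), hF.2.2.smul _⟩

theorem contourIntegral_add {F₁ F₂ : ℂ → X} (h₁ : ContourIntegrable θ δ τ F₁)
    (h₂ : ContourIntegrable θ δ τ F₂) :
    contourIntegral θ δ τ (fun z => F₁ z + F₂ z) =
      contourIntegral θ δ τ F₁ + contourIntegral θ δ τ F₂ := by
  have h₁ := h₁.intervalIntegrable_smul
  have h₂ := h₂.intervalIntegrable_smul
  simp only [contourIntegral, smul_add]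
  rw [intervalIntegral.integral_add h₁.1 h₂.1, intervalIntegral.integral_add h₁.2.1 h₂.2.1,
    intervalIntegral.integral_add h₁.2.2 h₂.2.2]
  abel

theorem contourIntegral_sub {F₁ F₂ : ℂ → X} (h₁ : ContourIntegrable θ δ τ F₁)
    (h₂ : ContourIntegrable θ δ τ F₂) :
    contourIntegral θ δ τ (fun z => F₁ z - F₂ z) =
      contourIntegral θ δ τ F₁ - contourIntegral θ δ τ F₂ := by
  have h₁ := h₁.intervalIntegrable_smul
  have h₂ := h₂.intervalIntegrable_smul
  simp only [contourIntegral, smul_sub]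
  rw [intervalIntegral.integral_sub h₁.1 h₂.1, intervalIntegral.integral_sub h₁.2.1 h₂.2.1,
    intervalIntegral.integral_sub h₁.2.2 h₂.2.2]
  abel

theorem contourIntegral_congr (hθ0 : 0 < θ) (hθπ : θ < Real.pi) (hτ : 0 < τ) (hδ : 0 < δ)
    (hδτ : δ < Real.pi / τ) {F₁ F₂ : ℂ → X} (h : EqOn F₁ F₂ (contour θ δ τ)) :
    contourIntegral θ δ τ F₁ = contourIntegral θ δ τ F₂ := by
  unfold contourIntegral
  congr 1
  · congr 1
    · congr 1
      exact intervalIntegral.integral_congr fun ρ hρ => by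
        simp only [h (ray_mem_contour hθ0 hθπ hτ hδ hδτ hρ).2]
    · exact intervalIntegral.integral_congr fun φ hφ => by
        simp only [h (arc_mem_contour hθ0 hθπ hδ hδτ hφ)]
  · exact intervalIntegral.integral_congr fun ρ hρ => by
      simp only [h (ray_mem_contour hθ0 hθπ hτ hδ hδτ hρ).1]

theorem contourIntegral_sum (hθ0 : 0 < θ) (hθπ : θ < Real.pi) (hτ : 0 < τ) (hδ : 0 < δ)
    (hδτ : δ < Real.pi / τ) {ι : Type*} {I : Finset ι} {f : ι → ℂ → X}
    (hf : ∀ i ∈ I, ContinuousOn (f i) (contour θ δ τ)) :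
    contourIntegral θ δ τ (fun z => ∑ i ∈ I, f i z) = ∑ i ∈ I, contourIntegral θ δ τ (f i) := by
  classical
  induction I using Finset.induction_on with
  | empty => simp [contourIntegral]
  | insert i I hi ih =>
    have hI : ∀ j ∈ I, ContinuousOn (f j) (contour θ δ τ) :=
      fun j hj => hf j (Finset.mem_insert_of_mem hj)
    simp only [Finset.sum_insert hi]
    rw [contourIntegral_add (contourIntegrable_of_continuousOn hθ0 hθπ hτ hδ hδτ
      (hf i (Finset.mem_insert_self _ _))) (contourIntegrable_of_continuousOn hθ0 hθπ hτ hδ hδτ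
      (continuousOn_finsetSum _ hI)), ih hI]

theorem norm_contourIntegral_le (hθ0 : 0 < θ) (hθπ : θ < Real.pi) (hτ : 0 < τ) (hδ : 0 < δ)
    (hδτ : δ < Real.pi / τ) {C : ℝ} (h : ∀ z ∈ contour θ δ τ, ‖F z‖ ≤ C) :
    ‖contourIntegral θ δ τ F‖ ≤
      C * (2 * |Real.pi / (τ * Real.sin θ) - δ| + δ * |θ - -θ|) := by
  unfold contourIntegral
  have e1 : ∀ t : ℝ, ‖Complex.exp (Complex.I * t)‖ = 1 := fun t => by
    rw [mul_comm, Complex.norm_exp_ofReal_mul_I]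
  have e2 : ‖Complex.exp (-(Complex.I * θ))‖ = 1 := by simpa using e1 (-θ)
  refine (norm_add₃_le).trans ?_
  rw [norm_neg]
  have h1 := intervalIntegral.norm_integral_le_of_norm_le_const (C := C)
    (f := fun ρ : ℝ => Complex.exp (-(Complex.I * θ)) • F (ρ * Complex.exp (-(Complex.I * θ))))
    (a := δ) (b := Real.pi / (τ * Real.sin θ)) fun ρ hρ => by
      rw [norm_smul, e2, one_mul]
      exact h _ (ray_mem_contour hθ0 hθπ hτ hδ hδτ (uIoc_subset_uIcc hρ)).2
  have h2 := intervalIntegral.norm_integral_le_of_norm_le_const (C := δ * C)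
    (f := fun φ : ℝ => (Complex.I * δ * Complex.exp (Complex.I * φ)) •
      F (δ * Complex.exp (Complex.I * φ))) (a := -θ) (b := θ) fun φ hφ => by
      rw [norm_smul, norm_mul, e1, mul_one, norm_mul, Complex.norm_I, one_mul, Complex.norm_real,
        Real.norm_of_nonneg hδ.le]
      exact mul_le_mul_of_nonneg_left
        (h _ (arc_mem_contour hθ0 hθπ hδ hδτ (uIoc_subset_uIcc hφ))) hδ.le
  have h3 := intervalIntegral.norm_integral_le_of_norm_le_const (C := C)
    (f := fun ρ : ℝ => Complex.exp (Complex.I * θ) • F (ρ * Complex.exp (Complex.I * θ)))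
    (a := δ) (b := Real.pi / (τ * Real.sin θ)) fun ρ hρ => by
      rw [norm_smul, e1, one_mul]
      exact h _ (ray_mem_contour hθ0 hθπ hτ hδ hδτ (uIoc_subset_uIcc hρ)).1
  linarith

/-- Contour integrals commute with uniform limits. -/
theorem contourIntegral_eq_of_tendstoUniformlyOn (hθ0 : 0 < θ) (hθπ : θ < Real.pi) (hτ : 0 < τ)
    (hδ : 0 < δ) (hδτ : δ < Real.pi / τ) {f : ℕ → ℂ → X} {c : X}
    (hf : ∀ n, ContinuousOn (f n) (contour θ δ τ)) (hc : ∀ n, contourIntegral θ δ τ (f n) = c)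
    (h : TendstoUniformlyOn f F atTop (contour θ δ τ)) : contourIntegral θ δ τ F = c := by
  have hF : ContourIntegrable θ δ τ F := contourIntegrable_of_continuousOn hθ0 hθπ hτ hδ hδτ
    (h.continuousOn (Frequently.of_forall hf))
  set L := 2 * |Real.pi / (τ * Real.sin θ) - δ| + δ * |θ - -θ| with hL
  have hL0 : 0 ≤ L := by positivity
  rw [← sub_eq_zero, ← norm_le_zero_iff]
  refine le_of_forall_pos_le_add fun ε hε => ?_
  obtain ⟨n, hn⟩ := (Metric.tendstoUniformlyOn_iff.1 h (ε / (L + 1)) (by positivity)).exists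
  rw [← hc n, ← contourIntegral_sub hF
    (contourIntegrable_of_continuousOn hθ0 hθπ hτ hδ hδτ (hf n)), zero_add]
  refine (norm_contourIntegral_le hθ0 hθπ hτ hδ hδτ (C := ε / (L + 1)) fun z hz => ?_).trans ?_
  · rw [← dist_eq_norm]
    exact (hn z hz).le
  · rw [← hL, div_mul_eq_mul_div, div_le_iff₀ (by positivity)]
    nlinarith

variable [CompleteSpace X]

/-- The fundamental theorem of calculus on the three pieces. The inner end points cancel, and the
outer end points differ by exactly one period `2πi/τ`. -/
theorem contourIntegral_eq_sub (hθ0 : 0 < θ) (hθπ : θ < Real.pi) (hτ : 0 < τ) (hδ : 0 < δ)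
    (hδτ : δ < Real.pi / τ) (hF : ContinuousOn F (contour θ δ τ)) {G : ℂ → X}
    (hG : ∀ z ∈ contour θ δ τ, HasDerivAt G (F z) z) :
    contourIntegral θ δ τ F =
      G (contourEnd θ τ + 2 * Real.pi * Complex.I / τ) - G (contourEnd θ τ) := by
  have hs : Real.sin θ ≠ 0 := (Real.sin_pos_of_pos_of_lt_pi hθ0 hθπ).ne'
  have hi := (contourIntegrable_of_continuousOn hθ0 hθπ hτ hδ hδτ hF).intervalIntegrable_smul
  have hlin : ∀ (c : ℂ) (ρ : ℝ), HasDerivAt (fun ρ : ℝ => (ρ : ℂ) * c) c ρ := fun c ρ => by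
    simpa using (Complex.ofRealCLM.hasDerivAt (x := ρ)).mul_const c
  have harc : ∀ φ : ℝ, HasDerivAt (fun φ : ℝ => (δ : ℂ) * Complex.exp (Complex.I * φ))
      (Complex.I * δ * Complex.exp (Complex.I * φ)) φ := fun φ => by
    have h1 : HasDerivAt (fun φ : ℝ => Complex.I * (φ : ℂ)) Complex.I φ := by
      simpa using (Complex.ofRealCLM.hasDerivAt (x := φ)).const_mul Complex.I
    convert! h1.cexp.const_mul (δ : ℂ) using 1
    ring
  have I1 := intervalIntegral.integral_eq_sub_of_hasDerivAt
    (f := fun ρ : ℝ => G (ρ * Complex.exp (-(Complex.I * θ))))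
    (fun ρ hρ => (hG _ (ray_mem_contour hθ0 hθπ hτ hδ hδτ hρ).2).scomp ρ (hlin _ ρ)) hi.1
  have I2 := intervalIntegral.integral_eq_sub_of_hasDerivAt
    (f := fun φ : ℝ => G (δ * Complex.exp (Complex.I * φ)))
    (fun φ hφ => (hG _ (arc_mem_contour hθ0 hθπ hδ hδτ hφ)).scomp φ (harc φ)) hi.2.1
  have I3 := intervalIntegral.integral_eq_sub_of_hasDerivAt
    (f := fun ρ : ℝ => G (ρ * Complex.exp (Complex.I * θ)))
    (fun ρ hρ => (hG _ (ray_mem_contour hθ0 hθπ hτ hδ hδτ hρ).1).scomp ρ (hlin _ ρ)) hi.2.2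
  rw [contourIntegral, I1, I2, I3, contourEnd_add hs, contourEnd]
  push_cast
  rw [mul_neg]
  abel

/-- Orthogonality of exponentials over one period. For `m ≠ 0` the primitive is itself periodic,
while for `m = 0` it is linear and grows by the length of the period. -/
theorem contourIntegral_exp_smul (hθ0 : 0 < θ) (hθπ : θ < Real.pi) (hτ : 0 < τ) (hδ : 0 < δ)
    (hδτ : δ < Real.pi / τ) (m : ℤ) (x : X) :
    contourIntegral θ δ τ (fun z => Complex.exp (z * (m * τ)) • x) =
      if m = 0 then (2 * Real.pi * Complex.I / τ : ℂ) • x else 0 := by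
  have hτ' : (τ : ℂ) ≠ 0 := by exact_mod_cast hτ.ne'
  have hcont : ContinuousOn (fun z => Complex.exp (z * (m * τ)) • x) (contour θ δ τ) := by
    fun_prop
  split_ifs with hm
  · subst hm
    have hG : ∀ z : ℂ, HasDerivAt (fun z : ℂ => z • x)
        (Complex.exp (z * ((0 : ℤ) * τ)) • x) z := fun z => by
      simpa using (hasDerivAt_id z).smul_const x
    rw [contourIntegral_eq_sub hθ0 hθπ hτ hδ hδτ hcont fun z _ => hG z]
    module
  · have hm' : (m : ℂ) * τ ≠ 0 := mul_ne_zero (by exact_mod_cast hm) hτ'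
    have hG : ∀ z : ℂ, HasDerivAt (fun z : ℂ => (Complex.exp (z * (m * τ)) / (m * τ)) • x)
        (Complex.exp (z * (m * τ)) • x) z := fun z => by
      have h1 : HasDerivAt (fun z : ℂ => z * (m * τ)) (m * τ) z := by
        simpa using (hasDerivAt_id z).mul_const ((m : ℂ) * τ)
      have h2 := (h1.cexp.div_const ((m : ℂ) * τ)).smul_const x
      rwa [mul_div_assoc, div_self hm', mul_one] at h2
    rw [contourIntegral_eq_sub hθ0 hθπ hτ hδ hδτ hcont fun z _ => hG z, sub_eq_zero]
    congr 2
    rw [show (contourEnd θ τ + 2 * Real.pi * Complex.I / τ) * (m * τ) =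
      contourEnd θ τ * (m * τ) + m * (2 * Real.pi * Complex.I) by field_simp, Complex.exp_add,
      Complex.exp_int_mul_two_pi_mul_I, mul_one]

/-- Cauchy's theorem for periodic functions that decay at `+∞`. -/
theorem contourIntegral_eq_zero {ε : ℝ} (hε : 0 < ε) (hθ : Real.pi / 2 < θ) (hθπ : θ < Real.pi)
    (hθε : -ε * Real.sin θ < Real.cos θ) (hτ : 0 < τ) (hδ : 0 < δ) (hδτ : δ < Real.pi / τ)
    (hF : DifferentiableOn ℂ F (cutStrip ε (4 / τ)))
    (hper : ∀ z, F (z + 2 * Real.pi * Complex.I / τ) = F z)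
    (hlim : ∀ κ : ℝ, 0 < κ → ∃ x₀ : ℝ, ∀ z : ℂ, x₀ ≤ z.re → ‖F z‖ ≤ κ) :
    contourIntegral θ δ τ F = 0 := by
  have hπ := Real.pi_pos
  have hθ0 : 0 < θ := by linarith
  have hs : 0 < Real.sin θ := Real.sin_pos_of_pos_of_lt_pi hθ0 hθπ
  have hsub := contour_subset_cutStrip hε hθ hθπ hθε hτ hδ
  obtain ⟨G, hG⟩ := exists_primitive_on_cutStrip hε (by positivity) hF
  rw [contourIntegral_eq_sub hθ0 hθπ hτ hδ hδτ (hF.continuousOn.mono hsub)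
    fun z hz => hG z (hsub hz)]
  set p : ℂ := 2 * Real.pi * Complex.I / τ with hp
  set P := contourEnd θ τ with hP
  have hend : Real.pi / (τ * Real.sin θ) ∈ uIcc δ (Real.pi / (τ * Real.sin θ)) := right_mem_uIcc
  have hP0 : P ∈ cutStrip ε (4 / τ) := hsub (ray_mem_contour hθ0 hθπ hτ hδ hδτ hend).2
  have hP1 : P + p ∈ cutStrip ε (4 / τ) := by
    rw [hP, hp, contourEnd_add hs.ne']
    exact hsub (ray_mem_contour hθ0 hθπ hτ hδ hδτ hend).1
  have hpim : p.im = 2 * (Real.pi / τ) := by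
    rw [hp, show (2 * Real.pi * Complex.I / τ : ℂ) = ((2 * (Real.pi / τ) : ℝ) : ℂ) * Complex.I by
      push_cast; ring, Complex.im_ofReal_mul, Complex.I_im, mul_one]
  have hpre : p.re = 0 := by
    rw [hp, show (2 * Real.pi * Complex.I / τ : ℂ) = ((2 * (Real.pi / τ) : ℝ) : ℂ) * Complex.I by
      push_cast; ring, Complex.re_ofReal_mul, Complex.I_re, mul_zero]
  have hPim : P.im = -(Real.pi / τ) := contourEnd_im hs.ne'
  -- By periodicity of `F` the increment of the primitive over one period has zero derivative under
  -- translation to the right, so it may be computed arbitrarily far to the right.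
  have hconst : ∀ x : ℝ, 0 ≤ x → G (P + x + p) - G (P + x) = G (P + p) - G P := by
    have hd : ∀ x ∈ Ici (0 : ℝ), HasDerivWithinAt
        (fun x : ℝ => G (P + x + p) - G (P + x)) 0 (Ici 0) x := by
      intro x hx
      have h1 : HasDerivAt (fun x : ℝ => P + (x : ℂ)) 1 x := by
        simpa using (Complex.ofRealCLM.hasDerivAt (x := x)).const_add P
      have h2 := (hG _ (add_ofReal_mem_cutStrip hP0 hx)).scomp x h1
      have hmem : P + x + p ∈ cutStrip ε (4 / τ) := by
        rw [add_right_comm]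
        exact add_ofReal_mem_cutStrip hP1 hx
      have h3 := (hG _ hmem).scomp x (h1.add_const p)
      have h4 := h3.sub h2
      rw [hper, sub_self] at h4
      exact h4.hasDerivWithinAt
    intro x hx
    have := (convex_Ici (0 : ℝ)).norm_image_sub_le_of_norm_hasDerivWithin_le (C := 0) hd
      (by simp) self_mem_Ici hx
    simp only [zero_mul, norm_le_zero_iff] at this
    simpa using sub_eq_zero.1 this
  rw [← norm_le_zero_iff]
  refine le_of_forall_pos_le_add fun κ hκ => ?_
  obtain ⟨x₀, hx₀⟩ := hlim (κ / (‖p‖ + 1)) (by positivity)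
  set x : ℝ := |x₀| + |P.re| + 1 with hx
  have hx0 : 0 ≤ x := by positivity
  have hre : 0 < P.re + x := by
    have := neg_abs_le P.re
    have := abs_nonneg x₀
    linarith
  have hxx : x₀ ≤ P.re + x := by
    have := neg_abs_le P.re
    have := le_abs_self x₀
    linarith
  rw [← hconst x hx0, zero_add]
  -- Far to the right the increment is estimated along a vertical segment of length `|p|`, which
  -- lies in the strip and on which `F` is small.
  have hseg : ∀ z ∈ segment ℝ (P + x) (P + x + p), z.re = P.re + x ∧ |z.im| ≤ Real.pi / τ := by
    intro z hz
    rw [segment_eq_image'] at hz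
    obtain ⟨t, ht, rfl⟩ := hz
    have hq : 0 < Real.pi / τ := by positivity
    constructor
    · simp [hpre]
    · simp only [add_sub_cancel_left, Complex.add_im, Complex.ofReal_im, add_zero, Complex.real_smul,
        Complex.im_ofReal_mul, hPim, hpim, abs_le]
      constructor <;> nlinarith [ht.1, ht.2]
  have hbound := (convex_segment (𝕜 := ℝ) (P + x) (P + x + p)).norm_image_sub_le_of_norm_hasDerivWithin_le
    (f := G) (f' := F) (C := κ / (‖p‖ + 1)) (fun z hz => ?_) (fun z hz => ?_)
    (left_mem_segment ℝ _ _) (right_mem_segment ℝ _ _)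
  · refine hbound.trans ?_
    rw [add_sub_cancel_left, div_mul_eq_mul_div, div_le_iff₀ (by positivity)]
    nlinarith [norm_nonneg p]
  · refine (hG z ⟨?_, ?_⟩).hasDerivWithinAt
    · rw [(hseg z hz).1]
      nlinarith [abs_nonneg z.im]
    · exact (hseg z hz).2.trans_lt (div_lt_div_of_pos_right (by linarith [Real.pi_lt_four]) hτ)
  · exact hx₀ z (by rw [(hseg z hz).1]; exact hxx)

end Integral

end Contour

end DiffusionWave

open Asymptotics

namespace DiffusionWave

/-! ## Taylor coefficients up to a given order -/

section Jet

variable {X : Type*} [NormedAddCommGroup X] [NormedSpace ℂ X]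

/-- `f(ζ) = ∑_{n ≤ N} ζ^n s_n + O(ζ^{N+1})` as `ζ → 0`. -/
def HasJet (N : ℕ) (f : ℂ → X) (s : ℕ → X) : Prop :=
  (fun ζ : ℂ => f ζ - ∑ n ∈ Finset.range (N + 1), ζ ^ n • s n) =O[𝓝 0]
    fun ζ : ℂ => ‖ζ‖ ^ (N + 1)

variable {N : ℕ} {f g : ℂ → X} {s t : ℕ → X}

theorem HasJet.congr (hf : HasJet N f s) (hst : ∀ n ≤ N, s n = t n) : HasJet N f t := by
  unfold HasJet at hf ⊢
  convert! hf using 5 with ζ n hn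
  rw [hst _ (Nat.lt_succ_iff.1 (Finset.mem_range.1 (by assumption)))]

theorem HasJet.congr_left (hf : HasJet N f s) (hfg : f =ᶠ[𝓝 0] g) : HasJet N g s := by
  refine IsBigO.congr' hf ?_ EventuallyEq.rfl
  filter_upwards [hfg] with ζ hζ
  rw [hζ]

theorem HasJet.add (hf : HasJet N f s) (hg : HasJet N g t) :
    HasJet N (fun ζ => f ζ + g ζ) (fun n => s n + t n) := by
  unfold HasJet at *
  refine (IsBigO.add hf hg).congr_left fun ζ => ?_
  simp only [smul_add, Finset.sum_add_distrib]
  abel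

theorem HasJet.sub (hf : HasJet N f s) (hg : HasJet N g t) :
    HasJet N (fun ζ => f ζ - g ζ) (fun n => s n - t n) := by
  unfold HasJet at *
  refine (IsBigO.sub hf hg).congr_left fun ζ => ?_
  simp only [smul_sub, Finset.sum_sub_distrib]
  abel

theorem hasJet_zero : HasJet N (fun _ => (0 : X)) (fun _ => 0) := by
  unfold HasJet
  simpa using isBigO_zero _ _

theorem HasJet.sum {ι : Type*} {I : Finset ι} {f : ι → ℂ → X} {s : ι → ℕ → X}
    (h : ∀ i ∈ I, HasJet N (f i) (s i)) :
    HasJet N (fun ζ => ∑ i ∈ I, f i ζ) (fun n => ∑ i ∈ I, s i n) := by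
  classical
  induction I using Finset.induction_on with
  | empty => simpa using hasJet_zero
  | insert i I hi ih =>
    simp only [Finset.sum_insert hi]
    exact (h i (Finset.mem_insert_self _ _)).add
      (ih fun j hj => h j (Finset.mem_insert_of_mem hj))

theorem hasJet_pow_smul (p : ℕ) (x : X) :
    HasJet N (fun ζ => ζ ^ p • x) (fun n => if n = p then x else 0) := by
  unfold HasJet
  by_cases hp : p ≤ N
  · have : ∀ ζ : ℂ, ζ ^ p • x - ∑ n ∈ Finset.range (N + 1), ζ ^ n • (if n = p then x else 0) = 0 := by
      intro ζ
      simp [smul_ite, hp]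
    simpa only [this] using isBigO_zero _ _
  · have : ∀ ζ : ℂ, ζ ^ p • x - ∑ n ∈ Finset.range (N + 1), ζ ^ n • (if n = p then x else 0) =
        ζ ^ p • x := by
      intro ζ
      simp [smul_ite, hp]
    simp only [this]
    refine IsBigO.of_bound ‖x‖ ?_
    filter_upwards [Metric.closedBall_mem_nhds (0 : ℂ) one_pos] with ζ hζ
    rw [norm_smul, norm_pow, norm_pow, norm_norm, mul_comm]
    exact mul_le_mul_of_nonneg_left
      (pow_le_pow_of_le_one (norm_nonneg _) (by simpa using hζ) (by omega)) (norm_nonneg _)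

theorem HasJet.isBigO_one (hf : HasJet N f s) : f =O[𝓝 0] fun _ => (1 : ℝ) := by
  have h1 : (fun ζ : ℂ => ∑ n ∈ Finset.range (N + 1), ζ ^ n • s n) =O[𝓝 0] fun _ => (1 : ℝ) :=
    (Continuous.tendsto (by fun_prop) _).isBigO_one ℝ
  have h2 : (fun ζ : ℂ => ‖ζ‖ ^ (N + 1)) =O[𝓝 0] fun _ => (1 : ℝ) :=
    (Continuous.tendsto (by fun_prop) _).isBigO_one ℝ
  refine ((hf.trans h2).add h1).congr_left fun ζ => ?_
  abel

theorem hasJet_polynomial (s : ℕ → X) :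
    HasJet N (fun ζ => ∑ n ∈ Finset.range (N + 1), ζ ^ n • s n) s := by
  unfold HasJet
  simpa using isBigO_zero _ _

/-- The Cauchy product. The two truncations multiply to a polynomial with the stated low
coefficients, and each error times a function bounded near `0` is again of order `N + 1`. -/
theorem HasJet.smul {φ : ℂ → ℂ} {c : ℕ → ℂ} (hφ : HasJet N φ c) (hf : HasJet N f s) :
    HasJet N (fun ζ => φ ζ • f ζ) (fun n => ∑ j ∈ Finset.range (n + 1), c j • s (n - j)) := by
  have h1 : HasJet N (fun ζ => (∑ j ∈ Finset.range (N + 1), ζ ^ j • c j) •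
      ∑ m ∈ Finset.range (N + 1), ζ ^ m • s m)
      (fun n => ∑ j ∈ Finset.range (n + 1), c j • s (n - j)) := by
    have h2 : HasJet N (fun ζ => ∑ j ∈ Finset.range (N + 1), ∑ m ∈ Finset.range (N + 1),
        ζ ^ (j + m) • c j • s m) (fun n => ∑ j ∈ Finset.range (N + 1),
        ∑ m ∈ Finset.range (N + 1), if n = j + m then c j • s m else 0) :=
      HasJet.sum fun j _ => HasJet.sum fun m _ => hasJet_pow_smul _ _
    refine (h2.congr fun n hn => ?_).congr_left (Eventually.of_forall fun ζ => ?_)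
    · have hsub : Finset.range (n + 1) ⊆ Finset.range (N + 1) := by
        intro j
        simp only [Finset.mem_range]
        omega
      rw [← Finset.sum_subset hsub]
      · refine Finset.sum_congr rfl fun j hj => ?_
        have hjn : j ≤ n := Nat.lt_succ_iff.1 (Finset.mem_range.1 hj)
        rw [Finset.sum_eq_single (n - j)]
        · rw [if_pos (by omega)]
        · intro m _ hm
          rw [if_neg (by omega)]
        · intro hm
          exact absurd (Finset.mem_range.2 (by omega)) hm
      · intro j _ hj
        rw [Finset.mem_range] at hj
        exact Finset.sum_eq_zero fun m _ => if_neg (by omega)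
    · dsimp only
      rw [Finset.sum_smul_sum]
      refine Finset.sum_congr rfl fun j _ => Finset.sum_congr rfl fun m _ => ?_
      rw [smul_smul, smul_smul, smul_eq_mul, pow_add]
      ring_nf
  have h3 : (fun ζ => φ ζ • (f ζ - ∑ m ∈ Finset.range (N + 1), ζ ^ m • s m)) =O[𝓝 0]
      fun ζ : ℂ => ‖ζ‖ ^ (N + 1) := by
    simpa using hφ.isBigO_one.smul hf
  have h4 : (fun ζ => (φ ζ - ∑ j ∈ Finset.range (N + 1), ζ ^ j • c j) •
      ∑ m ∈ Finset.range (N + 1), ζ ^ m • s m) =O[𝓝 0] fun ζ : ℂ => ‖ζ‖ ^ (N + 1) := by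
    simpa using IsBigO.smul hφ (hasJet_polynomial (N := N) s).isBigO_one
  refine ((h3.add h4).add h1).congr_left fun ζ => ?_
  simp only [smul_sub, sub_smul]
  abel

theorem HasJet.smul_const {φ : ℂ → ℂ} {c : ℕ → ℂ} (hφ : HasJet N φ c) (x : X) :
    HasJet N (fun ζ => φ ζ • x) (fun n => c n • x) := by
  have h := hφ.smul (hasJet_pow_smul 0 x)
  simp only [pow_zero, one_smul] at h
  refine h.congr fun n _ => ?_
  rw [Finset.sum_eq_single n]
  · simp
  · intro j hj hjn
    have := Finset.mem_range.1 hj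
    rw [if_neg (by omega), smul_zero]
  · simp

theorem HasJet.const_mul {φ : ℂ → ℂ} {c : ℕ → ℂ} (hφ : HasJet N φ c) (r : ℂ) :
    HasJet N (fun ζ => r * φ ζ) (fun n => r * c n) := by
  simpa only [smul_eq_mul, mul_comm r] using hφ.smul_const r

theorem HasJet.mul_const {φ : ℂ → ℂ} {c : ℕ → ℂ} (hφ : HasJet N φ c) (r : ℂ) :
    HasJet N (fun ζ => φ ζ * r) (fun n => c n * r) :=
  hφ.smul_const r

theorem hasJet_of_analyticAt {φ : ℂ → ℂ} (hφ : AnalyticAt ℂ φ 0) :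
    HasJet N φ (fun j => iteratedDeriv j φ 0 / (j.factorial : ℂ)) := by
  refine (hφ.hasFPowerSeriesAt.isBigO_sub_partialSum_pow (N + 1)).congr_left fun ζ => ?_
  simp [FormalMultilinearSeries.partialSum, FormalMultilinearSeries.ofScalars, mul_comm]

end Jet

/-! ## Generating functions -/

section GeneratingFunctions

/-- The operator `ζ d/dζ` multiplies `ζ^n` by `n` and preserves a remainder of the form `ζ^M h`. A
remainder holomorphic off `1` yields both the Taylor coefficients `n^l` and global
differentiability. -/
theorem exists_gammaFun_eq (l M : ℕ) : ∃ h : ℂ → ℂ, DifferentiableOn ℂ h {1}ᶜ ∧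
    ∀ ζ : ℂ, ζ ≠ 1 → gammaFun l ζ = ∑ n ∈ Finset.range M, (n : ℂ) ^ l * ζ ^ n + ζ ^ M * h ζ := by
  induction l with
  | zero =>
    refine ⟨fun ζ => 1 / (1 - ζ), ?_, fun ζ hζ => ?_⟩
    · intro ζ hζ
      have : 1 - ζ ≠ 0 := sub_ne_zero.2 (Ne.symm hζ)
      fun_prop (disch := assumption)
    · have h1 : 1 - ζ ≠ 0 := sub_ne_zero.2 hζ.symm
      have h2 : ζ - 1 ≠ 0 := sub_ne_zero.2 hζ
      simp only [pow_zero, one_mul, geom_sum_eq hζ]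
      change 1 / (1 - ζ) = _
      field_simp
      ring
  | succ l ih =>
    obtain ⟨h, hd, hh⟩ := ih
    have hopen : IsOpen ({1}ᶜ : Set ℂ) := isOpen_compl_singleton
    refine ⟨fun ζ => M * h ζ + ζ * deriv h ζ, ?_, fun ζ hζ => ?_⟩
    · exact (hd.const_mul _).add (differentiableOn_id.mul (hd.deriv hopen))
    · have hstep : gammaFun (l + 1) ζ = ζ * deriv (gammaFun l) ζ := by
        rw [gammaFun, Function.iterate_succ_apply']
        rfl
      have hev : gammaFun l =ᶠ[𝓝 ζ]
          fun ζ => ∑ n ∈ Finset.range M, (n : ℂ) ^ l * ζ ^ n + ζ ^ M * h ζ := by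
        filter_upwards [hopen.mem_nhds hζ] with ξ hξ using hh ξ hξ
      have hder : HasDerivAt (fun ζ => ∑ n ∈ Finset.range M, (n : ℂ) ^ l * ζ ^ n + ζ ^ M * h ζ)
          (∑ n ∈ Finset.range M, (n : ℂ) ^ l * (n * ζ ^ (n - 1)) +
            (M * ζ ^ (M - 1) * h ζ + ζ ^ M * deriv h ζ)) ζ := by
        refine (HasDerivAt.fun_sum fun n _ => (hasDerivAt_pow n ζ).const_mul _).add ?_
        exact (hasDerivAt_pow M ζ).mul (hd.hasDerivAt (hopen.mem_nhds hζ))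
      have hpow : ∀ n : ℕ, ζ * (n * ζ ^ (n - 1)) = n * ζ ^ n := by
        intro n
        rcases n with _ | n
        · simp
        · rw [Nat.add_sub_cancel, pow_succ]
          ring
      rw [hstep, hev.deriv_eq, hder.deriv, mul_add, Finset.mul_sum]
      have h1 : ∀ n : ℕ, ζ * ((n : ℂ) ^ l * (n * ζ ^ (n - 1))) = (n : ℂ) ^ (l + 1) * ζ ^ n := by
        intro n
        rw [mul_left_comm, hpow]
        ring
      simp only [h1]
      linear_combination h ζ * hpow M

theorem differentiableOn_gammaFun (l : ℕ) : DifferentiableOn ℂ (gammaFun l) {1}ᶜ := by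
  obtain ⟨h, hd, hh⟩ := exists_gammaFun_eq l 0
  exact hd.congr fun ζ hζ => by simpa using hh ζ hζ

theorem hasJet_gammaFun (N l : ℕ) : HasJet N (gammaFun l) (fun n => (n : ℂ) ^ l) := by
  obtain ⟨h, hd, hh⟩ := exists_gammaFun_eq l (N + 1)
  have hopen : IsOpen ({1}ᶜ : Set ℂ) := isOpen_compl_singleton
  have h0 : (0 : ℂ) ∈ ({1}ᶜ : Set ℂ) := by simp
  have h1 : h =O[𝓝 0] fun _ => (1 : ℝ) :=
    (hd.continuousOn.continuousAt (hopen.mem_nhds h0)).tendsto.isBigO_one ℝ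
  have h2 : (fun ζ : ℂ => ζ ^ (N + 1)) =O[𝓝 0] fun ζ : ℂ => ‖ζ‖ ^ (N + 1) :=
    (isBigO_refl _ _).norm_right.congr_right fun ζ => norm_pow _ _
  have h3 := h2.mul h1
  simp only [mul_one] at h3
  refine IsBigO.congr' h3 ?_ EventuallyEq.rfl
  filter_upwards [hopen.mem_nhds h0] with ζ hζ
  rw [hh ζ hζ]
  simp [mul_comm]

theorem hasJet_div_one_sub (N : ℕ) :
    HasJet N (fun ζ : ℂ => ζ / (1 - ζ)) (fun n => if n = 0 then 0 else 1) := by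
  have h := (hasJet_gammaFun N 0).sub (hasJet_pow_smul (N := N) 0 (1 : ℂ))
  refine (h.congr fun n _ => ?_).congr_left ?_
  · split_ifs <;> simp
  · filter_upwards [isOpen_compl_singleton.mem_nhds (show (0 : ℂ) ∈ ({1}ᶜ : Set ℂ) by simp)]
      with ζ hζ
    have h1 : 1 - ζ ≠ 0 := sub_ne_zero.2 (Ne.symm hζ)
    change 1 / (1 - ζ) - ζ ^ 0 • (1 : ℂ) = _
    rw [pow_zero, one_smul]
    field_simp
    ring

theorem hasJet_correction (N k : ℕ) (a : ℕ → ℂ) :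
    HasJet N (fun ζ : ℂ => ∑ j ∈ Finset.Ico 1 k, a j * ζ ^ j)
      (fun n => if n ∈ Finset.Ico 1 k then a n else 0) := by
  have h : HasJet N (fun ζ : ℂ => ∑ j ∈ Finset.Ico 1 k, ζ ^ j • a j)
      (fun n => ∑ j ∈ Finset.Ico 1 k, if n = j then a j else 0) :=
    HasJet.sum fun j _ => hasJet_pow_smul j (a j)
  refine (h.congr fun n _ => ?_).congr_left (Eventually.of_forall fun ζ => ?_)
  · rw [Finset.sum_ite_eq]
  · simp [mul_comm]

/-- Multiplicativity, which fails for general complex powers, holds here because a positive factor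
leaves the argument unchanged. -/
theorem div_ofReal_cpow {τ : ℝ} (hτ : 0 < τ) (u : ℂ) (s : ℝ) :
    (u / τ) ^ (s : ℂ) = ((τ ^ (-s) : ℝ) : ℂ) * u ^ (s : ℂ) := by
  rw [Complex.cpow_ofReal, Complex.cpow_ofReal, div_eq_inv_mul, ← Complex.ofReal_inv,
    Complex.arg_real_mul _ (inv_pos.2 hτ), norm_mul, Complex.norm_real,
    Real.norm_of_nonneg (inv_pos.2 hτ).le, Real.mul_rpow (inv_pos.2 hτ).le (norm_nonneg _),
    Real.inv_rpow hτ.le, ← Real.rpow_neg hτ.le]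
  push_cast
  ring

theorem bdf_zero_mem_slitPlane {k : ℕ} (hk : 1 ≤ k) : bdf k 0 ∈ Complex.slitPlane := by
  obtain ⟨h, h0, he⟩ := exists_bdf_zero_eq hk
  rw [he]
  exact Complex.ofReal_mem_slitPlane.2 h0

variable {X : Type*} [NormedAddCommGroup X] [InnerProductSpace ℂ X]

/-- Convolution quadrature is multiplication by a power of the generating polynomial. -/
theorem HasJet.bdfStep_cpow_smul {k N : ℕ} (hk : 1 ≤ k) {τ : ℝ} (hτ : 0 < τ) (s : ℝ) {f : ℂ → X}
    {φ : ℕ → X} (hf : HasJet N f φ) :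
    HasJet N (fun ζ => bdfStep k τ ζ ^ (s : ℂ) • f ζ) (cqDeriv k s τ φ) := by
  have han : AnalyticAt ℂ (fun ζ : ℂ => bdf k ζ ^ (s : ℂ)) 0 :=
    ((differentiable_bdf k).analyticAt 0).cpow analyticAt_const (bdf_zero_mem_slitPlane hk)
  have h1 := (hasJet_of_analyticAt (N := N) han).const_mul ((τ ^ (-s) : ℝ) : ℂ)
  refine ((h1.smul hf).congr fun n _ => ?_).congr_left (Eventually.of_forall fun ζ => ?_)
  · rw [cqDeriv, Finset.smul_sum]
    exact Finset.sum_congr rfl fun j _ => by rw [mul_smul]; rfl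
  · change _ = (bdf k ζ / (τ : ℂ)) ^ (s : ℂ) • f ζ
    rw [div_ofReal_cpow hτ]

theorem HasJet.bdfStep_smul {k N : ℕ} (hk : 1 ≤ k) {τ : ℝ} (hτ : 0 < τ) {f : ℂ → X}
    {φ : ℕ → X} (hf : HasJet N f φ) :
    HasJet N (fun ζ => bdfStep k τ ζ • f ζ) (cqDeriv k 1 τ φ) := by
  simpa using hf.bdfStep_cpow_smul hk hτ 1

end GeneratingFunctions

/-! ## The geometry of the contour -/

section ContourGeometry

variable {θ δ τ : ℝ}

theorem mem_contour_cases (hθ0 : 0 < θ) (hθπ : θ < Real.pi) (hτ : 0 < τ) (hδ : 0 < δ) {z : ℂ}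
    (hz : z ∈ contour θ δ τ) :
    (∃ φ ∈ Icc (-θ) θ, (δ : ℂ) * Complex.exp (Complex.I * φ) = z) ∨
      ∃ ρ ∈ Icc δ (Real.pi / (τ * Real.sin θ)), (ρ : ℂ) * Complex.exp (Complex.I * θ) = z ∨
        (ρ : ℂ) * Complex.exp (-(Complex.I * θ)) = z := by
  have hs : 0 < Real.sin θ := Real.sin_pos_of_pos_of_lt_pi hθ0 hθπ
  have hray : ∀ ρ φ : ℝ, δ ≤ ρ → |Real.sin φ| = Real.sin θ →
      |((ρ : ℂ) * Complex.exp ((φ : ℂ) * Complex.I)).im| ≤ Real.pi / τ →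
      ρ ≤ Real.pi / (τ * Real.sin θ) := by
    intro ρ φ hρ hφ h
    rw [Complex.im_ofReal_mul, Complex.exp_ofReal_mul_I_im, abs_mul, hφ,
      abs_of_nonneg (hδ.le.trans hρ), le_div_iff₀ hτ] at h
    rw [le_div_iff₀ (by positivity)]
    linarith
  obtain ⟨hz | ⟨ρ, hρ, rfl | rfl⟩, him⟩ := hz
  · refine Or.inl ⟨z.arg, abs_le.1 hz.2, ?_⟩
    rw [mul_comm Complex.I, ← hz.1, Complex.norm_mul_exp_arg_mul_I]
  · refine Or.inr ⟨ρ, ⟨hρ, hray ρ θ hρ (abs_of_pos hs) ?_⟩, Or.inl rfl⟩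
    rwa [mul_comm (θ : ℂ)]
  · refine Or.inr ⟨ρ, ⟨hρ, hray ρ (-θ) hρ ?_ ?_⟩, Or.inr rfl⟩
    · rw [Real.sin_neg, abs_neg, abs_of_pos hs]
    · push_cast
      rwa [neg_mul, mul_comm (θ : ℂ)]

theorem isCompact_contour (hθ0 : 0 < θ) (hθπ : θ < Real.pi) (hτ : 0 < τ) (hδ : 0 < δ)
    (hδτ : δ < Real.pi / τ) : IsCompact (contour θ δ τ) := by
  have heq : contour θ δ τ = (fun φ : ℝ => (δ : ℂ) * Complex.exp (Complex.I * φ)) '' uIcc (-θ) θ ∪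
      ((fun ρ : ℝ => (ρ : ℂ) * Complex.exp (Complex.I * θ)) ''
        uIcc δ (Real.pi / (τ * Real.sin θ)) ∪
      (fun ρ : ℝ => (ρ : ℂ) * Complex.exp (-(Complex.I * θ))) ''
        uIcc δ (Real.pi / (τ * Real.sin θ))) := by
    ext z
    constructor
    · intro hz
      rcases mem_contour_cases hθ0 hθπ hτ hδ hz with ⟨φ, hφ, h⟩ | ⟨ρ, hρ, h | h⟩
      · exact Or.inl ⟨φ, Icc_subset_uIcc hφ, h⟩
      · exact Or.inr (Or.inl ⟨ρ, Icc_subset_uIcc hρ, h⟩)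
      · exact Or.inr (Or.inr ⟨ρ, Icc_subset_uIcc hρ, h⟩)
    · rintro (⟨φ, hφ, rfl⟩ | ⟨ρ, hρ, rfl⟩ | ⟨ρ, hρ, rfl⟩)
      · exact arc_mem_contour hθ0 hθπ hδ hδτ hφ
      · exact (ray_mem_contour hθ0 hθπ hτ hδ hδτ hρ).1
      · exact (ray_mem_contour hθ0 hθπ hτ hδ hδτ hρ).2
  rw [heq]
  exact (isCompact_uIcc.image (by fun_prop)).union
    ((isCompact_uIcc.image (by fun_prop)).union (isCompact_uIcc.image (by fun_prop)))

theorem contourEnd_mem_contour (hθ0 : 0 < θ) (hθπ : θ < Real.pi) (hτ : 0 < τ) (hδ : 0 < δ)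
    (hδτ : δ < Real.pi / τ) : contourEnd θ τ ∈ contour θ δ τ :=
  (ray_mem_contour hθ0 hθπ hτ hδ hδτ right_mem_uIcc).2

/-- The lower end is a leftmost point, so `|e^{-zτ}|` is largest there. Absolute convergence of the
generating function at this one point then dominates the series on the whole contour. -/
theorem contourEnd_re_le (hθ : Real.pi / 2 < θ) (hθπ : θ < Real.pi) (hτ : 0 < τ) (hδ : 0 < δ)
    (hδτ : δ < Real.pi / τ) {z : ℂ} (hz : z ∈ contour θ δ τ) : (contourEnd θ τ).re ≤ z.re := by
  have hπ := Real.pi_pos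
  have hs : 0 < Real.sin θ := Real.sin_pos_of_pos_of_lt_pi (by linarith) hθπ
  have hc : Real.cos θ < 0 := Real.cos_neg_of_pi_div_two_lt_of_lt hθ (by linarith)
  have hre : ∀ ρ φ : ℝ, ((ρ : ℂ) * Complex.exp (Complex.I * φ)).re = ρ * Real.cos φ := by
    intro ρ φ
    rw [mul_comm Complex.I, Complex.re_ofReal_mul, Complex.exp_ofReal_mul_I_re]
  have hre' : ∀ ρ : ℝ, ((ρ : ℂ) * Complex.exp (-(Complex.I * θ))).re = ρ * Real.cos θ := by
    intro ρ
    rw [← mul_neg, ← Complex.ofReal_neg, hre, Real.cos_neg]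
  have hle : δ ≤ Real.pi / (τ * Real.sin θ) := by
    refine hδτ.le.trans (div_le_div_of_nonneg_left hπ.le (by positivity) ?_)
    exact mul_le_of_le_one_right hτ.le (Real.sin_le_one θ)
  rw [contourEnd, hre']
  rcases mem_contour_cases (by linarith) hθπ hτ hδ hz with ⟨φ, hφ, rfl⟩ | ⟨ρ, hρ, rfl | rfl⟩
  · rw [hre]
    have h1 : Real.cos θ ≤ Real.cos φ := by
      rw [← Real.cos_abs φ]
      exact Real.cos_le_cos_of_nonneg_of_le_pi (abs_nonneg _) hθπ.le (abs_le.2 hφ)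
    nlinarith
  · rw [hre]
    exact mul_le_mul_of_nonpos_right hρ.2 hc.le
  · rw [hre']
    exact mul_le_mul_of_nonpos_right hρ.2 hc.le

end ContourGeometry

/-! ## Inversion of the discrete convolution equation -/

section Inversion

variable {X : Type*} [NormedAddCommGroup X] [InnerProductSpace ℂ X]

/-- The points at which the symbol `δ_τ(ζ)^α` is holomorphic and lies in the resolvent set. -/
def regularSet (k : ℕ) (α τ : ℝ) (A : X →ₗ.[ℂ] X) : Set ℂ :=
  {ζ | bdfStep k τ ζ ∈ Complex.slitPlane ∧ InResolventSet A (bdfStep k τ ζ ^ (α : ℂ))}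

/-- `τ e^{z t_n} (δ_τ(e^{-zτ})^α - A)⁻¹ Φ(e^{-zτ})`. -/
noncomputable def cqIntegrand (k : ℕ) (α τ : ℝ) (A : X →ₗ.[ℂ] X) (n : ℕ) (Φ : ℂ → X) (z : ℂ) : X :=
  (τ * Complex.exp (z * (n * τ)) : ℂ) •
    resolventOp A (bdfStep k τ (Complex.exp (-z * τ)) ^ (α : ℂ)) (Φ (Complex.exp (-z * τ)))

variable {k : ℕ} {α τ : ℝ} {A : X →ₗ.[ℂ] X}

theorem differentiable_bdfStep : Differentiable ℂ (bdfStep k τ) :=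
  (differentiable_bdf k).div_const _

theorem bdfStep_ne_zero {ζ : ℂ} (hζ : ζ ∈ regularSet k α τ A) : bdfStep k τ ζ ≠ 0 :=
  Complex.slitPlane_ne_zero hζ.1

theorem ne_one_of_mem_regularSet {ζ : ℂ} (hζ : ζ ∈ regularSet k α τ A) : ζ ≠ 1 := by
  rintro rfl
  exact bdfStep_ne_zero hζ (by rw [bdfStep, bdf_one, zero_div])

theorem exp_neg_mul_pow (z : ℂ) (τ : ℝ) (j : ℕ) :
    Complex.exp (-z * τ) ^ j = Complex.exp (-z * (j * τ)) := by
  rw [← Complex.exp_nat_mul]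
  ring_nf

theorem exp_mul_exp_pow (z : ℂ) (τ : ℝ) (n m : ℕ) :
    Complex.exp (z * (n * τ)) * Complex.exp (-z * τ) ^ m =
      Complex.exp (z * (((n - m : ℤ) : ℂ) * τ)) := by
  rw [exp_neg_mul_pow, ← Complex.exp_add]
  push_cast
  ring_nf

theorem cqIntegrand_add (n : ℕ) (Φ Ψ : ℂ → X) (z : ℂ) :
    cqIntegrand k α τ A n (fun ζ => Φ ζ + Ψ ζ) z =
      cqIntegrand k α τ A n Φ z + cqIntegrand k α τ A n Ψ z := by
  simp only [cqIntegrand, map_add, smul_add]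

variable [CompleteSpace X]

theorem differentiableAt_resolventOp_bdfStep {ζ : ℂ} (hζ : ζ ∈ regularSet k α τ A) :
    DifferentiableAt ℂ (fun ζ => resolventOp A (bdfStep k τ ζ ^ (α : ℂ))) ζ :=
  hζ.2.differentiableAt.comp ζ (f := fun ζ => bdfStep k τ ζ ^ (α : ℂ))
    ((differentiable_bdfStep ζ).cpow_const hζ.1)

theorem differentiableOn_cqIntegrand {s : Set ℂ}
    (hs : ∀ z ∈ s, Complex.exp (-z * τ) ∈ regularSet k α τ A) {Φ : ℂ → X}
    (hΦ : ∀ ζ ∈ regularSet k α τ A, DifferentiableAt ℂ Φ ζ) (n : ℕ) :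
    DifferentiableOn ℂ (cqIntegrand k α τ A n Φ) s := by
  intro z hz
  have hexp : DifferentiableAt ℂ (fun z : ℂ => Complex.exp (-z * τ)) z := by fun_prop
  have h1 := (differentiableAt_resolventOp_bdfStep (hs z hz)).comp z hexp
  have h2 := (hΦ _ (hs z hz)).comp z hexp
  have h3 : DifferentiableAt ℂ (fun z : ℂ => (τ * Complex.exp (z * (n * τ)) : ℂ)) z := by fun_prop
  exact (h3.smul (h1.clm_apply h2)).differentiableWithinAt

section

variable {ε θ δ : ℝ} (hε : 0 < ε) (hθ : Real.pi / 2 < θ) (hθπ : θ < Real.pi)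
  (hθε : -ε * Real.sin θ < Real.cos θ) (hτ : 0 < τ) (hδ : 0 < δ) (hδτ : δ < Real.pi / τ)
  (h0 : (0 : ℂ) ∈ regularSet k α τ A)
  (hD : ∀ z ∈ cutStrip ε (4 / τ), Complex.exp (-z * τ) ∈ regularSet k α τ A)

include hε hθ hθπ hθε hτ hδ hδτ h0 hD

/-- With `ζ = e^{-zτ}` the factor `e^{z t_n}` is `ζ^{-n}`. Since the resolvent is bounded near `ζ =
0`, the integrand is `O(ζ)`; it is also periodic, and Cauchy's theorem for decaying periodic
functions applies. -/
theorem contourIntegral_cqIntegrand_eq_zero {Φ : ℂ → X}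
    (hΦ : ∀ ζ ∈ regularSet k α τ A, DifferentiableAt ℂ Φ ζ) {n : ℕ}
    (hO : Φ =O[𝓝 0] fun ζ : ℂ => ‖ζ‖ ^ (n + 1)) :
    contourIntegral θ δ τ (cqIntegrand k α τ A n Φ) = 0 := by
  have hτ' : (τ : ℂ) ≠ 0 := by exact_mod_cast hτ.ne'
  refine contourIntegral_eq_zero hε hθ hθπ hθε hτ hδ hδτ
    (differentiableOn_cqIntegrand hD hΦ n) (fun z => ?_) fun κ hκ => ?_
  · have h1 : Complex.exp (-(z + 2 * Real.pi * Complex.I / τ) * τ) = Complex.exp (-z * τ) := by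
      rw [show -(z + 2 * Real.pi * Complex.I / τ) * τ = -z * τ - 2 * Real.pi * Complex.I by
        field_simp; ring, Complex.exp_sub, Complex.exp_two_pi_mul_I, div_one]
    have h2 : Complex.exp ((z + 2 * Real.pi * Complex.I / τ) * (n * τ)) =
        Complex.exp (z * (n * τ)) := by
      rw [show (z + 2 * Real.pi * Complex.I / τ) * (n * τ) =
        z * (n * τ) + n * (2 * Real.pi * Complex.I) by field_simp, Complex.exp_add,
        Complex.exp_nat_mul_two_pi_mul_I, mul_one]
    rw [cqIntegrand, h1, h2, cqIntegrand]
  · have hR : (fun ζ => resolventOp A (bdfStep k τ ζ ^ (α : ℂ))) =O[𝓝 0] fun _ => (1 : ℝ) :=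
      (differentiableAt_resolventOp_bdfStep h0).continuousAt.tendsto.isBigO_one ℝ
    obtain ⟨C₁, hC₁⟩ := hR.bound
    obtain ⟨C₂, hC₂⟩ := hO.bound
    have hlim : Tendsto (fun x : ℝ => Real.exp (-(τ * x))) atTop (𝓝 0) :=
      Real.tendsto_exp_neg_atTop_nhds_zero.comp (tendsto_id.const_mul_atTop hτ)
    obtain ⟨r, hr, hball⟩ := Metric.eventually_nhds_iff_ball.1 (hC₁.and hC₂)
    have hsmall : ∀ᶠ x : ℝ in atTop,
        Real.exp (-(τ * x)) < min r (κ / (τ * (|C₁| * |C₂|) + 1)) :=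
      hlim.eventually_lt_const (lt_min hr (by positivity))
    obtain ⟨x₀, hx₀⟩ := eventually_atTop.1 hsmall
    refine ⟨x₀, fun z hz => ?_⟩
    have hn : ‖Complex.exp (-z * τ)‖ = Real.exp (-(τ * z.re)) := by
      rw [Complex.norm_exp]
      simp [mul_comm]
    have hlt := hx₀ z.re hz
    rw [← hn] at hlt
    set ζ := Complex.exp (-z * τ) with hζ
    obtain ⟨hb₁, hb₂⟩ := hball ζ (by simpa using hlt.trans_le (min_le_left _ _))
    have hb₁' : ‖resolventOp A (bdfStep k τ ζ ^ (α : ℂ))‖ ≤ |C₁| := by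
      simpa using hb₁.trans (mul_le_mul_of_nonneg_right (le_abs_self C₁) (norm_nonneg _))
    have hb₂' : ‖Φ ζ‖ ≤ |C₂| * ‖ζ‖ ^ (n + 1) := by
      refine hb₂.trans ?_
      rw [norm_pow, norm_norm]
      exact mul_le_mul_of_nonneg_right (le_abs_self C₂) (by positivity)
    have hone : ‖Complex.exp (z * (n * τ))‖ * ‖ζ‖ ^ n = 1 := by
      rw [← norm_pow, ← norm_mul, hζ, exp_mul_exp_pow]
      simp
    have hlt' := (hlt.trans_le (min_le_right _ _)).le
    rw [le_div_iff₀ (by positivity)] at hlt'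
    calc ‖cqIntegrand k α τ A n Φ z‖
        = τ * ‖Complex.exp (z * (n * τ))‖ *
            ‖resolventOp A (bdfStep k τ ζ ^ (α : ℂ)) (Φ ζ)‖ := by
          rw [cqIntegrand, norm_smul, norm_mul, Complex.norm_real, Real.norm_of_nonneg hτ.le]
      _ ≤ τ * ‖Complex.exp (z * (n * τ))‖ * (|C₁| * (|C₂| * ‖ζ‖ ^ (n + 1))) := by
          gcongr
          exact (ContinuousLinearMap.le_opNorm _ _).trans (by gcongr)
      _ = τ * (|C₁| * |C₂|) * ‖ζ‖ * (‖Complex.exp (z * (n * τ))‖ * ‖ζ‖ ^ n) := by ring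
      _ ≤ κ := by
          rw [hone]
          linarith [norm_nonneg ζ]

/-- The solution of a discrete convolution equation is the contour integral of the resolvent applied
to the generating function of the right-hand side. -/
theorem contourIntegral_cqIntegrand (hk : 1 ≤ k) {Φ : ℂ → X}
    (hΦ : ∀ ζ ∈ regularSet k α τ A, DifferentiableAt ℂ Φ ζ) {N : ℕ} {W : ℕ → A.domain}
    (hjet : HasJet N Φ fun n => cqDeriv k α τ (fun m => (W m : X)) n - A (W n)) {n : ℕ}
    (hn : n ≤ N) :
    contourIntegral θ δ τ (cqIntegrand k α τ A n Φ) = (2 * Real.pi * Complex.I : ℂ) • (W n : X) := by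
  have hτ' : (τ : ℂ) ≠ 0 := by exact_mod_cast hτ.ne'
  have hθ0 : 0 < θ := by linarith [Real.pi_pos]
  have hsub := contour_subset_cutStrip hε hθ hθπ hθε hτ hδ
  set Wt : ℂ → X := fun ζ => ∑ m ∈ Finset.range (N + 1), ζ ^ m • (W m : X) with hWt
  -- The defect of the polynomial truncation in the transformed equation. It is of order `N + 1`
  -- precisely because the scheme holds up to index `N`; nothing beyond `N` is used.
  set E : ℂ → X := fun ζ => bdfStep k τ ζ ^ (α : ℂ) • Wt ζ -
    ∑ m ∈ Finset.range (N + 1), ζ ^ m • A (W m) - Φ ζ with hE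
  have hEd : ∀ ζ ∈ regularSet k α τ A, DifferentiableAt ℂ E ζ := by
    intro ζ hζ
    have h1 : DifferentiableAt ℂ (fun ζ => bdfStep k τ ζ ^ (α : ℂ)) ζ :=
      (differentiable_bdfStep ζ).cpow_const hζ.1
    have h2 : DifferentiableAt ℂ Wt ζ := by fun_prop
    have h3 : DifferentiableAt ℂ (fun ζ : ℂ => ∑ m ∈ Finset.range (N + 1), ζ ^ m • A (W m)) ζ := by
      fun_prop
    exact ((h1.smul h2).sub h3).sub (hΦ ζ hζ)
  have hEO : E =O[𝓝 0] fun ζ : ℂ => ‖ζ‖ ^ (N + 1) := by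
    have h1 := (((hasJet_polynomial (N := N) (fun m => (W m : X))).bdfStep_cpow_smul hk hτ α).sub
      (hasJet_polynomial (N := N) fun m => A (W m))).sub hjet
    refine IsBigO.congr_left h1 fun ζ => ?_
    simp [hE, hWt]
  have hEO' : E =O[𝓝 0] fun ζ : ℂ => ‖ζ‖ ^ (n + 1) := by
    refine hEO.trans (IsBigO.of_bound 1 ?_)
    filter_upwards [Metric.closedBall_mem_nhds (0 : ℂ) one_pos] with ζ hζ
    rw [one_mul, norm_pow, norm_norm, norm_pow, norm_norm]
    exact pow_le_pow_of_le_one (norm_nonneg _) (by simpa using hζ) (by omega)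
  -- Applying the resolvent to the definition of `E` expresses the resolvent of `Φ` as the
  -- polynomial minus the resolvent of `E`. Only the coefficient with `m = n` survives integration.
  have hsplit : EqOn (cqIntegrand k α τ A n Φ) (fun z =>
      ∑ m ∈ Finset.range (N + 1), (Complex.exp (z * (((n - m : ℤ) : ℂ) * τ)) • (τ : ℂ) • (W m : X)) -
        cqIntegrand k α τ A n E z) (contour θ δ τ) := by
    intro z hz
    have hres := (hD z (hsub hz)).2.isResolvent
    simp only [cqIntegrand]
    set ζ := Complex.exp (-z * τ) with hζ
    have hEζ : E ζ = ∑ m ∈ Finset.range (N + 1), ζ ^ m •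
        (bdfStep k τ ζ ^ (α : ℂ) • (W m : X) - A (W m)) - Φ ζ := by
      simp only [hE, hWt, Finset.smul_sum, smul_sub, Finset.sum_sub_distrib, smul_comm (ζ ^ _)]
    have hsum : (τ * Complex.exp (z * (n * τ)) : ℂ) •
        ∑ m ∈ Finset.range (N + 1), ζ ^ m • (W m : X) = ∑ m ∈ Finset.range (N + 1),
          Complex.exp (z * (((n - m : ℤ) : ℂ) * τ)) • (τ : ℂ) • (W m : X) := by
      rw [Finset.smul_sum]
      refine Finset.sum_congr rfl fun m _ => ?_
      rw [← exp_mul_exp_pow, ← hζ, smul_smul, smul_smul]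
      ring_nf
    rw [hEζ, map_sub, map_sum]
    simp only [map_smul, hres.left]
    rw [smul_sub, hsum, sub_sub_cancel]
  have hcont : ∀ m ∈ Finset.range (N + 1), ContinuousOn (fun z : ℂ =>
      Complex.exp (z * (((n - m : ℤ) : ℂ) * τ)) • (τ : ℂ) • (W m : X)) (contour θ δ τ) := by
    intro m _
    fun_prop
  rw [contourIntegral_congr hθ0 hθπ hτ hδ hδτ hsplit, contourIntegral_sub
    (contourIntegrable_of_continuousOn hθ0 hθπ hτ hδ hδτ (continuousOn_finsetSum _ hcont))
    (contourIntegrable_of_continuousOn hθ0 hθπ hτ hδ hδτ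
      ((differentiableOn_cqIntegrand hD hEd n).continuousOn.mono hsub)),
    contourIntegral_cqIntegrand_eq_zero hε hθ hθπ hθε hτ hδ hδτ h0 hD hEd hEO', sub_zero,
    contourIntegral_sum hθ0 hθπ hτ hδ hδτ hcont, Finset.sum_eq_single n]
  · rw [contourIntegral_exp_smul hθ0 hθπ hτ hδ hδτ, if_pos (by omega), smul_smul,
      div_mul_cancel₀ _ hτ']
  · intro m _ hm
    rw [contourIntegral_exp_smul hθ0 hθπ hτ hδ hδτ, if_neg (by omega)]
  · intro h
    exact absurd (Finset.mem_range.2 (by omega)) h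

end

end Inversion

/-! ## The four integrands -/

section Integrands

variable {X : Type*} [NormedAddCommGroup X] [InnerProductSpace ℂ X]
  {k : ℕ} {α τ : ℝ} {A : X →ₗ.[ℂ] X}

/-- The generating function of the part of the right-hand side that stems from `v`. -/
noncomputable def dataV (k : ℕ) (a : ℕ → ℂ) (x : X) (ζ : ℂ) : X :=
  (ζ / (1 - ζ) + ∑ j ∈ Finset.Ico 1 k, a j * ζ ^ j) • x

/-- The generating function of the part of the right-hand side that stems from `b`. -/
noncomputable def dataB (k : ℕ) (τ : ℝ) (c : ℕ → ℂ) (x : X) (ζ : ℂ) : X :=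
  ((τ : ℂ) * (gammaFun 1 ζ + ∑ j ∈ Finset.Ico 1 k, c j * ζ ^ j)) • x

/-- The generating function of the part of the right-hand side that stems from the derivatives of
the source term. -/
noncomputable def dataF (k : ℕ) (τ : ℝ) (β : ℕ → ℕ → ℂ) (F : ℕ → X) (ζ : ℂ) : X :=
  bdfStep k τ ζ • ∑ l ∈ Finset.Ico 1 (k - 1),
      (gammaFun l ζ * ((τ : ℂ) ^ l / (l.factorial : ℂ))) • F l +
    ∑ l ∈ Finset.Ico 1 (k - 1),
      ((∑ j ∈ Finset.Ico 1 k, β l j * ζ ^ j) * (τ : ℂ) ^ (l - 1)) • F l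

/-- The generating function of the part of the right-hand side that stems from the first `M`
values of the remainder. -/
noncomputable def dataR (k : ℕ) (τ : ℝ) (R : ℕ → X) (M : ℕ) (ζ : ℂ) : X :=
  bdfStep k τ ζ • ∑ m ∈ Finset.range M, ζ ^ (m + 1) • R (m + 1)

theorem bdf_eq_mul_bdfStep (hτ : τ ≠ 0) (ζ : ℂ) : bdf k ζ = τ * bdfStep k τ ζ := by
  have : (τ : ℂ) ≠ 0 := by exact_mod_cast hτ
  rw [bdfStep]
  field_simp

variable {z : ℂ}

/-- In `μ K` the factor `δ = τ δ_τ` of `μ` cancels the `δ_τ⁻¹` of the kernel, which leaves the `τ`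
of `cqIntegrand`. -/
theorem integrandV_eq (hτ : τ ≠ 0) (hz : bdfStep k τ (Complex.exp (-z * τ)) ≠ 0) (a : ℕ → ℂ)
    (n : ℕ) (x : X) :
    integrandV k α τ A a n x z = cqIntegrand k α τ A n (dataV k a x) z := by
  simp only [integrandV, cqIntegrand, kernelK, dataV, muFun, smul_apply, map_smul,
    smul_smul, bdf_eq_mul_bdfStep hτ]
  congr 1
  generalize bdfStep k τ (Complex.exp (-z * τ)) = s at hz ⊢
  field_simp

theorem integrandB_eq (hz : bdfStep k τ (Complex.exp (-z * τ)) ≠ 0)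
    (c : ℕ → ℂ) (n : ℕ) (x : X) :
    integrandB k α τ A c n x z = cqIntegrand k α τ A n (dataB k τ c x) z := by
  simp only [integrandB, cqIntegrand, kernelK, dataB, smul_apply, map_smul,
    smul_smul, exp_neg_mul_pow]
  congr 1
  generalize bdfStep k τ (Complex.exp (-z * τ)) = s at hz ⊢
  field_simp

theorem integrandF_eq (hτ : τ ≠ 0) (hz : bdfStep k τ (Complex.exp (-z * τ)) ≠ 0)
    (β : ℕ → ℕ → ℂ) (n : ℕ) (F : ℕ → X) :
    integrandF k α τ A β n F z = cqIntegrand k α τ A n (dataF k τ β F) z := by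
  have hdata : ∑ l ∈ Finset.Ico 1 (k - 1),
      ((bdf k (Complex.exp (-z * τ)) * (gammaFun l (Complex.exp (-z * τ)) / (l.factorial : ℂ)) +
        ∑ j ∈ Finset.Ico 1 k, β l j * Complex.exp (-z * (j * τ))) * (τ : ℂ) ^ l) • F l =
      (τ : ℂ) • dataF k τ β F (Complex.exp (-z * τ)) := by
    simp only [dataF, Finset.smul_sum, smul_add, ← Finset.sum_add_distrib]
    refine Finset.sum_congr rfl fun l hl => ?_
    have hl1 : (τ : ℂ) ^ l = τ * (τ : ℂ) ^ (l - 1) := by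
      rw [← pow_succ', Nat.sub_add_cancel (Finset.mem_Ico.1 hl).1]
    rw [smul_smul, smul_smul, smul_smul, ← add_smul]
    congr 1
    simp only [exp_neg_mul_pow]
    rw [bdf_eq_mul_bdfStep hτ, add_mul]
    congr 1
    · ring
    · rw [hl1]
      ring
  simp only [integrandF, cqIntegrand, kernelK, hdata, smul_apply, map_smul, smul_smul]
  congr 1
  generalize bdfStep k τ (Complex.exp (-z * τ)) = s at hz ⊢
  field_simp

/-- Here `δ_τ² δ_τ⁻¹ = δ_τ` also holds when `δ_τ = 0`, so no nonvanishing is required. -/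
theorem integrandR_eq (n : ℕ) (R : ℕ → X) : integrandR k α τ A n R z =
      cqIntegrand k α τ A n (fun ζ => bdfStep k τ ζ • genFun R ζ) z := by
  simp only [integrandR, cqIntegrand, kernelK, smul_apply, map_smul, smul_smul]
  congr 1
  field_simp

section Regular

variable {ζ : ℂ}

theorem differentiableAt_gammaFun (hζ : ζ ≠ 1) (l : ℕ) : DifferentiableAt ℂ (gammaFun l) ζ :=
  (differentiableOn_gammaFun l).differentiableAt (isOpen_compl_singleton.mem_nhds hζ)

theorem differentiableAt_dataV (hζ : ζ ≠ 1) (a : ℕ → ℂ) (x : X) :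
    DifferentiableAt ℂ (dataV k a x) ζ := by
  have : 1 - ζ ≠ 0 := sub_ne_zero.2 hζ.symm
  unfold dataV
  fun_prop (disch := assumption)

theorem differentiableAt_dataB (hζ : ζ ≠ 1) (c : ℕ → ℂ) (x : X) :
    DifferentiableAt ℂ (dataB k τ c x) ζ := by
  have := differentiableAt_gammaFun hζ 1
  unfold dataB
  fun_prop

theorem differentiableAt_dataF (hζ : ζ ≠ 1) (β : ℕ → ℕ → ℂ) (F : ℕ → X) :
    DifferentiableAt ℂ (dataF k τ β F) ζ := by
  have h1 := differentiable_bdfStep (k := k) (τ := τ) ζ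
  have h2 : DifferentiableAt ℂ (fun ζ => ∑ l ∈ Finset.Ico 1 (k - 1),
      (gammaFun l ζ * ((τ : ℂ) ^ l / (l.factorial : ℂ))) • F l) ζ :=
    DifferentiableAt.fun_sum fun l _ =>
      ((differentiableAt_gammaFun hζ l).mul_const _).smul_const (F l)
  have h3 : DifferentiableAt ℂ (fun ζ => ∑ l ∈ Finset.Ico 1 (k - 1),
      ((∑ j ∈ Finset.Ico 1 k, β l j * ζ ^ j) * (τ : ℂ) ^ (l - 1)) • F l) ζ := by fun_prop
  exact (h1.smul h2).add h3

theorem differentiable_dataR (R : ℕ → X) (M : ℕ) : Differentiable ℂ (dataR k τ R M) := by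
  have := differentiable_bdfStep (k := k) (τ := τ)
  unfold dataR
  fun_prop

end Regular

/-- The Taylor coefficients of the data are the right-hand sides of the scheme. -/
theorem hasJet_data (hk : 1 ≤ k) (hτ : 0 < τ) {N M : ℕ} (hNM : N ≤ M) (a c : ℕ → ℂ)
    (β : ℕ → ℕ → ℂ) (x y : X) {f : ℝ → X} {R : ℕ → X}
    (hR : ∀ n ≤ N, R n = taylorRemainder k (N * τ) f (n * τ)) :
    HasJet N (fun ζ => dataV k a x ζ + dataB k τ c y ζ +
        dataF k τ β (fun l => derivAtZero (N * τ) f (l - 1)) ζ + dataR k τ R M ζ)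
      (fun n => (if n = 0 then 0 else x + ((n * τ : ℝ) : ℂ) • y) +
        (if 1 ≤ n ∧ n ≤ k - 1 then a n • x + (c n * (τ : ℂ)) • y +
          ∑ l ∈ Finset.Ico 1 (k - 1), (β l n * (τ : ℂ) ^ (l - 1)) • derivAtZero (N * τ) f (l - 1)
        else 0) + cqDeriv k 1 τ (fun m => primitive f (m * τ)) n) := by
  have hV : HasJet N (dataV k a x) _ :=
    ((hasJet_div_one_sub N).add (hasJet_correction N k a)).smul_const x
  have hB : HasJet N (dataB k τ c y) _ :=
    (((hasJet_gammaFun N 1).add (hasJet_correction N k c)).const_mul (τ : ℂ)).smul_const y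
  have hβ : HasJet N (fun ζ => ∑ l ∈ Finset.Ico 1 (k - 1),
      ((∑ j ∈ Finset.Ico 1 k, β l j * ζ ^ j) * (τ : ℂ) ^ (l - 1)) •
        derivAtZero (N * τ) f (l - 1)) _ :=
    HasJet.sum fun l _ => ((hasJet_correction N k (β l)).mul_const _).smul_const _
  have hγ : HasJet N (fun ζ => ∑ l ∈ Finset.Ico 1 (k - 1),
      (gammaFun l ζ * ((τ : ℂ) ^ l / (l.factorial : ℂ))) • derivAtZero (N * τ) f (l - 1)) _ :=
    HasJet.sum fun l _ => ((hasJet_gammaFun N l).mul_const _).smul_const _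
  have hRj : HasJet N (fun ζ => ∑ m ∈ Finset.range M, ζ ^ (m + 1) • R (m + 1))
      (fun n => if n = 0 then 0 else R n) := by
    have h : HasJet N (fun ζ => ∑ m ∈ Finset.range M, ζ ^ (m + 1) • R (m + 1)) _ :=
      HasJet.sum fun m _ => hasJet_pow_smul (m + 1) (R (m + 1))
    refine h.congr fun n hn => ?_
    rcases n with _ | n
    · simp
    · simp only [Nat.add_right_cancel_iff, Finset.sum_ite_eq, Finset.mem_range]
      rw [if_pos (by omega), if_neg (by omega)]
  -- The Taylor part of `g` and the remainder recombine to `g(t_n)`: the coefficients of `τ^l γ_l /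
  -- l!` are `t_n^l / l!`. At `n = 0` both sides vanish, since `l ≥ 1` and `g(0) = 0`.
  have hg : HasJet N (fun ζ => (∑ l ∈ Finset.Ico 1 (k - 1),
      (gammaFun l ζ * ((τ : ℂ) ^ l / (l.factorial : ℂ))) • derivAtZero (N * τ) f (l - 1)) +
      ∑ m ∈ Finset.range M, ζ ^ (m + 1) • R (m + 1)) (fun m => primitive f (m * τ)) := by
    refine (hγ.add hRj).congr fun n hn => ?_
    rcases eq_or_ne n 0 with rfl | hn0
    · simp only [if_true, add_zero, Nat.cast_zero, zero_mul, primitive,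
        intervalIntegral.integral_same]
      refine Finset.sum_eq_zero fun l hl => ?_
      have : l ≠ 0 := by have := (Finset.mem_Ico.1 hl).1; omega
      simp [this]
    · rw [if_neg hn0, hR n hn, taylorRemainder]
      have : ∀ l, (n : ℂ) ^ l * ((τ : ℂ) ^ l / (l.factorial : ℂ)) =
          ((n * τ : ℝ) : ℂ) ^ l / (l.factorial : ℂ) := by
        intro l
        push_cast
        rw [mul_pow, mul_div_assoc]
      simp only [this]
      abel
  have hall := ((hV.add hB).add hβ).add (hg.bdfStep_smul hk hτ)
  refine (hall.congr fun n hn => ?_).congr_left (Eventually.of_forall fun ζ => ?_)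
  · have hmem : n ∈ Finset.Ico 1 k ↔ 1 ≤ n ∧ n ≤ k - 1 := by
      rw [Finset.mem_Ico]
      omega
    simp only [hmem]
    congr 1
    rcases eq_or_ne n 0 with rfl | hn0
    · simp
    · simp only [if_neg hn0]
      split_ifs
      · push_cast
        module
      · simp only [zero_mul, zero_smul, Finset.sum_const_zero]
        push_cast
        module
  · simp only [dataF, dataR, smul_add]
    abel

variable [CompleteSpace X]

/-- The representation of the solution of the corrected scheme, for an operator whose resolvent set
contains the symbol. -/
theorem representation {ε θ δ : ℝ} (hε : 0 < ε) (hθ : Real.pi / 2 < θ) (hθπ : θ < Real.pi)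
    (hθε : -ε * Real.sin θ < Real.cos θ) (hτ : 0 < τ) (hδ : 0 < δ) (hδτ : δ < Real.pi / τ)
    (hk : 1 ≤ k) (h0 : (0 : ℂ) ∈ regularSet k α τ A)
    (hD : ∀ z ∈ cutStrip ε (4 / τ), Complex.exp (-z * τ) ∈ regularSet k α τ A)
    {N : ℕ} {a c : ℕ → ℂ} {β : ℕ → ℕ → ℂ} {v b : A.domain} {f : ℝ → X} {U : ℕ → A.domain}
    (hU : IsDiscreteSolution k α τ N A a c β v b f U) {R : ℕ → X}
    (hR : ∀ n ≤ N, R n = taylorRemainder k (N * τ) f (n * τ))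
    (hsum : ∀ z ∈ contour θ δ τ, Summable fun n : ℕ => ‖Complex.exp (-z * τ) ^ n • R n‖)
    {n : ℕ} (hn : n ≤ N) :
    ContourIntegrable θ δ τ (integrandV k α τ A a n (A v)) ∧
    ContourIntegrable θ δ τ (integrandB k α τ A c n (A b)) ∧
    ContourIntegrable θ δ τ
      (integrandF k α τ A β n (fun l => derivAtZero (N * τ) f (l - 1))) ∧
    ContourIntegrable θ δ τ (integrandR k α τ A n R) ∧
    contourIntegral θ δ τ (integrandV k α τ A a n (A v)) +
      contourIntegral θ δ τ (integrandB k α τ A c n (A b)) +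
      contourIntegral θ δ τ
        (integrandF k α τ A β n (fun l => derivAtZero (N * τ) f (l - 1))) +
      contourIntegral θ δ τ (integrandR k α τ A n R) =
        (2 * Real.pi * Complex.I : ℂ) • ((U n : X) - (v : X) - ((n * τ : ℝ) : ℂ) • (b : X)) := by
  have hθ0 : 0 < θ := by linarith [Real.pi_pos]
  have hsub := contour_subset_cutStrip hε hθ hθπ hθε hτ hδ
  have hreg : ∀ z ∈ contour θ δ τ, Complex.exp (-z * τ) ∈ regularSet k α τ A :=
    fun z hz => hD z (hsub hz)
  have hne : ∀ z ∈ contour θ δ τ, bdfStep k τ (Complex.exp (-z * τ)) ≠ 0 :=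
    fun z hz => bdfStep_ne_zero (hreg z hz)
  set F : ℕ → X := fun l => derivAtZero (N * τ) f (l - 1) with hF
  have hcont : ∀ {Φ : ℂ → X}, (∀ ζ ∈ regularSet k α τ A, DifferentiableAt ℂ Φ ζ) →
      ContinuousOn (cqIntegrand k α τ A n Φ) (contour θ δ τ) := fun hΦ =>
    ((differentiableOn_cqIntegrand hD hΦ n).mono hsub).continuousOn
  have hdV : ∀ ζ ∈ regularSet k α τ A, DifferentiableAt ℂ (dataV k a (A v)) ζ :=
    fun ζ hζ => differentiableAt_dataV (ne_one_of_mem_regularSet hζ) a _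
  have hdB : ∀ ζ ∈ regularSet k α τ A, DifferentiableAt ℂ (dataB k τ c (A b)) ζ :=
    fun ζ hζ => differentiableAt_dataB (ne_one_of_mem_regularSet hζ) c _
  have hdF : ∀ ζ ∈ regularSet k α τ A, DifferentiableAt ℂ (dataF k τ β F) ζ :=
    fun ζ hζ => differentiableAt_dataF (ne_one_of_mem_regularSet hζ) β _
  have hdR : ∀ M, ∀ ζ ∈ regularSet k α τ A, DifferentiableAt ℂ (dataR k τ R M) ζ :=
    fun M ζ _ => differentiable_dataR R M ζ
  have eV : EqOn (integrandV k α τ A a n (A v)) (cqIntegrand k α τ A n (dataV k a (A v)))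
      (contour θ δ τ) := fun z hz => integrandV_eq hτ.ne' (hne z hz) a n _
  have eB : EqOn (integrandB k α τ A c n (A b)) (cqIntegrand k α τ A n (dataB k τ c (A b)))
      (contour θ δ τ) := fun z hz => integrandB_eq (hne z hz) c n _
  have eF : EqOn (integrandF k α τ A β n F) (cqIntegrand k α τ A n (dataF k τ β F))
      (contour θ δ τ) := fun z hz => integrandF_eq hτ.ne' (hne z hz) β n _
  have eR : EqOn (integrandR k α τ A n R)
      (cqIntegrand k α τ A n (fun ζ => bdfStep k τ ζ • genFun R ζ)) (contour θ δ τ) :=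
    fun z _ => integrandR_eq n R
  have hint : ∀ {Φ : ℂ → X}, ContinuousOn Φ (contour θ δ τ) → ContourIntegrable θ δ τ Φ :=
    contourIntegrable_of_continuousOn hθ0 hθπ hτ hδ hδτ
  -- The generating function of `R` need not extend off the contour, so it is treated as a uniform
  -- limit of polynomials there by the Weierstrass test at the leftmost point.
  have hgen : TendstoUniformlyOn
      (fun (M : ℕ) (z : ℂ) => ∑ m ∈ Finset.range M, Complex.exp (-z * τ) ^ (m + 1) • R (m + 1))
      (fun z => genFun R (Complex.exp (-z * τ))) atTop (contour θ δ τ) := by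
    refine tendstoUniformlyOn_tsum_nat
      ((summable_nat_add_iff 1).2 (hsum _ (contourEnd_mem_contour hθ0 hθπ hτ hδ hδτ)))
      fun m z hz => ?_
    rw [norm_smul, norm_smul, norm_pow, norm_pow, Complex.norm_exp, Complex.norm_exp]
    have hre : (-z * τ).re ≤ (-contourEnd θ τ * τ).re := by
      simpa using mul_le_mul_of_nonneg_right (contourEnd_re_le hθ hθπ hτ hδ hδτ hz) hτ.le
    exact mul_le_mul_of_nonneg_right
      (pow_le_pow_left₀ (Real.exp_nonneg _) (Real.exp_le_exp.2 hre) _) (norm_nonneg _)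
  have hunif : TendstoUniformlyOn (fun M => cqIntegrand k α τ A n (dataR k τ R M))
      (integrandR k α τ A n R) atTop (contour θ δ τ) := by
    set L : ℂ → X →L[ℂ] X := fun z => (τ * Complex.exp (z * (n * τ)) *
      bdfStep k τ (Complex.exp (-z * τ)) : ℂ) •
        resolventOp A (bdfStep k τ (Complex.exp (-z * τ)) ^ (α : ℂ)) with hL
    have hLc : ContinuousOn L (contour θ δ τ) := by
      intro z hz
      have hexp : DifferentiableAt ℂ (fun z : ℂ => Complex.exp (-z * τ)) z := by fun_prop
      have h1 := (differentiableAt_resolventOp_bdfStep (hreg z hz)).comp z hexp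
      have h2 : DifferentiableAt ℂ (fun z : ℂ => bdfStep k τ (Complex.exp (-z * τ))) z :=
        (differentiable_bdfStep _).comp z hexp
      have h3 : DifferentiableAt ℂ (fun z : ℂ => (τ * Complex.exp (z * (n * τ)) *
        bdfStep k τ (Complex.exp (-z * τ)) : ℂ)) z := by fun_prop
      exact (h3.smul h1).continuousAt.continuousWithinAt
    obtain ⟨C, hC⟩ := (isCompact_contour hθ0 hθπ hτ hδ hδτ).exists_bound_of_continuousOn hLc
    rw [Metric.tendstoUniformlyOn_iff] at hgen ⊢
    intro κ hκ
    filter_upwards [hgen (κ / (|C| + 1)) (by positivity)] with M hM z hz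
    have hval : ∀ Ψ : ℂ → X, cqIntegrand k α τ A n (fun ζ => bdfStep k τ ζ • Ψ ζ) z =
        L z (Ψ (Complex.exp (-z * τ))) := by
      intro Ψ
      simp only [cqIntegrand, hL, smul_apply, map_smul, smul_smul]
    rw [eR hz, hval]
    have : cqIntegrand k α τ A n (dataR k τ R M) z = _ :=
      hval fun ζ => ∑ m ∈ Finset.range M, ζ ^ (m + 1) • R (m + 1)
    rw [this, dist_eq_norm, ← map_sub]
    have h1 := hM z hz
    rw [dist_eq_norm, lt_div_iff₀ (by positivity)] at h1
    refine ((L z).le_opNorm _).trans_lt (h1.trans_le' ?_)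
    rw [mul_comm]
    gcongr
    linarith [hC z hz, le_abs_self C]
  have hRcont : ContinuousOn (integrandR k α τ A n R) (contour θ δ τ) :=
    hunif.continuousOn (Frequently.of_forall fun M => hcont (hdR M))
  refine ⟨hint ((hcont hdV).congr eV), hint ((hcont hdB).congr eB), hint ((hcont hdF).congr eF),
    hint hRcont, ?_⟩
  set W : ℕ → A.domain := fun m => U m - v - ((m * τ : ℝ) : ℂ) • b with hW
  have hAW : ∀ m : ℕ, A (W m) = A (U m) - A v - ((m * τ : ℝ) : ℂ) • A b := by
    intro m
    rw [hW, LinearPMap.map_sub, LinearPMap.map_sub, LinearPMap.map_smul]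
  have hcoe : ∀ m : ℕ, (W m : X) = (U m : X) - (v : X) - ((m * τ : ℝ) : ℂ) • (b : X) :=
    fun m => rfl
  -- Passing from `U` to `W` moves `A v + t_n A b` to the right-hand side. At index `0`, which the
  -- scheme does not cover, both sides are zero.
  have hjet : ∀ M, N ≤ M → HasJet N (fun ζ => dataV k a (A v) ζ + dataB k τ c (A b) ζ +
      dataF k τ β F ζ + dataR k τ R M ζ)
      fun m => cqDeriv k α τ (fun m => (W m : X)) m - A (W m) := by
    intro M hM
    refine (hasJet_data hk hτ hM a c β (A v) (A b) hR).congr fun m hm => ?_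
    rcases Nat.eq_zero_or_pos m with rfl | hm0
    · have hW0 : W 0 = 0 := by simp [hW, hU.1]
      simp only [cqDeriv, zero_add, Finset.range_one, Finset.sum_singleton, Nat.sub_zero, hW0,
        LinearPMap.map_zero]
      simp [primitive]
    · have := hU.2 m hm0 hm
      simp only [hcoe, hAW]
      rw [if_neg (by omega)]
      simp only [show (1 ≤ m ∧ m ≤ k - 1) ↔ m ≤ k - 1 from and_iff_right hm0]
      rw [← sub_eq_iff_eq_add'] at this
      rw [← this]
      abel
  -- The right-hand side does not involve `M`: terms of the remainder beyond index `N` do not affect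
  -- the `n`-th coefficient for `n ≤ N`.
  have htotal : ∀ M, N ≤ M → contourIntegral θ δ τ (cqIntegrand k α τ A n (dataR k τ R M)) =
      (2 * Real.pi * Complex.I : ℂ) • (W n : X) -
        (contourIntegral θ δ τ (cqIntegrand k α τ A n (dataV k a (A v))) +
        contourIntegral θ δ τ (cqIntegrand k α τ A n (dataB k τ c (A b))) +
        contourIntegral θ δ τ (cqIntegrand k α τ A n (dataF k τ β F))) := by
    intro M hM
    have h1 := contourIntegral_cqIntegrand hε hθ hθπ hθε hτ hδ hδτ h0 hD hk
      (Φ := fun ζ => dataV k a (A v) ζ + dataB k τ c (A b) ζ + dataF k τ β F ζ + dataR k τ R M ζ)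
      (fun ζ hζ => (((hdV ζ hζ).add (hdB ζ hζ)).add (hdF ζ hζ)).add (hdR M ζ hζ)) (hjet M hM) hn
    have h2 : cqIntegrand k α τ A n (fun ζ => dataV k a (A v) ζ + dataB k τ c (A b) ζ +
        dataF k τ β F ζ + dataR k τ R M ζ) = fun z =>
        cqIntegrand k α τ A n (dataV k a (A v)) z + cqIntegrand k α τ A n (dataB k τ c (A b)) z +
        cqIntegrand k α τ A n (dataF k τ β F) z + cqIntegrand k α τ A n (dataR k τ R M) z := by
      funext z
      rw [cqIntegrand_add n (fun ζ => dataV k a (A v) ζ + dataB k τ c (A b) ζ + dataF k τ β F ζ),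
        cqIntegrand_add n (fun ζ => dataV k a (A v) ζ + dataB k τ c (A b) ζ), cqIntegrand_add]
    have hcVB : ContinuousOn (fun z => cqIntegrand k α τ A n (dataV k a (A v)) z +
        cqIntegrand k α τ A n (dataB k τ c (A b)) z) (contour θ δ τ) :=
      (hcont hdV).add (hcont hdB)
    have hcVBF : ContinuousOn (fun z => cqIntegrand k α τ A n (dataV k a (A v)) z +
        cqIntegrand k α τ A n (dataB k τ c (A b)) z + cqIntegrand k α τ A n (dataF k τ β F) z)
        (contour θ δ τ) := hcVB.add (hcont hdF)
    rw [h2, contourIntegral_add (hint hcVBF) (hint (hcont (hdR M))),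
      contourIntegral_add (hint hcVB) (hint (hcont hdF)),
      contourIntegral_add (hint (hcont hdV)) (hint (hcont hdB))] at h1
    rw [← h1]
    abel
  have hRint := contourIntegral_eq_of_tendstoUniformlyOn hθ0 hθπ hτ hδ hδτ
    (f := fun M => cqIntegrand k α τ A n (dataR k τ R (M + N)))
    (fun M => hcont (hdR _)) (fun M => htotal (M + N) (Nat.le_add_left _ _))
    (fun u hu => (tendsto_add_atTop_nat N).eventually (hunif u hu))
  rw [contourIntegral_congr hθ0 hθπ hτ hδ hδτ eV, contourIntegral_congr hθ0 hθπ hτ hδ hδτ eB,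
    contourIntegral_congr hθ0 hθπ hτ hδ hδτ eF, hRint, hcoe]
  abel

end Integrands

/-! ### The representation for the Laplacian -/

/-- Under the step size condition the spectrum of the Laplacian does not meet the range of the
symbol. -/
theorem mem_regularSet_laplacian {d : ℕ} {Ω : Set (EuclideanSpace ℝ (Fin d))}
    {V : Submodule ℂ (L2Pairs Ω)} (hV : IsClosed (V : Set (L2Pairs Ω))) {k : ℕ} {α η τ : ℝ}
    (hη : 0 < η) (hτ : 0 < τ) (hcfl : CFLCondition k α η τ (laplacian V)) {ζ : ℂ}
    (hslit : bdf k ζ ∈ Complex.slitPlane)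
    (hpow : ∀ y : ℝ, 0 ≤ y → bdf k ζ ^ (α : ℂ) = -(y : ℂ) →
      criticalOrder k ≤ α ∧ cflConst α k - η < y) :
    ζ ∈ regularSet k α τ (laplacian V) := by
  have hτα : 0 < τ ^ α := Real.rpow_pos_of_pos hτ α
  refine ⟨?_, inResolventSet_laplacian hV ?_⟩
  · rw [bdfStep, div_eq_inv_mul, ← Complex.ofReal_inv]
    rw [Complex.mem_slitPlane_iff] at hslit ⊢
    rw [Complex.re_ofReal_mul, Complex.im_ofReal_mul]
    have := inv_pos.2 hτ
    exact hslit.imp (mul_pos this) (mul_ne_zero this.ne')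
  · rw [or_iff_not_imp_left, Complex.mem_slitPlane_iff, not_or, not_lt, not_not]
    rintro ⟨hre, him⟩
    have hneg : bdfStep k τ ζ ^ (α : ℂ) = -((-(bdfStep k τ ζ ^ (α : ℂ)).re : ℝ) : ℂ) := by
      apply Complex.ext <;> simp [him]
    refine ⟨_, hneg, ?_⟩
    set x : ℝ := -(bdfStep k τ ζ ^ (α : ℂ)).re with hx
    have hx0 : 0 ≤ x := neg_nonneg.2 hre
    -- Undoing the scaling by `τ` compares `τ^α x` with `c - η`; together with the step size
    -- condition this gives `r(A) < x`.
    have hbdf : bdf k ζ ^ (α : ℂ) = -((τ ^ α * x : ℝ) : ℂ) := by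
      rw [bdfStep, div_ofReal_cpow hτ, Real.rpow_neg hτ.le] at hneg
      have : ((τ ^ α : ℝ) : ℂ) ≠ 0 := by exact_mod_cast hτα.ne'
      rw [Complex.ofReal_inv, inv_mul_eq_iff_eq_mul₀ this] at hneg
      rw [hneg]
      push_cast
      ring
    obtain ⟨hcrit, hlt⟩ := hpow _ (by positivity) hbdf
    rcases hcfl with h | ⟨-, h⟩
    · exact absurd h (not_lt.2 hcrit)
    -- The truncation of `ENNReal.ofReal` at zero must be ruled out: strict monotonicity is applied
    -- below at `c - η`, which has to be nonnegative.
    have hηc : η ≤ cflConst α k := by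
      have h1 : ENNReal.ofReal η ≤ ENNReal.ofReal (cflConst α k) := le_add_self.trans h
      by_contra! hc
      exact absurd ((ENNReal.ofReal_lt_ofReal_iff hη).2 hc) (not_lt.2 h1)
    have h2 : ENNReal.ofReal (τ ^ α) * numericalRadius (laplacian V) ≤
        ENNReal.ofReal (cflConst α k - η) := by
      rw [ENNReal.ofReal_sub _ hη.le]
      exact ENNReal.le_sub_of_add_le_right ENNReal.ofReal_ne_top h
    have h3 : ENNReal.ofReal (τ ^ α) * numericalRadius (laplacian V) <
        ENNReal.ofReal (τ ^ α) * ENNReal.ofReal x := by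
      rw [← ENNReal.ofReal_mul hτα.le]
      exact h2.trans_lt ((ENNReal.ofReal_lt_ofReal_iff_of_nonneg (by linarith)).2 hlt)
    exact lt_of_mul_lt_mul_left' h3

/-- A sector of angle slightly larger than `π / 2` is contained in `{Re z > -ε |Im z|}`. -/
theorem exists_angle {ε : ℝ} (hε : 0 < ε) {φ : ℝ} (hφ : Real.pi / 2 < φ) :
    ∃ θ₀ : ℝ, Real.pi / 2 < θ₀ ∧ θ₀ ≤ φ ∧
      ∀ θ : ℝ, Real.pi / 2 < θ → θ < θ₀ → -ε * Real.sin θ < Real.cos θ := by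
  have hev : ∀ᶠ θ in 𝓝 (Real.pi / 2), -ε * Real.sin θ < Real.cos θ := by
    refine ContinuousAt.eventually_lt (by fun_prop) (by fun_prop) ?_
    simpa using hε
  obtain ⟨r, hr, hball⟩ := Metric.eventually_nhds_iff_ball.1 hev
  refine ⟨min φ (Real.pi / 2 + r), lt_min hφ (by linarith), min_le_left _ _, fun θ h1 h2 => ?_⟩
  refine hball θ ?_
  rw [Metric.mem_ball, Real.dist_eq, abs_lt]
  have := h2.trans_le (min_le_right _ _)
  constructor <;> linarith

end DiffusionWave

theorem theorem3p1 (k : ℕ) (hk1 : 1 ≤ k) (hk6 : k ≤ 6) (α : ℝ) (hα1 : 1 < α) (hα2 : α < 2)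
    (η : ℝ) (hη : 0 < η) :
    ∃ θ₀ : ℝ, Real.pi / 2 < θ₀ ∧ θ₀ ≤ Real.pi / α ∧
      ∀ θ : ℝ, Real.pi / 2 < θ → θ < θ₀ →
      ∀ (d : ℕ) (Ω : Set (EuclideanSpace ℝ (Fin d))), IsOpen Ω →
      ∀ V : Submodule ℂ (L2Pairs Ω), V ≤ H10 Ω → IsClosed (V : Set (L2Pairs Ω)) →
      ∀ (τ : ℝ) (N : ℕ), 0 < τ → CFLCondition k α η τ (laplacian V) →
      ∀ (a c : ℕ → ℂ) (β : ℕ → ℕ → ℂ) (v b : (laplacian V).domain) (f : ℝ → L2Closure V),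
        IsSource k (N * τ) f →
      ∀ U : ℕ → (laplacian V).domain,
        IsDiscreteSolution k α τ N (laplacian V) a c β v b f U →
      ∀ δ : ℝ, 0 < δ → δ < Real.pi / τ →
      ∀ R : ℕ → L2Closure V,
        (∀ n : ℕ, n ≤ N → R n = taylorRemainder k (N * τ) f (n * τ)) →
        (∀ z ∈ contour θ δ τ, Summable fun n : ℕ => ‖Complex.exp (-z * τ) ^ n • R n‖) →
      (∀ z ∈ contour θ δ τ, bdfStep k τ (Complex.exp (-z * τ)) ≠ 0 ∧
        InResolventSet (laplacian V) (bdfStep k τ (Complex.exp (-z * τ)) ^ (α : ℂ))) ∧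
      ∀ n : ℕ, 1 ≤ n → n ≤ N →
        ContourIntegrable θ δ τ
          (integrandV k α τ (laplacian V) a n (laplacian V v)) ∧
        ContourIntegrable θ δ τ
          (integrandB k α τ (laplacian V) c n (laplacian V b)) ∧
        ContourIntegrable θ δ τ
          (integrandF k α τ (laplacian V) β n (fun l => derivAtZero (N * τ) f (l - 1))) ∧
        ContourIntegrable θ δ τ (integrandR k α τ (laplacian V) n R) ∧
        (U n : L2Closure V) - (v : L2Closure V) - ((n * τ : ℝ) : ℂ) • (b : L2Closure V) =
          (1 / (2 * Real.pi * Complex.I) : ℂ) •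
              contourIntegral θ δ τ
                (integrandV k α τ (laplacian V) a n (laplacian V v)) +
          (1 / (2 * Real.pi * Complex.I) : ℂ) •
              contourIntegral θ δ τ
                (integrandB k α τ (laplacian V) c n (laplacian V b)) +
          (1 / (2 * Real.pi * Complex.I) : ℂ) •
              contourIntegral θ δ τ
                (integrandF k α τ (laplacian V) β n
                  (fun l => derivAtZero (N * τ) f (l - 1))) +
          (1 / (2 * Real.pi * Complex.I) : ℂ) •
              contourIntegral θ δ τ (integrandR k α τ (laplacian V) n R) := by
  have hπ := Real.pi_pos
  have hα0 : 0 < α := by linarith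
  have hlt : Real.pi / α < Real.pi := div_lt_self hπ hα1
  obtain ⟨ε, hε, hsymbol⟩ := exists_forall_bdf_exp_mem_slitPlane hk1 hk6 hα1 hα2 hη
  obtain ⟨θ₀, hθ₀, hθ₀α, hangle⟩ := exists_angle hε (div_lt_div_of_pos_left hπ hα0 hα2)
  refine ⟨θ₀, hθ₀, hθ₀α, fun θ hθ hθθ₀ d Ω _ V _ hV τ N hτ hcfl a c β v b f _ U hU δ hδ hδτ R hR
    hsum => ?_⟩
  have hθπ : θ < Real.pi := (hθθ₀.trans_le hθ₀α).trans hlt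
  have hθε := hangle θ hθ hθθ₀
  -- The substitution `w = zτ` maps this strip to the one of height `4`, where the symbol was
  -- studied independently of `τ`.
  have hD : ∀ z ∈ cutStrip ε (4 / τ),
      Complex.exp (-z * τ) ∈ regularSet k α τ (laplacian V) := by
    rintro z ⟨hz1, hz2⟩
    have him : |(z * τ).im| = |z.im| * τ := by
      rw [Complex.im_mul_ofReal, abs_mul, abs_of_pos hτ]
    obtain ⟨h1, h2⟩ := hsymbol (z * τ)
      (by rw [him, Complex.re_mul_ofReal]; nlinarith) (by rwa [him, ← lt_div_iff₀ hτ])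
    rw [neg_mul]
    exact mem_regularSet_laplacian hV hη hτ hcfl h1 h2
  -- The value `ζ = 0` corresponds to `Re z → ∞` and is not of the form `e^{-zτ}`. There `δ(0)^α` is
  -- positive, so it meets no point `-y` with `y ≥ 0`.
  have h0 : (0 : ℂ) ∈ regularSet k α τ (laplacian V) := by
    obtain ⟨h, hpos, he⟩ := exists_bdf_zero_eq hk1
    refine mem_regularSet_laplacian hV hη hτ hcfl (bdf_zero_mem_slitPlane hk1) fun y hy hpow => ?_
    rw [he, ← Complex.ofReal_cpow hpos.le] at hpow
    have h1 : h ^ α = -y := by exact_mod_cast hpow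
    linarith [Real.rpow_pos_of_pos hpos α]
  refine ⟨fun z hz => ?_, fun n _ hn => ?_⟩
  · have := hD z (contour_subset_cutStrip hε hθ hθπ hθε hτ hδ hz)
    exact ⟨bdfStep_ne_zero this, this.2⟩
  · obtain ⟨iV, iB, iF, iR, htotal⟩ := representation hε hθ hθπ hθε hτ hδ hδτ hk1 h0 hD hU hR
      hsum hn
    refine ⟨iV, iB, iF, iR, ?_⟩
    rw [← smul_add, ← smul_add, ← smul_add, htotal, smul_smul,
      one_div_mul_cancel Complex.two_pi_I_ne_zero, one_smul]
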